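/- Let $\square=[-\pi,\pi)^2$, $\square^*=[-\tfrac12,\tfrac12)^2$, let $\epsilon_0>1$, $\gamma=\epsilon_0-1$, and let $R\subset\mathbb R^2$ be a non-empty open set with $\overline R\subset\square$. All function spaces consist of $\mathbb C^2$-valued functions. $H^1(\square)$ has its standard norm, $H^{-1}(\square)$ is the space of bounded conjugate-linear functionals on $H^1(\square)$ with the dual norm, and for $\theta\in\square^*$, $H^1_\theta=\{e^{\mathrm i\theta\cdot y}v : v\in H^1(\square)\ \text{is } \square\text{-periodic}\}$. Write $\operatorname{div}u=u_{1,1}+u_{2,2}$, $\operatorname{curl}u=u_{2,1}-u_{1,2}$, $\nabla^\perp p=(-p_{,2},p_{,1})$, and let $$V(\theta)=\{v\in H^1_\theta : \operatorname{div}v=\operatorname{curl}v=0\ \text{in }\square\setminus R\},\qquad \mathcal H=\mathcal H(\theta)=\overline{V(\theta)}^{\,L^2(\square)}.$$ With $X(u,\phi)=\nabla^\perp u_1\cdot\overline{\nabla\phi_2}+\nabla u_2\cdot\overline{\nabla^\perp\phi_1}$ consider, for $0<\varepsilon<1$, the sesquilinear forms $$a(u,\phi)=\int_{\square\setminus R}\operatorname{div}u\,\overline{\operatorname{div}\phi}+\operatorname{curl}u\,\overline{\operatorname{curl}\phi},\qquad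 c(u,\phi)=\int_\square u\cdot\overline\phi+\gamma\int_R u_2\overline{\phi_2},$$ $$b(u,\phi)=-\frac12\int_{\square\setminus R}X(u,\phi)+\frac1\gamma\int_R\big(\nabla u_1\cdot\overline{\nabla\phi_1}+\epsilon_0\nabla u_2\cdot\overline{\nabla\phi_2}+X(u,\phi)\big),$$ $$b_\varepsilon(u,\phi)=\frac{\sqrt{1-\varepsilon}-1}{\varepsilon}\int_{\square\setminus R}X(u,\phi)+\frac1{\gamma+\varepsilon}\int_R\big(\nabla u_1\cdot\overline{\nabla\phi_1}+\epsilon_0\nabla u_2\cdot\overline{\nabla\phi_2}+\sqrt{1-\varepsilon}\,X(u,\phi)\big).$$ Let $\mathcal B_\varepsilon(\theta)$ be the operator in $(L^2(\square),c)$ generated by the form $\varepsilon^{-1}a+b_\varepsilon$ with form domain $H^1_\theta$, let $\mathcal B(\theta)$ be the operator in $(\mathcal H,c)$ generated by the form $b$ with form domain $V(\theta)$, and let $P:L^2(\square)\to\mathcal H$ be the projection that is orthogonal with respect to $c$. Here the operator generated in $(K,c)$ by a form $q$ with dense form domain $D\subset K$ maps $u\in D$ to $f\in K$ exactly when $q(u,\psi)=c(f,\psi)$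 for all $\psi\in D$. **(i)** There is a constant $C>0$ (depending only on $\epsilon_0$ and $R$) such that for all $0<\varepsilon<1$, $\theta\in\square^*$ and $F\in H^{-1}(\square)$ the problems $$U_{\varepsilon,\theta}\in H^1_\theta:\quad \varepsilon^{-1}a(U_{\varepsilon,\theta},\phi)+b_\varepsilon(U_{\varepsilon,\theta},\phi)+c(U_{\varepsilon,\theta},\phi)=\langle F,\phi\rangle\quad\forall\phi\in H^1_\theta,$$ $$V_\theta\in V(\theta):\quad b(V_\theta,\tilde V)+c(V_\theta,\tilde V)=\langle F,\tilde V\rangle\quad\forall\tilde V\in V(\theta)$$ are uniquely solvable and $$\|U_{\varepsilon,\theta}-V_\theta\|_{H^1(\square)}\le C\varepsilon\|F\|_{H^{-1}(\square)}.$$ **(ii)** There is a constant $C>0$ (depending only on $\epsilon_0$ and $R$) such that for all $\theta\in\square^*$ and $0<\varepsilon<1$ the bounded inverses $(\mathcal B_\varepsilon(\theta)+I)^{-1}$ on $L^2(\square)$ and $(\mathcal B(\theta)+I)^{-1}$ on $\mathcal H$ and the projection $P$ exist, and $$\big\|(\mathcal B_\varepsilon(\theta)+I)^{-1}-(\mathcal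 B(\theta)+I)^{-1}P\big\|_{L^2(\square)\to L^2(\square)}\le C\varepsilon.$$ -/

import Mathlib

open MeasureTheory
open scoped ContDiff ComplexConjugate

noncomputable section

namespace LightLine

/-! ### The cell and the Lebesgue space -/

abbrev Plane := EuclideanSpace ℝ (Fin 2)

abbrev C2 := EuclideanSpace ℂ (Fin 2)

/-- The periodic reference cell `[-π, π)²`. -/
def cell : Set Plane := {y | ∀ i, y i ∈ Set.Ico (-Real.pi) Real.pi}

/-- The dual cell `[-1/2, 1/2)²` of quasi-momenta. -/
def dualCell : Set Plane := {θ | ∀ i, θ i ∈ Set.Ico (-(1 / 2) : ℝ) (1 / 2)}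

/-- Lebesgue measure on the cell. For an open `R` inside the cell, integrals over `R` and over
`cell \ R` are written as integrals over `R` and `Rᶜ` with respect to this measure. -/
def cellMeasure : Measure Plane := volume.restrict cell

/-- `L²(□; ℂ²)` with its standard norm. -/
abbrev L2 := Lp C2 2 cellMeasure

/-- Triples `(u, (g₁, g₂))` with norm `(‖u‖² + ‖g₁‖² + ‖g₂‖²)^{1/2}`. -/
abbrev Jet := WithLp 2 (L2 × PiLp 2 (fun _ : Fin 2 => L2))

/-! ### Sobolev spaces -/

/-- Integration by parts over the cell, in the direction `j`, against `φ`, without boundary term: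
`∫_□ φ_{,j} u = - ∫_□ φ g_j`. -/
def IntByParts (j : Fin 2) (φ : Plane → ℝ) (w : Jet) : Prop :=
  ∫ y, (fderiv ℝ φ y (EuclideanSpace.single j 1)) • w.fst y ∂cellMeasure
    = - ∫ y, φ y • w.snd j y ∂cellMeasure

theorem measurableSet_cell : MeasurableSet cell := by
  have : cell = ⋂ i, (fun y : Plane => y i) ⁻¹' Set.Ico (-Real.pi) Real.pi := by
    ext y; simp [cell]
  rw [this]
  exact MeasurableSet.iInter fun i => measurableSet_Ico.preimage (by fun_prop)

theorem cell_subset_closedBall : cell ⊆ Metric.closedBall (0 : Plane) (2 * Real.pi) := by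
  intro y hy
  have h0 := hy 0
  have h1 := hy 1
  simp only [Set.mem_Ico] at h0 h1
  rw [mem_closedBall_zero_iff, EuclideanSpace.norm_eq]
  apply Real.sqrt_le_iff.2
  refine ⟨by positivity, ?_⟩
  simp only [Real.norm_eq_abs, sq_abs, Fin.sum_univ_two]
  nlinarith [Real.pi_pos]

instance : IsFiniteMeasure cellMeasure := by
  refine ⟨?_⟩
  rw [cellMeasure, Measure.restrict_apply_univ]
  exact lt_of_le_of_lt (measure_mono cell_subset_closedBall)
    (isCompact_closedBall (0 : Plane) _).measure_lt_top

theorem integrable_L2 (f : L2) : Integrable f cellMeasure :=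
  (Lp.memLp f).integrable (by norm_num)

theorem integrable_smul_L2 {φ : Plane → ℝ} (hφ : Continuous φ) (f : L2) :
    Integrable (fun y => φ y • f y) cellMeasure := by
  obtain ⟨C, hC⟩ := (isCompact_closedBall (0 : Plane) (2 * Real.pi)).exists_bound_of_continuousOn
    hφ.continuousOn
  refine (integrable_L2 f).bdd_smul C hφ.aestronglyMeasurable ?_
  rw [cellMeasure, ae_restrict_iff' measurableSet_cell]
  exact Filter.Eventually.of_forall fun y hy => hC y (cell_subset_closedBall hy)

theorem continuous_partial {φ : Plane → ℝ} (hφ : ContDiff ℝ ∞ φ) (j : Fin 2) :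
    Continuous fun y => fderiv ℝ φ y (EuclideanSpace.single j 1) :=
  (hφ.continuous_fderiv (by simp)).clm_apply continuous_const

theorem intByParts_zero (j : Fin 2) (φ : Plane → ℝ) : IntByParts j φ 0 := by
  unfold IntByParts
  have h : ((0 : L2) : Plane → C2) =ᵐ[cellMeasure] 0 := Lp.coeFn_zero _ _ _
  rw [integral_congr_ae (g := fun _ => 0), integral_congr_ae (f := fun y => φ y • _)
    (g := fun _ => 0)]
  · simp
  · filter_upwards [h] with y hy
    change φ y • ((0 : L2) : Plane → C2) y = 0
    rw [hy, Pi.zero_apply, smul_zero]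
  · filter_upwards [h] with y hy
    change _ • ((0 : L2) : Plane → C2) y = 0
    rw [hy, Pi.zero_apply, smul_zero]

theorem intByParts_add {j : Fin 2} {φ : Plane → ℝ} (hφ : ContDiff ℝ ∞ φ) {v w : Jet}
    (hv : IntByParts j φ v) (hw : IntByParts j φ w) : IntByParts j φ (v + w) := by
  unfold IntByParts at *
  have e1 : ∫ y, (fderiv ℝ φ y (EuclideanSpace.single j 1)) • (v + w).fst y ∂cellMeasure
      = ∫ y, (fderiv ℝ φ y (EuclideanSpace.single j 1)) • v.fst y ∂cellMeasure
        + ∫ y, (fderiv ℝ φ y (EuclideanSpace.single j 1)) • w.fst y ∂cellMeasure := by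
    rw [← integral_add (integrable_smul_L2 (continuous_partial hφ j) _)
      (integrable_smul_L2 (continuous_partial hφ j) _)]
    refine integral_congr_ae ?_
    filter_upwards [Lp.coeFn_add v.fst w.fst] with y hy
    rw [← smul_add]
    exact congrArg _ hy
  have e2 : ∫ y, φ y • (v + w).snd j y ∂cellMeasure
      = ∫ y, φ y • v.snd j y ∂cellMeasure + ∫ y, φ y • w.snd j y ∂cellMeasure := by
    rw [← integral_add (integrable_smul_L2 hφ.continuous _) (integrable_smul_L2 hφ.continuous _)]
    refine integral_congr_ae ?_
    filter_upwards [Lp.coeFn_add (v.snd j) (w.snd j)] with y hy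
    rw [← smul_add]
    exact congrArg _ hy
  rw [e1, e2, hv, hw, neg_add]

theorem intByParts_smul {j : Fin 2} {φ : Plane → ℝ} (a : ℂ) {v : Jet}
    (hv : IntByParts j φ v) : IntByParts j φ (a • v) := by
  unfold IntByParts at *
  have e1 : ∫ y, (fderiv ℝ φ y (EuclideanSpace.single j 1)) • (a • v).fst y ∂cellMeasure
      = a • ∫ y, (fderiv ℝ φ y (EuclideanSpace.single j 1)) • v.fst y ∂cellMeasure := by
    rw [← integral_smul]
    refine integral_congr_ae ?_
    filter_upwards [Lp.coeFn_smul a v.fst] with y hy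
    rw [smul_comm a]
    exact congrArg _ hy
  have e2 : ∫ y, φ y • (a • v).snd j y ∂cellMeasure
      = a • ∫ y, φ y • v.snd j y ∂cellMeasure := by
    rw [← integral_smul]
    refine integral_congr_ae ?_
    filter_upwards [Lp.coeFn_smul a (v.snd j)] with y hy
    rw [smul_comm a]
    exact congrArg _ hy
  rw [e1, e2, hv, smul_neg]

/-- `H¹(□; ℂ²)`: fields in `L²(□; ℂ²)` together with their weak partial derivatives, which are
in `L²(□; ℂ²)`. The norm is the standard one, `(‖u‖² + ‖u_{,1}‖² + ‖u_{,2}‖²)^{1/2}`. -/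
def H1 : Submodule ℂ Jet where
  carrier := {w | ∀ (j : Fin 2) (φ : Plane → ℝ), ContDiff ℝ ∞ φ → HasCompactSupport φ →
    tsupport φ ⊆ interior cell → IntByParts j φ w}
  zero_mem' := fun j φ _ _ _ => intByParts_zero j φ
  add_mem' := fun hv hw j φ h1 h2 h3 => intByParts_add h1 (hv j φ h1 h2 h3) (hw j φ h1 h2 h3)
  smul_mem' := fun a _ hv j φ h1 h2 h3 => intByParts_smul a (hv j φ h1 h2 h3)

/-- `φ` is periodic with respect to the cell. -/
def IsCellPeriodic (φ : Plane → ℝ) : Prop :=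
  ∀ (i : Fin 2) (y : Plane), φ (y + EuclideanSpace.single i (2 * Real.pi)) = φ y

/-- `H¹_per(□; ℂ²)`: the `□`-periodic elements of `H¹(□; ℂ²)`. Periodicity (equality of traces on
opposite sides, or equivalently the periodic extension being in `H¹_loc(ℝ²)`) says that
integration by parts over the cell against smooth periodic functions has no boundary term. -/
def H1per : Submodule ℂ H1 where
  carrier := {w | ∀ (j : Fin 2) (φ : Plane → ℝ), ContDiff ℝ ∞ φ → IsCellPeriodic φ →
    IntByParts j φ w.1}
  zero_mem' := fun j φ _ _ => intByParts_zero j φ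
  add_mem' := fun hv hw j φ h1 h2 => intByParts_add h1 (hv j φ h1 h2) (hw j φ h1 h2)
  smul_mem' := fun a _ hv j φ h1 h2 => intByParts_smul a (hv j φ h1 h2)

/-- The underlying field of an element of `H¹(□; ℂ²)`. -/
def toL2 : H1 →ₗ[ℂ] L2 where
  toFun w := w.1.fst
  map_add' _ _ := rfl
  map_smul' _ _ := rfl

/-- The weak partial derivative `w_{,j}`. -/
def pd (w : H1) (j : Fin 2) : L2 := w.1.snd j

theorem pd_add (v w : H1) (j : Fin 2) : pd (v + w) j = pd v j + pd w j := rfl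

theorem pd_smul (a : ℂ) (w : H1) (j : Fin 2) : pd (a • w) j = a • pd w j := rfl

/-- The Bloch factor `e^{i θ·y}`. -/
def bloch (θ y : Plane) : ℂ := Complex.exp (Complex.I * ((∑ i, θ i * y i : ℝ) : ℂ))

/-- `H¹_θ(□; ℂ²) = {e^{i θ·y} v | v ∈ H¹_per(□; ℂ²)}`. -/
def H1theta (θ : Plane) : Submodule ℂ H1 where
  carrier := {w | ∃ v ∈ H1per, toL2 w =ᵐ[cellMeasure] fun y => bloch θ y • toL2 v y}
  zero_mem' := by
    refine ⟨0, H1per.zero_mem, ?_⟩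
    rw [map_zero]
    filter_upwards [Lp.coeFn_zero C2 2 cellMeasure] with y hy
    rw [hy, Pi.zero_apply, smul_zero]
  add_mem' := by
    rintro w w' ⟨v, hv, h⟩ ⟨v', hv', h'⟩
    refine ⟨v + v', H1per.add_mem hv hv', ?_⟩
    rw [map_add, map_add]
    filter_upwards [Lp.coeFn_add (toL2 w) (toL2 w'), Lp.coeFn_add (toL2 v) (toL2 v'), h, h']
      with y h1 h2 h3 h4
    rw [h1, h2, Pi.add_apply, Pi.add_apply, h3, h4, smul_add]
  smul_mem' := by
    rintro a w ⟨v, hv, h⟩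
    refine ⟨a • v, H1per.smul_mem a hv, ?_⟩
    rw [map_smul, map_smul]
    filter_upwards [Lp.coeFn_smul a (toL2 w), Lp.coeFn_smul a (toL2 v), h] with y h1 h2 h3
    rw [h1, h2, Pi.smul_apply, Pi.smul_apply, h3, smul_comm]

/-! ### Differential expressions -/

/-- `div w = w_{1,1} + w_{2,2}`. -/
def divg (w : H1) (y : Plane) : ℂ := pd w 0 y 0 + pd w 1 y 1

/-- `curl w = w_{2,1} - w_{1,2}`. -/
def curl (w : H1) (y : Plane) : ℂ := pd w 0 y 1 - pd w 1 y 0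

/-- The gradient of the component `w_i`. -/
def grad (w : H1) (i : Fin 2) (y : Plane) : Fin 2 → ℂ := ![pd w 0 y i, pd w 1 y i]

/-- The rotated gradient `∇^⊥ w_i = (-w_{i,2}, w_{i,1})`. -/
def gradPerp (w : H1) (i : Fin 2) (y : Plane) : Fin 2 → ℂ := ![-pd w 1 y i, pd w 0 y i]

/-- The component `f_i` of a field. -/
def comp (f : L2) (i : Fin 2) (y : Plane) : ℂ := f y i

/-- `p · conj q`. -/
def dot (p q : Fin 2 → ℂ) : ℂ := ∑ j, p j * conj (q j)

/-- `∇^⊥ u_1 · conj (∇ φ_2) + ∇ u_2 · conj (∇^⊥ φ_1)`. -/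
def cross (u φ : H1) (y : Plane) : ℂ :=
  dot (gradPerp u 0 y) (grad φ 1 y) + dot (grad u 1 y) (gradPerp φ 0 y)

theorem integrable_coord_mul (f g : L2) (i j : Fin 2) :
    Integrable (fun y => f y i * conj (g y j)) cellMeasure := by
  have hf : MemLp (fun y => f y i) 2 cellMeasure :=
    (EuclideanSpace.proj (𝕜 := ℂ) i : C2 →L[ℂ] ℂ).comp_memLp' (Lp.memLp f)
  have hg : MemLp (fun y => conj (g y j)) 2 cellMeasure :=
    ((EuclideanSpace.proj (𝕜 := ℂ) j : C2 →L[ℂ] ℂ).comp_memLp' (Lp.memLp g)).star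
  exact hf.integrable_mul hg

theorem ae_pd_add (v w : H1) : ∀ᵐ y ∂cellMeasure, ∀ j i,
    pd (v + w) j y i = pd v j y i + pd w j y i := by
  refine ae_all_iff.2 fun j => ?_
  rw [pd_add]
  filter_upwards [Lp.coeFn_add (pd v j) (pd w j)] with y hy i
  rw [hy]; rfl

theorem ae_pd_smul (a : ℂ) (w : H1) : ∀ᵐ y ∂cellMeasure, ∀ j i,
    pd (a • w) j y i = a * pd w j y i := by
  refine ae_all_iff.2 fun j => ?_
  rw [pd_smul]
  filter_upwards [Lp.coeFn_smul a (pd w j)] with y hy i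
  rw [hy]; rfl

theorem integrable_cross (u φ : H1) : Integrable (cross u φ) cellMeasure := by
  have h := fun i j k l => integrable_coord_mul (pd u i) (pd φ j) k l
  have : cross u φ = fun y =>
      (-(pd u 1 y 0 * conj (pd φ 0 y 1)) + pd u 0 y 0 * conj (pd φ 1 y 1))
      + (-(pd u 0 y 1 * conj (pd φ 1 y 0)) + pd u 1 y 1 * conj (pd φ 0 y 0)) := by
    funext y
    simp [cross, dot, grad, gradPerp, Fin.sum_univ_two]
  rw [this]
  exact ((h 1 0 0 1).neg.add (h 0 1 0 1)).add ((h 0 1 1 0).neg.add (h 1 0 1 0))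

theorem integrable_grad (u φ : H1) (i : Fin 2) :
    Integrable (fun y => dot (grad u i y) (grad φ i y)) cellMeasure := by
  have h := fun i j k l => integrable_coord_mul (pd u i) (pd φ j) k l
  have : (fun y => dot (grad u i y) (grad φ i y)) = fun y =>
      pd u 0 y i * conj (pd φ 0 y i) + pd u 1 y i * conj (pd φ 1 y i) := by
    funext y
    simp [dot, grad, Fin.sum_univ_two]
  rw [this]
  exact (h 0 0 i i).add (h 1 1 i i)

theorem integrable_divCurl (u φ : H1) :
    Integrable (fun y => divg u y * conj (divg φ y) + curl u y * conj (curl φ y)) cellMeasure := by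
  have h := fun i j k l => integrable_coord_mul (pd u i) (pd φ j) k l
  have : (fun y => divg u y * conj (divg φ y) + curl u y * conj (curl φ y)) = fun y =>
      ((pd u 0 y 0 * conj (pd φ 0 y 0) + pd u 0 y 0 * conj (pd φ 1 y 1))
        + (pd u 1 y 1 * conj (pd φ 0 y 0) + pd u 1 y 1 * conj (pd φ 1 y 1)))
      + ((pd u 0 y 1 * conj (pd φ 0 y 1) - pd u 0 y 1 * conj (pd φ 1 y 0))
        - (pd u 1 y 0 * conj (pd φ 0 y 1) - pd u 1 y 0 * conj (pd φ 1 y 0))) := by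
    funext y
    simp only [divg, curl, map_add, map_sub]
    ring
  rw [this]
  exact (((h 0 0 0 0).add (h 0 1 0 1)).add ((h 1 0 1 0).add (h 1 1 1 1))).add
    (((h 0 0 1 1).sub (h 0 1 1 0)).sub ((h 1 0 0 1).sub (h 1 1 0 0)))

/-- A form `∫_S q(u, φ)` whose density is linear in the first argument is linear in it. -/
def formOfDensity (S : Set Plane) (q : H1 → H1 → Plane → ℂ)
    (hq : ∀ u φ, Integrable (q u φ) cellMeasure)
    (hadd : ∀ u v φ, ∀ᵐ y ∂cellMeasure, q (u + v) φ y = q u φ y + q v φ y)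
    (hsmul : ∀ (a : ℂ) u φ, ∀ᵐ y ∂cellMeasure, q (a • u) φ y = a * q u φ y) :
    H1 →ₗ[ℂ] (H1 → ℂ) where
  toFun u φ := ∫ y in S, q u φ y ∂cellMeasure
  map_add' u v := by
    funext φ
    rw [Pi.add_apply, ← integral_add (hq u φ).restrict (hq v φ).restrict]
    exact integral_congr_ae (ae_restrict_of_ae (hadd u v φ))
  map_smul' a u := by
    funext φ
    rw [RingHom.id_apply, Pi.smul_apply, smul_eq_mul, ← integral_const_mul]
    exact integral_congr_ae (ae_restrict_of_ae (hsmul a u φ))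

/-! ### The forms `a`, `b`, `b_ε` and `c`

Each is linear in its first argument (and conjugate-linear in its second one). -/

/-- `a(u, φ) = ∫_{□∖R} div u conj(div φ) + curl u conj(curl φ)`. -/
def aForm (R : Set Plane) : H1 →ₗ[ℂ] (H1 → ℂ) :=
  formOfDensity Rᶜ (fun u φ y => divg u y * conj (divg φ y) + curl u y * conj (curl φ y))
    integrable_divCurl
    (fun u v φ => by
      filter_upwards [ae_pd_add u v] with y hy
      simp only [divg, curl, hy]; ring)
    (fun a u φ => by
      filter_upwards [ae_pd_smul a u] with y hy
      simp only [divg, curl, hy]; ring)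

/-- `∫_S ∇^⊥ u_1 · conj (∇ φ_2) + ∇ u_2 · conj (∇^⊥ φ_1)`. -/
def crossForm (S : Set Plane) : H1 →ₗ[ℂ] (H1 → ℂ) :=
  formOfDensity S cross integrable_cross
    (fun u v φ => by
      filter_upwards [ae_pd_add u v] with y hy
      simp [cross, dot, grad, gradPerp, hy, Fin.sum_univ_two]; ring)
    (fun a u φ => by
      filter_upwards [ae_pd_smul a u] with y hy
      simp [cross, dot, grad, gradPerp, hy, Fin.sum_univ_two]; ring)

/-- `∫_S ∇ u_i · conj (∇ φ_i)`. -/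
def gradForm (S : Set Plane) (i : Fin 2) : H1 →ₗ[ℂ] (H1 → ℂ) :=
  formOfDensity S (fun u φ y => dot (grad u i y) (grad φ i y)) (fun u φ => integrable_grad u φ i)
    (fun u v φ => by
      filter_upwards [ae_pd_add u v] with y hy
      simp [dot, grad, hy, Fin.sum_univ_two]; ring)
    (fun a u φ => by
      filter_upwards [ae_pd_smul a u] with y hy
      simp [dot, grad, hy, Fin.sum_univ_two]; ring)

/-- `b(u, φ) = -½ ∫_{□∖R} (∇^⊥ u_1 · conj ∇φ_2 + ∇u_2 · conj ∇^⊥φ_1)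
  + γ⁻¹ ∫_R (∇u_1 · conj ∇φ_1 + ε₀ ∇u_2 · conj ∇φ_2
    + ∇^⊥ u_1 · conj ∇φ_2 + ∇u_2 · conj ∇^⊥φ_1)`, where `γ = ε₀ - 1`. -/
def bForm (ε₀ : ℝ) (R : Set Plane) : H1 →ₗ[ℂ] (H1 → ℂ) :=
  (-(1 / 2) : ℂ) • crossForm Rᶜ
    + (((ε₀ - 1)⁻¹ : ℝ) : ℂ) • (gradForm R 0 + (ε₀ : ℂ) • gradForm R 1 + crossForm R)

/-- `b_ε(u, φ) = ((√(1-ε) - 1)/ε) ∫_{□∖R} (∇^⊥ u_1 · conj ∇φ_2 + ∇u_2 · conj ∇^⊥φ_1)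
  + (γ+ε)⁻¹ ∫_R (∇u_1 · conj ∇φ_1 + ε₀ ∇u_2 · conj ∇φ_2
    + √(1-ε) (∇^⊥ u_1 · conj ∇φ_2 + ∇u_2 · conj ∇^⊥φ_1))`, where `γ = ε₀ - 1`. -/
def bEpsForm (ε₀ : ℝ) (R : Set Plane) (ε : ℝ) : H1 →ₗ[ℂ] (H1 → ℂ) :=
  (((Real.sqrt (1 - ε) - 1) / ε : ℝ) : ℂ) • crossForm Rᶜ
    + (((ε₀ - 1 + ε)⁻¹ : ℝ) : ℂ) • (gradForm R 0 + (ε₀ : ℂ) • gradForm R 1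
        + ((Real.sqrt (1 - ε) : ℝ) : ℂ) • crossForm R)

/-- `ε⁻¹ a + b_ε`. -/
def epsForm (ε₀ : ℝ) (R : Set Plane) (ε : ℝ) : H1 →ₗ[ℂ] (H1 → ℂ) :=
  ((ε⁻¹ : ℝ) : ℂ) • aForm R + bEpsForm ε₀ R ε

/-- `c(u, φ) = ∫_□ u · conj φ + γ ∫_R u_2 conj φ_2`, where `γ = ε₀ - 1`. -/
def cForm (ε₀ : ℝ) (R : Set Plane) : L2 →ₗ[ℂ] (L2 → ℂ) where
  toFun u φ := ∫ y, (comp u 0 y * conj (comp φ 0 y) + comp u 1 y * conj (comp φ 1 y)) ∂cellMeasure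
    + ((ε₀ - 1 : ℝ) : ℂ) * ∫ y in R, comp u 1 y * conj (comp φ 1 y) ∂cellMeasure
  map_add' u v := by
    funext φ
    have h : ∀ (u : L2) i, Integrable (fun y => comp u i y * conj (comp φ i y)) cellMeasure :=
      fun u i => integrable_coord_mul u φ i i
    have e1 : ∫ y, (comp (u + v) 0 y * conj (comp φ 0 y) + comp (u + v) 1 y * conj (comp φ 1 y)) ∂cellMeasure
        = ∫ y, (comp u 0 y * conj (comp φ 0 y) + comp u 1 y * conj (comp φ 1 y)) ∂cellMeasure
          + ∫ y, (comp v 0 y * conj (comp φ 0 y) + comp v 1 y * conj (comp φ 1 y)) ∂cellMeasure := by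
      have hs : ∀ u : L2, Integrable (fun y => comp u 0 y * conj (comp φ 0 y)
          + comp u 1 y * conj (comp φ 1 y)) cellMeasure := fun u => (h u 0).add (h u 1)
      rw [← integral_add (hs u) (hs v)]
      refine integral_congr_ae ?_
      filter_upwards [Lp.coeFn_add u v] with y hy
      simp only [comp, hy, Pi.add_apply, PiLp.add_apply]; ring
    have e2 : ∫ y in R, comp (u + v) 1 y * conj (comp φ 1 y) ∂cellMeasure
        = ∫ y in R, comp u 1 y * conj (comp φ 1 y) ∂cellMeasure
          + ∫ y in R, comp v 1 y * conj (comp φ 1 y) ∂cellMeasure := by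
      rw [← integral_add (h u 1).restrict (h v 1).restrict]
      refine integral_congr_ae (ae_restrict_of_ae ?_)
      filter_upwards [Lp.coeFn_add u v] with y hy
      simp only [comp, hy, Pi.add_apply, PiLp.add_apply]; ring
    rw [Pi.add_apply, e1, e2]; ring
  map_smul' a u := by
    funext φ
    have e1 : ∫ y, (comp (a • u) 0 y * conj (comp φ 0 y) + comp (a • u) 1 y * conj (comp φ 1 y)) ∂cellMeasure
        = a * ∫ y, (comp u 0 y * conj (comp φ 0 y) + comp u 1 y * conj (comp φ 1 y)) ∂cellMeasure := by
      rw [← integral_const_mul]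
      refine integral_congr_ae ?_
      filter_upwards [Lp.coeFn_smul a u] with y hy
      simp only [comp, hy, Pi.smul_apply, PiLp.smul_apply, smul_eq_mul]; ring
    have e2 : ∫ y in R, comp (a • u) 1 y * conj (comp φ 1 y) ∂cellMeasure
        = a * ∫ y in R, comp u 1 y * conj (comp φ 1 y) ∂cellMeasure := by
      rw [← integral_const_mul]
      refine integral_congr_ae (ae_restrict_of_ae ?_)
      filter_upwards [Lp.coeFn_smul a u] with y hy
      simp only [comp, hy, Pi.smul_apply, PiLp.smul_apply, smul_eq_mul]; ring
    rw [RingHom.id_apply, Pi.smul_apply, smul_eq_mul, e1, e2]; ring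

/-! ### The constrained spaces -/

/-- `V(θ) = {v ∈ H¹_θ(□; ℂ²) | div v = 0 and curl v = 0 in □∖R}`. -/
def V (R : Set Plane) (θ : Plane) : Submodule ℂ H1 where
  carrier := {v | v ∈ H1theta θ ∧
    ∀ᵐ y ∂(cellMeasure.restrict Rᶜ), divg v y = 0 ∧ curl v y = 0}
  zero_mem' := by
    refine ⟨(H1theta θ).zero_mem, ae_restrict_of_ae ?_⟩
    filter_upwards [ae_pd_smul 0 0] with y hy
    simp only [zero_smul, zero_mul] at hy
    simp [divg, curl, hy]
  add_mem' := by
    rintro v w ⟨hv, h⟩ ⟨hw, h'⟩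
    refine ⟨(H1theta θ).add_mem hv hw, ?_⟩
    filter_upwards [h, h', ae_restrict_of_ae (ae_pd_add v w)] with y h1 h2 hy
    simp only [divg, curl] at h1 h2 ⊢
    simp only [hy]
    exact ⟨by linear_combination h1.1 + h2.1, by linear_combination h1.2 + h2.2⟩
  smul_mem' := by
    rintro a v ⟨hv, h⟩
    refine ⟨(H1theta θ).smul_mem a hv, ?_⟩
    filter_upwards [h, ae_restrict_of_ae (ae_pd_smul a v)] with y h1 hy
    simp only [divg, curl] at h1 ⊢
    simp only [hy]
    exact ⟨by linear_combination a * h1.1, by linear_combination a * h1.2⟩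

/-- `ℋ`, the closure of `V(θ)` in `L²(□; ℂ²)`. -/
def Hspace (R : Set Plane) (θ : Plane) : Submodule ℂ L2 :=
  ((V R θ).map toL2).topologicalClosure

/-! ### Operators generated by forms -/

/-- The graph of the operator generated by the form `q` with form domain `D` in the Hilbert space
`(K, c)`, where `ι` is the inclusion of `K` into `L²`: the pairs `(u, f)` in `K × K` such that
`u` lies in `D` and `q(u, ψ) = c(f, ψ)` for all `ψ` in `D`. -/
def formGraph {K : Type*} [AddCommGroup K] [Module ℂ K] (ι : K →ₗ[ℂ] L2)
    (D : Submodule ℂ H1) (q : H1 →ₗ[ℂ] (H1 → ℂ)) (c : L2 →ₗ[ℂ] (L2 → ℂ)) :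
    Submodule ℂ (K × K) where
  carrier := {p | ∃ w ∈ D, toL2 w = ι p.1 ∧ ∀ ψ ∈ D, q w ψ = c (ι p.2) (toL2 ψ)}
  zero_mem' := ⟨0, D.zero_mem, by simp, fun ψ _ => by simp⟩
  add_mem' := by
    rintro p p' ⟨w, hw, h1, h2⟩ ⟨w', hw', h1', h2'⟩
    refine ⟨w + w', D.add_mem hw hw', by simp [h1, h1'], fun ψ hψ => ?_⟩
    simp [h2 ψ hψ, h2' ψ hψ]
  smul_mem' := by
    rintro a p ⟨w, hw, h1, h2⟩
    refine ⟨a • w, D.smul_mem a hw, by simp [h1], fun ψ hψ => ?_⟩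
    simp [h2 ψ hψ]

/-- `ℬ_ε(θ)`: the operator in `(L²(□; ℂ²), c)` generated by `ε⁻¹ a + b_ε` with form domain
`H¹_θ(□; ℂ²)`, which is dense, so that the graph is single-valued. -/
def Beps (ε₀ : ℝ) (R : Set Plane) (ε : ℝ) (θ : Plane) : L2 →ₗ.[ℂ] L2 :=
  (formGraph LinearMap.id (H1theta θ) (epsForm ε₀ R ε) (cForm ε₀ R)).toLinearPMap

/-- `ℬ(θ)`: the operator in `(ℋ, c)` generated by `b` with form domain `V(θ)`, which is dense in
`ℋ`, so that the graph is single-valued. -/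
def B (ε₀ : ℝ) (R : Set Plane) (θ : Plane) : Hspace R θ →ₗ.[ℂ] Hspace R θ :=
  (formGraph (Hspace R θ).subtype (V R θ) (bForm ε₀ R) (cForm ε₀ R)).toLinearPMap

/-- `S = (T + I)⁻¹`, as an everywhere defined bounded operator. -/
def IsResolvent {K : Type*} [NormedAddCommGroup K] [NormedSpace ℂ K] (T : K →ₗ.[ℂ] K)
    (S : K →L[ℂ] K) : Prop :=
  (∀ f, ∃ h : S f ∈ T.domain, T ⟨S f, h⟩ + S f = f) ∧ ∀ u : T.domain, S (T u + u) = u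

/-- `P` is the projection of `L²(□; ℂ²)` onto `K` that is orthogonal with respect to `c`. -/
def IsOrthogonalProjection (c : L2 →ₗ[ℂ] (L2 → ℂ)) (K : Submodule ℂ L2) (P : L2 →L[ℂ] K) :
    Prop :=
  ∀ f, ∀ h ∈ K, c (f - P f) h = 0

/-- `H⁻¹(□; ℂ²)`: the bounded conjugate-linear functionals on `H¹(□; ℂ²)`, with the dual norm. -/
abbrev Hneg1 := H1 →L⋆[ℂ] ℂ

/-- `U ∈ H¹_θ` and `ε⁻¹ a(U, φ) + b_ε(U, φ) + c(U, φ) = ⟨F, φ⟩` for all `φ ∈ H¹_θ`. -/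
def SolvesEps (ε₀ : ℝ) (R : Set Plane) (ε : ℝ) (θ : Plane) (F : Hneg1) (U : H1) : Prop :=
  U ∈ H1theta θ ∧ ∀ φ ∈ H1theta θ, epsForm ε₀ R ε U φ + cForm ε₀ R (toL2 U) (toL2 φ) = F φ

/-- `W ∈ V(θ)` and `b(W, ψ) + c(W, ψ) = ⟨F, ψ⟩` for all `ψ ∈ V(θ)`. -/
def SolvesLimit (ε₀ : ℝ) (R : Set Plane) (θ : Plane) (F : Hneg1) (W : H1) : Prop :=
  W ∈ V R θ ∧ ∀ ψ ∈ V R θ, bForm ε₀ R W ψ + cForm ε₀ R (toL2 W) (toL2 ψ) = F ψ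

end LightLine

end

/-!
The theorem is a resolvent estimate for a singularly perturbed family of forms, in which the
singular part `ε⁻¹ a` penalises the divergence and the curl outside `R`. Three facts carry it; the
error estimate that follows from them holds in any Hilbert space.

* Uniform coercivity. The identity `|div u|² + |curl u|² = |∇u|² + X(u, u)` (`divCurl_re_eq`)
  turns the density of `ε⁻¹ a + b_ε` outside `R` into `ε⁻¹ (|∇u|² + √(1-ε) X(u, u))`, which is at
  least `½ |∇u|²` because `X(u, u) ≥ -|∇u|²`. Inside `R`, completing the square with the weight
  `√ε₀` gives a similar bound, since `ε₀ > 1`. Together with `c` the forms control the norm of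
  `H¹` with a constant independent of `ε` and `θ` (`epsForm_coercive`), and so does the limit form
  `b + c` on `V(θ)` (`b_coercive`). Solvability is then the Lax–Milgram lemma.

* The gap inequality. Every `u` in `H¹_θ` has a distance to `V(θ)` whose square is at most a
  constant times `a(u, u)`, uniformly in `θ` (`exists_mem_V_norm_sub_le`). Set
  `h = (div u, curl u)` outside `R`; a solution `z` in `H¹_θ` of `(div z, curl z) = h` outside `R`
  with `‖z‖ ≤ C ‖h‖` gives the element `u - z` of `V(θ)`. In the Fourier basis
  `e^{i(k+θ)·y} (1, ± i)` the div–curl operator is diagonal with entries of modulus `|k + θ|`,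
  which is at least `1/2` unless `k = 0`. The values of `h` inside `R` are free, and as `R` has
  positive measure they can be used to remove the two modes with `k = 0`. The Fourier basis comes
  from the one of the torus (`fourierBasis`), and `H¹_θ` is characterised by Fourier coefficients
  (`mem_H1theta_iff`).

* Consistency. The coefficients of `b_ε` converge to those of `b` at the rate `ε`
  (`norm_bEps_sub_b_le`).

For the solutions `U` and `W` of the two problems, write `U - W = v + z` with `v` in `V(θ)` and
`‖z‖² ≤ K a(U - W, U - W)`. Testing the equation of `U - W` with `v`, where the singular term
disappears, bounds `‖v‖` by `C (ε + ‖z‖)`. Testing with `U - W` bounds `ε⁻¹ a(U - W, U - W)` by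
`C (ε ‖v‖ + ‖z‖)`. Hence `‖z‖² ≤ C ε (ε² + ‖z‖)`, so that `z` and `v` are `O(ε)`
(`norm_sub_le_of_gap`).

For the operators, the resolvents are the solution operators for the functionals `c(f, ·)`
(`isResolvent_formGraph`), and `f` and `P f` define the same functional on `V(θ)`, so that the
estimate of the resolvents is the estimate of the solutions.
-/

noncomputable section

namespace LightLine

/-! ### Hermitian forms on a Hilbert space -/

section Abstract

variable {E : Type*} [NormedAddCommGroup E] [InnerProductSpace ℂ E]

/-- `q` is Hermitian and bounded with constant `M`. -/
structure IsHermitianForm (q : E →ₗ[ℂ] (E → ℂ)) (M : ℝ) : Prop where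
  symm : ∀ u v, q v u = conj (q u v)
  bound : ∀ u v, ‖q u v‖ ≤ M * ‖u‖ * ‖v‖

namespace IsHermitianForm

variable {q q' : E →ₗ[ℂ] (E → ℂ)} {M M' : ℝ}

theorem map_add_right (hq : IsHermitianForm q M) (u v w : E) : q u (v + w) = q u v + q u w := by
  rw [hq.symm (v + w) u, hq.symm v u, hq.symm w u, map_add, Pi.add_apply, map_add]

theorem map_smul_right (hq : IsHermitianForm q M) (a : ℂ) (u v : E) :
    q u (a • v) = conj a * q u v := by
  rw [hq.symm (a • v) u, hq.symm v u, map_smul, Pi.smul_apply, smul_eq_mul, map_mul]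

theorem add (hq : IsHermitianForm q M) (hq' : IsHermitianForm q' M') :
    IsHermitianForm (q + q') (M + M') where
  symm u v := by
    simp only [LinearMap.add_apply, Pi.add_apply, map_add, hq.symm u v, hq'.symm u v]
  bound u v := by
    calc ‖q u v + q' u v‖ ≤ ‖q u v‖ + ‖q' u v‖ := norm_add_le _ _
      _ ≤ M * ‖u‖ * ‖v‖ + M' * ‖u‖ * ‖v‖ := add_le_add (hq.bound u v) (hq'.bound u v)
      _ = (M + M') * ‖u‖ * ‖v‖ := by ring

theorem smul (hq : IsHermitianForm q M) (r : ℝ) : IsHermitianForm ((r : ℂ) • q) (|r| * M) where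
  symm u v := by
    simp only [LinearMap.smul_apply, Pi.smul_apply, smul_eq_mul, map_mul, Complex.conj_ofReal,
      hq.symm u v]
  bound u v := by
    simp only [LinearMap.smul_apply, Pi.smul_apply, smul_eq_mul, norm_mul, Complex.norm_real,
      Real.norm_eq_abs]
    calc |r| * ‖q u v‖ ≤ |r| * (M * ‖u‖ * ‖v‖) :=
          mul_le_mul_of_nonneg_left (hq.bound u v) (abs_nonneg r)
      _ = |r| * M * ‖u‖ * ‖v‖ := by ring

theorem mono (hq : IsHermitianForm q M) (h : M ≤ M') : IsHermitianForm q M' where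
  symm := hq.symm
  bound u v := (hq.bound u v).trans (by gcongr)

/-- A Hermitian form that is bounded by the sum of squares is bounded by the product, because both
sides can be rescaled. -/
theorem of_le_add_sq (hs : ∀ u v, q v u = conj (q u v))
    (hb : ∀ u v, ‖q u v‖ ≤ M * (‖u‖ ^ 2 + ‖v‖ ^ 2)) : IsHermitianForm q (2 * M) where
  symm := hs
  bound u v := by
    have hsm : ∀ (a : ℂ) u v, q u (a • v) = conj a * q u v := fun a u v => by
      rw [hs (a • v) u, hs v u, map_smul, Pi.smul_apply, smul_eq_mul, map_mul]
    rcases eq_or_ne u 0 with rfl | hu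
    · simp
    rcases eq_or_ne v 0 with rfl | hv
    · have := hsm 0 u 0
      simp only [zero_smul, map_zero, zero_mul] at this
      simp [this]
    have hu' := norm_pos_iff.2 hu
    have hv' := norm_pos_iff.2 hv
    have h := hb (((‖u‖⁻¹ : ℝ) : ℂ) • u) (((‖v‖⁻¹ : ℝ) : ℂ) • v)
    rw [hsm, map_smul, Pi.smul_apply, smul_eq_mul, norm_mul, norm_mul, norm_smul, norm_smul,
      Complex.conj_ofReal, Complex.norm_real, Complex.norm_real, norm_inv, norm_inv, norm_norm,
      norm_norm, inv_mul_cancel₀ hu'.ne', inv_mul_cancel₀ hv'.ne'] at h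
    have h2 : ‖q u v‖ = ‖u‖ * ‖v‖ * (‖v‖⁻¹ * (‖u‖⁻¹ * ‖q u v‖)) := by field_simp
    rw [h2]
    calc ‖u‖ * ‖v‖ * (‖v‖⁻¹ * (‖u‖⁻¹ * ‖q u v‖)) ≤ ‖u‖ * ‖v‖ * (M * (1 ^ 2 + 1 ^ 2)) := by gcongr
      _ = 2 * M * ‖u‖ * ‖v‖ := by ring

/-- The Lax–Milgram lemma on a complete subspace. -/
theorem exists_solution (hq : IsHermitianForm q M) {D : Submodule ℂ E} [CompleteSpace D] {ν : ℝ}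
    (hν : 0 < ν) (hco : ∀ u ∈ D, ν * ‖u‖ ^ 2 ≤ (q u u).re) (F : E →L⋆[ℂ] ℂ) :
    ∃ u ∈ D, ∀ φ ∈ D, q u φ = F φ := by
  let B₀ : D →ₗ⋆[ℂ] D →ₗ[ℂ] ℂ := LinearMap.mk₂'ₛₗ (starRingEnd ℂ) (RingHom.id ℂ)
    (fun v w => q w v) (fun v v' w => hq.map_add_right _ _ _)
    (fun a v w => hq.map_smul_right _ _ _) (fun v w w' => by simp) (fun a v w => by simp)
  let B : D →L⋆[ℂ] D →L[ℂ] ℂ := B₀.mkContinuous₂ M fun v w => by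
    calc ‖q w v‖ ≤ M * ‖(w : E)‖ * ‖(v : E)‖ := hq.bound _ _
      _ = M * ‖v‖ * ‖w‖ := by simp only [Submodule.coe_norm]; ring
  let A : D →L[ℂ] D := InnerProductSpace.continuousLinearMapOfBilin B
  have hA : ∀ v w : D, inner ℂ (A v) w = q w v := fun v w =>
    InnerProductSpace.continuousLinearMapOfBilin_apply B v w
  have hbelow : ∀ v : D, ν * ‖v‖ ≤ ‖A v‖ := fun v => by
    rcases eq_or_ne v 0 with rfl | hv
    · simp
    have hv' := norm_pos_iff.2 hv
    have h1 : ν * ‖v‖ ^ 2 ≤ ‖A v‖ * ‖v‖ :=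
      calc ν * ‖v‖ ^ 2 ≤ (q v v).re := hco v v.2
        _ = (inner ℂ (A v) v : ℂ).re := by rw [hA]
        _ ≤ ‖(inner ℂ (A v) v : ℂ)‖ := Complex.re_le_norm _
        _ ≤ ‖A v‖ * ‖v‖ := norm_inner_le_norm _ _
    nlinarith
  have hanti : AntilipschitzWith (Real.toNNReal ν⁻¹) A := by
    refine ContinuousLinearMap.antilipschitz_of_bound A fun v => ?_
    rw [Real.coe_toNNReal _ (inv_pos.2 hν).le]
    calc ‖v‖ = ν⁻¹ * (ν * ‖v‖) := by field_simp
      _ ≤ ν⁻¹ * ‖A v‖ := by gcongr; exact hbelow v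
  have hrange : A.range = ⊤ := by
    have hc : IsClosed (A.range : Set D) := hanti.isClosed_range A.uniformContinuous
    have := hc.completeSpace_coe
    rw [← A.range.orthogonal_orthogonal, Submodule.eq_top_iff']
    intro v w hw
    obtain rfl : w = 0 := by
      have h0 : inner ℂ (A w) w = 0 := hw _ ⟨w, rfl⟩
      have h1 := hco w w.2
      rw [← hA, h0, Complex.zero_re] at h1
      have h2 : ‖(w : E)‖ ^ 2 ≤ 0 := by nlinarith [sq_nonneg ‖(w : E)‖]
      have h3 : ‖(w : E)‖ = 0 := by nlinarith [sq_nonneg ‖(w : E)‖]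
      exact Subtype.ext (norm_eq_zero.1 h3)
    exact inner_zero_left _
  let G : D →L[ℂ] ℂ := LinearMap.mkContinuous
    { toFun := fun φ => conj (F φ)
      map_add' := fun φ ψ => by simp
      map_smul' := fun a φ => by simp } ‖F‖ fun φ => by
        simpa using F.le_opNorm (φ : E)
  obtain ⟨u, hu⟩ : (InnerProductSpace.toDual ℂ D).symm G ∈ A.range := hrange ▸ Submodule.mem_top
  refine ⟨u, u.2, fun φ hφ => ?_⟩
  have h1 := InnerProductSpace.toDual_symm_apply (x := ⟨φ, hφ⟩) (y := G)
  rw [← hu] at h1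
  have h2 := (hA u ⟨φ, hφ⟩).symm.trans h1
  have h3 : q φ u = conj (F φ) := h2
  rw [hq.symm φ u, h3, Complex.conj_conj]

end IsHermitianForm

theorem norm_le_of_solution {q : E →ₗ[ℂ] (E → ℂ)} {D : Submodule ℂ E} {ν : ℝ}
    (hν : 0 < ν) (hco : ∀ u ∈ D, ν * ‖u‖ ^ 2 ≤ (q u u).re) {F : E →L⋆[ℂ] ℂ} {u : E} (hu : u ∈ D)
    (hs : ∀ φ ∈ D, q u φ = F φ) : ‖u‖ ≤ ‖F‖ / ν := by
  rw [le_div_iff₀ hν]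
  rcases eq_or_ne u 0 with rfl | h0
  · simp
  have hu' := norm_pos_iff.2 h0
  have h1 : ν * ‖u‖ ^ 2 ≤ ‖F‖ * ‖u‖ :=
    calc ν * ‖u‖ ^ 2 ≤ (q u u).re := hco u hu
      _ ≤ ‖q u u‖ := Complex.re_le_norm _
      _ = ‖F u‖ := by rw [hs u hu]
      _ ≤ ‖F‖ * ‖u‖ := F.le_opNorm u
  nlinarith

theorem solution_unique {q : E →ₗ[ℂ] (E → ℂ)} {D : Submodule ℂ E} {ν : ℝ}
    (hν : 0 < ν) (hco : ∀ u ∈ D, ν * ‖u‖ ^ 2 ≤ (q u u).re) {F : E → ℂ} {u v : E} (hu : u ∈ D)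
    (hv : v ∈ D) (hsu : ∀ φ ∈ D, q u φ = F φ) (hsv : ∀ φ ∈ D, q v φ = F φ) : u = v := by
  have hd := D.sub_mem hu hv
  have h1 := hco _ hd
  rw [map_sub, Pi.sub_apply, hsu _ hd, hsv _ hd, sub_self, Complex.zero_re] at h1
  have h3 : ‖u - v‖ = 0 := by
    have := sq_nonneg ‖u - v‖
    have h2 : ‖u - v‖ ^ 2 = 0 := by nlinarith
    exact pow_eq_zero_iff (two_ne_zero) |>.1 h2
  exact sub_eq_zero.1 (norm_eq_zero.1 h3)

/-- A coercivity bound for `ε⁻¹ a + β_ε` passes to the limit form `β` on the kernel of `a`. -/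
theorem coercive_limit {D N : Submodule ℂ E} (hND : N ≤ D) {a β : E →ₗ[ℂ] (E → ℂ)}
    {βε : ℝ → E →ₗ[ℂ] (E → ℂ)} {M ν : ℝ}
    (haN : ∀ v ∈ N, ∀ φ, a v φ = 0)
    (hdiff : ∀ ε, 0 < ε → ε < 1 → ∀ u v, ‖βε ε u v - β u v‖ ≤ M * ε * ‖u‖ * ‖v‖)
    (hco : ∀ ε, 0 < ε → ε < 1 → ∀ u ∈ D,
      ν * ‖u‖ ^ 2 ≤ ((((ε⁻¹ : ℝ) : ℂ) • a + βε ε) u u).re) :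
    ∀ u ∈ N, ν * ‖u‖ ^ 2 ≤ (β u u).re := by
  intro u hu
  have key : ∀ ε, 0 < ε → ε < 1 → ν * ‖u‖ ^ 2 ≤ (β u u).re + ε * (M * ‖u‖ ^ 2) := by
    intro ε h0 h1
    have h2 := hco ε h0 h1 u (hND hu)
    have h3 := (Complex.re_le_norm _).trans (hdiff ε h0 h1 u u)
    simp only [LinearMap.add_apply, LinearMap.smul_apply, Pi.add_apply, Pi.smul_apply, haN u hu,
      smul_zero, zero_add, Complex.sub_re] at h2 h3
    nlinarith
  have hlim : Filter.Tendsto (fun ε : ℝ => (β u u).re + ε * (M * ‖u‖ ^ 2))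
      (nhdsWithin 0 (Set.Ioi 0)) (nhds ((β u u).re + 0 * (M * ‖u‖ ^ 2))) :=
    (Continuous.tendsto (by fun_prop) 0).mono_left nhdsWithin_le_nhds
  rw [zero_mul, add_zero] at hlim
  refine ge_of_tendsto hlim ?_
  filter_upwards [Ioo_mem_nhdsGT (zero_lt_one' ℝ)] with ε hε using key ε hε.1 hε.2

/-- The constant of `norm_sub_le_of_gap`. -/
def errorConst (K M ν : ℝ) : ℝ :=
  (1 + M / ν) * (1 / ν + (1 + M / ν) * (K * (1 + M / ν) ^ 2 + K * (1 + M / ν) / ν + 1))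

theorem errorConst_pos {K M ν : ℝ} (hK : 0 ≤ K) (hM : 0 ≤ M) (hν : 0 < ν) :
    0 < errorConst K M ν := by
  unfold errorConst; positivity

/-- The error estimate for the singularly perturbed problem. The error `e = U - W` splits, by the
gap inequality, into `v` in the kernel `N` of `a` and a remainder `z` controlled by `a(e, e)`.
Testing with `v`, where the singular term drops out, bounds `v` in terms of `z`; testing with `e`
then gives a quadratic inequality for `‖z‖`, which makes `z`, and with it `v`, of order `ε`. -/
theorem norm_sub_le_of_gap {D N : Submodule ℂ E} (hND : N ≤ D) {a β βε : E →ₗ[ℂ] (E → ℂ)}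
    {K M Ma ν ε : ℝ} (hK : 0 ≤ K) (hM : 0 ≤ M) (hν : 0 < ν) (hε : 0 < ε) (hε1 : ε < 1)
    (ha : IsHermitianForm a Ma) (haN : ∀ v ∈ N, ∀ φ, a v φ = 0)
    (hgap : ∀ u ∈ D, ∃ w ∈ N, ‖u - w‖ ^ 2 ≤ K * (a u u).re)
    (hβε : IsHermitianForm βε M)
    (hdiff : ∀ u v, ‖βε u v - β u v‖ ≤ M * ε * ‖u‖ * ‖v‖)
    (hco : ∀ u ∈ D, ν * ‖u‖ ^ 2 ≤ ((((ε⁻¹ : ℝ) : ℂ) • a + βε) u u).re)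
    (hcoN : ∀ u ∈ N, ν * ‖u‖ ^ 2 ≤ (β u u).re)
    {F : E →L⋆[ℂ] ℂ} {U W : E} (hU : U ∈ D)
    (hUs : ∀ φ ∈ D, (((ε⁻¹ : ℝ) : ℂ) • a + βε) U φ = F φ)
    (hW : W ∈ N) (hWs : ∀ φ ∈ N, β W φ = F φ) :
    ‖U - W‖ ≤ errorConst K M ν * ε * ‖F‖ := by
  set e := U - W with he
  have heD : e ∈ D := D.sub_mem hU (hND hW)
  obtain ⟨v, hv, hz⟩ := hgap e heD
  set z := e - v with hzdef
  have hev : e = v + z := by rw [hzdef]; abel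
  have hq : IsHermitianForm (((ε⁻¹ : ℝ) : ℂ) • a + βε) (|ε⁻¹| * Ma + M) :=
    (ha.smul ε⁻¹).add hβε
  have hWb : ‖W‖ ≤ ‖F‖ / ν := norm_le_of_solution hν hcoN hW hWs
  set L := M * (‖F‖ / ν) with hL
  have hF0 : 0 ≤ ‖F‖ := norm_nonneg F
  have hL0 : 0 ≤ L := by positivity
  -- the residual of `W` in the perturbed problem
  have hres : ∀ φ ∈ D, (((ε⁻¹ : ℝ) : ℂ) • a + βε) e φ = F φ - βε W φ := by
    intro φ hφ
    rw [he, map_sub, Pi.sub_apply, hUs φ hφ]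
    simp [haN W hW]
  have hresN : ∀ φ ∈ N, ‖F φ - βε W φ‖ ≤ ε * L * ‖φ‖ := by
    intro φ hφ
    rw [← hWs φ hφ, norm_sub_rev]
    calc ‖βε W φ - β W φ‖ ≤ M * ε * ‖W‖ * ‖φ‖ := hdiff W φ
      _ ≤ M * ε * (‖F‖ / ν) * ‖φ‖ := by gcongr
      _ = ε * L * ‖φ‖ := by rw [hL]; ring
  have hresz : ‖F z - βε W z‖ ≤ (‖F‖ + L) * ‖z‖ := by
    calc ‖F z - βε W z‖ ≤ ‖F z‖ + ‖βε W z‖ := norm_sub_le _ _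
      _ ≤ ‖F‖ * ‖z‖ + M * ‖W‖ * ‖z‖ := add_le_add (F.le_opNorm z) (hβε.bound W z)
      _ ≤ ‖F‖ * ‖z‖ + M * (‖F‖ / ν) * ‖z‖ := by gcongr
      _ = (‖F‖ + L) * ‖z‖ := by rw [hL]; ring
  set Q := ((((ε⁻¹ : ℝ) : ℂ) • a + βε) e e).re with hQ
  have hQe : ν * ‖e‖ ^ 2 ≤ Q := hco e heD
  have hQle : Q ≤ ε * L * ‖v‖ + (‖F‖ + L) * ‖z‖ := by
    have h1 : (((ε⁻¹ : ℝ) : ℂ) • a + βε) e e = (F v - βε W v) + (F z - βε W z) := by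
      rw [hres e heD, hev, map_add, hβε.map_add_right]; ring
    calc Q ≤ ‖(((ε⁻¹ : ℝ) : ℂ) • a + βε) e e‖ := Complex.re_le_norm _
      _ ≤ ‖F v - βε W v‖ + ‖F z - βε W z‖ := by rw [h1]; exact norm_add_le _ _
      _ ≤ _ := add_le_add (hresN v hv) hresz
  have hv2 : ν * ‖v‖ ≤ ε * L + M * ‖z‖ := by
    rcases eq_or_ne v 0 with h0 | h0
    · rw [h0, norm_zero, mul_zero]; positivity
    have hvpos := norm_pos_iff.2 h0
    have hazv : a z v = 0 := by rw [ha.symm v z, haN v hv, map_zero]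
    have h1 : (((ε⁻¹ : ℝ) : ℂ) • a + βε) v v = (F v - βε W v) - βε z v := by
      rw [← hres v (hND hv), hev, map_add, Pi.add_apply]
      simp [hazv]
    have h2 : ν * ‖v‖ ^ 2 ≤ ε * L * ‖v‖ + M * ‖z‖ * ‖v‖ :=
      calc ν * ‖v‖ ^ 2 ≤ _ := hco v (hND hv)
        _ ≤ ‖(((ε⁻¹ : ℝ) : ℂ) • a + βε) v v‖ := Complex.re_le_norm _
        _ ≤ ‖F v - βε W v‖ + ‖βε z v‖ := by rw [h1]; exact norm_sub_le _ _
        _ ≤ _ := add_le_add (hresN v hv) (hβε.bound z v)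
    nlinarith
  -- the coercivity constant absorbs the possibly negative contribution of `βε`
  have haQ : (a e e).re ≤ ε * ((1 + M / ν) * Q) := by
    have h1 : Q = ε⁻¹ * (a e e).re + (βε e e).re := by
      rw [hQ]; simp
    have h2 : -(βε e e).re ≤ M * ‖e‖ * ‖e‖ :=
      ((neg_le_abs _).trans (Complex.abs_re_le_norm _)).trans (hβε.bound e e)
    have h3 : M * ‖e‖ * ‖e‖ ≤ M / ν * Q := by
      calc M * ‖e‖ * ‖e‖ = M / ν * (ν * ‖e‖ ^ 2) := by field_simp
        _ ≤ M / ν * Q := by gcongr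
    have h4 : ε⁻¹ * (a e e).re ≤ (1 + M / ν) * Q := by linarith
    calc (a e e).re = ε * (ε⁻¹ * (a e e).re) := by field_simp
      _ ≤ _ := by gcongr
  set m := 1 + M / ν with hm
  have hm1 : 1 ≤ m := by rw [hm]; have : 0 ≤ M / ν := by positivity
                         linarith
  set G := ‖F‖ + L with hG
  have hG0 : 0 ≤ G := by positivity
  have hLG : L ≤ G := by rw [hG]; linarith
  have hvG : ‖v‖ ≤ ε * G / ν + M / ν * ‖z‖ := by
    have : ‖v‖ ≤ (ε * L + M * ‖z‖) / ν := by rw [le_div_iff₀ hν]; linarith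
    calc ‖v‖ ≤ (ε * L + M * ‖z‖) / ν := this
      _ ≤ (ε * G + M * ‖z‖) / ν := by gcongr
      _ = _ := by ring
  have hQG : Q ≤ ε ^ 2 * G ^ 2 / ν + m * G * ‖z‖ := by
    calc Q ≤ ε * G * ‖v‖ + G * ‖z‖ := by
          refine hQle.trans ?_
          gcongr
      _ ≤ ε * G * (ε * G / ν + M / ν * ‖z‖) + G * ‖z‖ := by gcongr
      _ = ε ^ 2 * G ^ 2 / ν + (1 + ε * (M / ν)) * G * ‖z‖ := by ring
      _ ≤ ε ^ 2 * G ^ 2 / ν + (1 + 1 * (M / ν)) * G * ‖z‖ := by gcongr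
      _ = _ := by rw [hm]; ring
  have hzz : ‖z‖ ^ 2 ≤ K * (ε * (m * (ε ^ 2 * G ^ 2 / ν + m * G * ‖z‖))) := by
    refine hz.trans ?_
    gcongr
    refine haQ.trans ?_
    gcongr
  set T := K * m ^ 2 + K * m / ν + 1 with hT
  have hT1 : 1 ≤ T := by rw [hT]; have : 0 ≤ K * m ^ 2 + K * m / ν := by positivity
                         linarith
  -- `hzz` is a quadratic inequality for `‖z‖` whose coefficients carry the factor `ε`
  have hzT : ‖z‖ ≤ T * (ε * G) := by
    by_contra hcon
    push Not at hcon
    have hεG : 0 ≤ ε * G := by positivity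
    have hzpos : 0 < ‖z‖ := lt_of_le_of_lt (by positivity) hcon
    have h1 : ε * (ε * G) ≤ ‖z‖ :=
      calc ε * (ε * G) ≤ T * (ε * G) := by gcongr; exact hε1.le.trans hT1
        _ ≤ ‖z‖ := hcon.le
    have h2 : ‖z‖ ^ 2 ≤ (T - 1) * (ε * G) * ‖z‖ := by
      calc ‖z‖ ^ 2 ≤ _ := hzz
        _ = K * m / ν * (ε * G) * (ε * (ε * G)) + K * m ^ 2 * (ε * G) * ‖z‖ := by ring
        _ ≤ K * m / ν * (ε * G) * ‖z‖ + K * m ^ 2 * (ε * G) * ‖z‖ := by gcongr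
        _ = _ := by rw [hT]; ring
    have h3 : (T - 1) * (ε * G) < ‖z‖ := by rw [sub_mul, one_mul]; linarith
    have h4 := mul_lt_mul_of_pos_right h3 hzpos
    rw [sq] at h2
    linarith
  have hGF : G = m * ‖F‖ := by rw [hG, hL, hm]; ring
  calc ‖e‖ ≤ ‖v‖ + ‖z‖ := by rw [hev]; exact norm_add_le _ _
    _ ≤ (ε * G / ν + M / ν * ‖z‖) + ‖z‖ := by gcongr
    _ = ε * G / ν + m * ‖z‖ := by rw [hm]; ring
    _ ≤ ε * G / ν + m * (T * (ε * G)) := by gcongr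
    _ = errorConst K M ν * ε * ‖F‖ := by
      rw [hGF, errorConst, ← hm, ← hT]; ring

end Abstract

/-! ### Boundedness and coercivity of the forms -/

theorem norm_sq_L2 (f : L2) : ‖f‖ ^ 2 = ∫ y, ‖f y‖ ^ 2 ∂cellMeasure := by
  rw [← inner_self_eq_norm_sq (𝕜 := ℂ), L2.inner_def]
  have h : ∀ y, inner ℂ (f y) (f y) = ((‖f y‖ ^ 2 : ℝ) : ℂ) := fun y => by
    rw [inner_self_eq_norm_sq_to_K]; push_cast; rfl
  simp only [h]
  rw [integral_complex_ofReal]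
  rfl

theorem integrable_norm_sq (f : L2) : Integrable (fun y => ‖f y‖ ^ 2) cellMeasure :=
  (memLp_two_iff_integrable_sq_norm (Lp.memLp f).1).1 (Lp.memLp f)

/-- The squared length of the gradient, `|∇w|²`. -/
def gradSq (w : H1) (y : Plane) : ℝ := ‖pd w 0 y‖ ^ 2 + ‖pd w 1 y‖ ^ 2

theorem gradSq_nonneg (w : H1) (y : Plane) : 0 ≤ gradSq w y := by unfold gradSq; positivity

theorem integrable_gradSq (w : H1) : Integrable (gradSq w) cellMeasure :=
  (integrable_norm_sq _).add (integrable_norm_sq _)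

theorem norm_sq_jet (w : Jet) : ‖w‖ ^ 2 = ‖w.fst‖ ^ 2 + (‖w.snd 0‖ ^ 2 + ‖w.snd 1‖ ^ 2) := by
  rw [WithLp.prod_norm_sq_eq_of_L2, PiLp.norm_sq_eq_of_L2 _ w.snd, Fin.sum_univ_two]

theorem norm_sq_H1 (w : H1) : ‖w‖ ^ 2 = ‖toL2 w‖ ^ 2 + ∫ y, gradSq w y ∂cellMeasure := by
  rw [Submodule.coe_norm, norm_sq_jet]
  unfold gradSq
  rw [integral_add (integrable_norm_sq _) (integrable_norm_sq _), ← norm_sq_L2, ← norm_sq_L2]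
  rfl

theorem integral_gradSq_le (w : H1) : ∫ y, gradSq w y ∂cellMeasure ≤ ‖w‖ ^ 2 := by
  rw [norm_sq_H1]; nlinarith [sq_nonneg ‖toL2 w‖]

theorem norm_toL2_le (w : H1) : ‖toL2 w‖ ≤ ‖w‖ := by
  refine le_of_sq_le_sq ?_ (norm_nonneg _)
  rw [norm_sq_H1]
  have : 0 ≤ ∫ y, gradSq w y ∂cellMeasure := integral_nonneg fun y => gradSq_nonneg w y
  linarith

/-- A form `∫_S q(u, φ)` with a Hermitian density dominated by `|∇u|² + |∇φ|²` is a bounded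
Hermitian form. -/
theorem isHermitianForm_formOfDensity {S : Set Plane} {q : H1 → H1 → Plane → ℂ}
    {hq : ∀ u φ, Integrable (q u φ) cellMeasure}
    {hadd : ∀ u v φ, ∀ᵐ y ∂cellMeasure, q (u + v) φ y = q u φ y + q v φ y}
    {hsmul : ∀ (a : ℂ) u φ, ∀ᵐ y ∂cellMeasure, q (a • u) φ y = a * q u φ y}
    (hsymm : ∀ u φ y, q φ u y = conj (q u φ y))
    (hb : ∀ u φ y, ‖q u φ y‖ ≤ gradSq u y + gradSq φ y) :
    IsHermitianForm (E := H1) (formOfDensity S q hq hadd hsmul) 2 := by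
  rw [← mul_one (2 : ℝ)]
  refine IsHermitianForm.of_le_add_sq (fun u v => ?_) (fun u v => ?_)
  · change ∫ y in S, q v u y ∂cellMeasure = conj (∫ y in S, q u v y ∂cellMeasure)
    rw [← integral_conj]
    exact integral_congr_ae (Filter.Eventually.of_forall fun y => hsymm u v y)
  · change ‖∫ y in S, q u v y ∂cellMeasure‖ ≤ _
    have hi : Integrable (fun y => gradSq u y + gradSq v y) cellMeasure :=
      (integrable_gradSq u).add (integrable_gradSq v)
    calc ‖∫ y in S, q u v y ∂cellMeasure‖ ≤ ∫ y in S, (gradSq u y + gradSq v y) ∂cellMeasure :=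
          norm_integral_le_of_norm_le hi.restrict (Filter.Eventually.of_forall (hb u v))
      _ ≤ ∫ y, (gradSq u y + gradSq v y) ∂cellMeasure :=
          setIntegral_le_integral hi (Filter.Eventually.of_forall fun y =>
            add_nonneg (gradSq_nonneg u y) (gradSq_nonneg v y))
      _ = ∫ y, gradSq u y ∂cellMeasure + ∫ y, gradSq v y ∂cellMeasure :=
          integral_add (integrable_gradSq u) (integrable_gradSq v)
      _ ≤ 1 * (‖u‖ ^ 2 + ‖v‖ ^ 2) := by
          rw [one_mul]; exact add_le_add (integral_gradSq_le u) (integral_gradSq_le v)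

theorem norm_sq_C2 (x : C2) : ‖x‖ ^ 2 = ‖x 0‖ ^ 2 + ‖x 1‖ ^ 2 := by
  rw [EuclideanSpace.norm_sq_eq, Fin.sum_univ_two]

theorem gradSq_eq (w : H1) (y : Plane) : gradSq w y
    = (‖pd w 0 y 0‖ ^ 2 + ‖pd w 0 y 1‖ ^ 2) + (‖pd w 1 y 0‖ ^ 2 + ‖pd w 1 y 1‖ ^ 2) := by
  rw [gradSq, norm_sq_C2, norm_sq_C2]

theorem norm_mul_conj_le (z w : ℂ) : ‖z * conj w‖ ≤ (‖z‖ ^ 2 + ‖w‖ ^ 2) / 2 := by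
  rw [norm_mul, RCLike.norm_conj]
  linarith [two_mul_le_add_sq ‖z‖ ‖w‖]

theorem cross_eq (u φ : H1) (y : Plane) : cross u φ y
    = -(pd u 1 y 0 * conj (pd φ 0 y 1)) + pd u 0 y 0 * conj (pd φ 1 y 1)
      + (-(pd u 0 y 1 * conj (pd φ 1 y 0)) + pd u 1 y 1 * conj (pd φ 0 y 0)) := by
  simp [cross, dot, grad, gradPerp, Fin.sum_univ_two]

theorem dot_grad_eq (u φ : H1) (i : Fin 2) (y : Plane) : dot (grad u i y) (grad φ i y)
    = pd u 0 y i * conj (pd φ 0 y i) + pd u 1 y i * conj (pd φ 1 y i) := by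
  simp [dot, grad, Fin.sum_univ_two]

theorem norm_add_sq_le (z w : ℂ) : ‖z + w‖ ^ 2 ≤ 2 * (‖z‖ ^ 2 + ‖w‖ ^ 2) := by
  have h := norm_add_le z w
  have := pow_le_pow_left₀ (norm_nonneg _) h 2
  linarith [two_mul_le_add_sq ‖z‖ ‖w‖, add_sq ‖z‖ ‖w‖]

theorem isHermitianForm_aForm (R : Set Plane) : IsHermitianForm (E := H1) (aForm R) 2 := by
  refine isHermitianForm_formOfDensity (fun u φ y => ?_) (fun u φ y => ?_)
  · simp only [map_add, map_mul, Complex.conj_conj]; ring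
  · have hdc : ∀ w : H1, ‖divg w y‖ ^ 2 + ‖curl w y‖ ^ 2 ≤ 2 * gradSq w y := fun w => by
      have h1 := norm_add_sq_le (pd w 0 y 0) (pd w 1 y 1)
      have h2 := norm_add_sq_le (pd w 0 y 1) (-pd w 1 y 0)
      rw [← sub_eq_add_neg, norm_neg] at h2
      rw [gradSq_eq, divg, curl]
      linarith
    have h1 := norm_mul_conj_le (divg u y) (divg φ y)
    have h2 := norm_mul_conj_le (curl u y) (curl φ y)
    have h3 := norm_add_le (divg u y * conj (divg φ y)) (curl u y * conj (curl φ y))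
    linarith [hdc u, hdc φ]

theorem isHermitianForm_crossForm (S : Set Plane) : IsHermitianForm (E := H1) (crossForm S) 2 := by
  refine isHermitianForm_formOfDensity (fun u φ y => ?_) (fun u φ y => ?_)
  · simp only [cross_eq, map_add, map_neg, map_mul, Complex.conj_conj]; ring
  · rw [cross_eq]
    have h1 := norm_mul_conj_le (pd u 1 y 0) (pd φ 0 y 1)
    have h2 := norm_mul_conj_le (pd u 0 y 0) (pd φ 1 y 1)
    have h3 := norm_mul_conj_le (pd u 0 y 1) (pd φ 1 y 0)
    have h4 := norm_mul_conj_le (pd u 1 y 1) (pd φ 0 y 0)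
    rw [← norm_neg] at h1 h3
    refine (norm_add_le_of_le (norm_add_le_of_le h1 h2) (norm_add_le_of_le h3 h4)).trans ?_
    have h5 := gradSq_nonneg u y
    have h6 := gradSq_nonneg φ y
    rw [gradSq_eq] at h5 h6 ⊢
    rw [gradSq_eq]
    linarith

theorem isHermitianForm_gradForm (S : Set Plane) (i : Fin 2) :
    IsHermitianForm (E := H1) (gradForm S i) 2 := by
  refine isHermitianForm_formOfDensity (fun u φ y => ?_) (fun u φ y => ?_)
  · simp only [dot_grad_eq, map_add, map_mul, Complex.conj_conj]; ring
  · rw [dot_grad_eq]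
    refine (norm_add_le_of_le (norm_mul_conj_le _ _) (norm_mul_conj_le _ _)).trans ?_
    have h : ∀ (w : H1) j, ‖pd w j y i‖ ^ 2 ≤ ‖pd w j y‖ ^ 2 := fun w j => by
      gcongr; exact PiLp.norm_apply_le (pd w j y) i
    unfold gradSq
    linarith [h u 0, h u 1, h φ 0, h φ 1, sq_nonneg ‖pd u 0 y‖, sq_nonneg ‖pd u 1 y‖,
      sq_nonneg ‖pd φ 0 y‖, sq_nonneg ‖pd φ 1 y‖]

theorem isHermitianForm_cForm {ε₀ : ℝ} (hε₀ : 1 < ε₀) (R : Set Plane) :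
    IsHermitianForm (E := L2) (cForm ε₀ R) ε₀ := by
  have hi : ∀ (u φ : L2) i, Integrable (fun y => comp u i y * conj (comp φ i y)) cellMeasure :=
    fun u φ i => integrable_coord_mul u φ i i
  have hS : ∀ (u φ : L2), Integrable (fun y => (‖u y‖ ^ 2 + ‖φ y‖ ^ 2) / 2) cellMeasure :=
    fun u φ => ((integrable_norm_sq u).add (integrable_norm_sq φ)).div_const 2
  rw [show ε₀ = 2 * (ε₀ / 2) by ring]
  refine IsHermitianForm.of_le_add_sq (fun u v => ?_) (fun u v => ?_)
  · rw [show 2 * (ε₀ / 2) = ε₀ by ring]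
    change ∫ y, (comp v 0 y * conj (comp u 0 y) + comp v 1 y * conj (comp u 1 y)) ∂cellMeasure
      + ((ε₀ - 1 : ℝ) : ℂ) * ∫ y in R, comp v 1 y * conj (comp u 1 y) ∂cellMeasure
      = conj (∫ y, (comp u 0 y * conj (comp v 0 y) + comp u 1 y * conj (comp v 1 y)) ∂cellMeasure
      + ((ε₀ - 1 : ℝ) : ℂ) * ∫ y in R, comp u 1 y * conj (comp v 1 y) ∂cellMeasure)
    rw [map_add (starRingEnd ℂ), map_mul (starRingEnd ℂ), Complex.conj_ofReal, ← integral_conj,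
      ← integral_conj]
    simp only [map_add, map_mul, Complex.conj_conj, mul_comm]
  · rw [show 2 * (ε₀ / 2) = ε₀ by ring]
    have hsum : ∫ y, (‖u y‖ ^ 2 + ‖v y‖ ^ 2) / 2 ∂cellMeasure = (‖u‖ ^ 2 + ‖v‖ ^ 2) / 2 := by
      rw [integral_div, integral_add (integrable_norm_sq u) (integrable_norm_sq v), norm_sq_L2,
        norm_sq_L2]
    have h1 : ‖∫ y, (comp u 0 y * conj (comp v 0 y) + comp u 1 y * conj (comp v 1 y))
        ∂cellMeasure‖ ≤ (‖u‖ ^ 2 + ‖v‖ ^ 2) / 2 := by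
      rw [← hsum]
      refine norm_integral_le_of_norm_le (hS u v) (Filter.Eventually.of_forall fun y => ?_)
      refine (norm_add_le_of_le (norm_mul_conj_le _ _) (norm_mul_conj_le _ _)).trans ?_
      simp only [norm_sq_C2 (u y), norm_sq_C2 (v y), comp]
      linarith
    have h2 : ‖∫ y in R, comp u 1 y * conj (comp v 1 y) ∂cellMeasure‖
        ≤ (‖u‖ ^ 2 + ‖v‖ ^ 2) / 2 := by
      rw [← hsum]
      refine (norm_integral_le_of_norm_le (hS u v).restrict
        (Filter.Eventually.of_forall fun y => ?_)).trans
        (setIntegral_le_integral (hS u v) (Filter.Eventually.of_forall fun y => by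
          change 0 ≤ (‖u y‖ ^ 2 + ‖v y‖ ^ 2) / 2; positivity))
      refine (norm_mul_conj_le _ _).trans ?_
      have := PiLp.norm_apply_le (u y) 1
      have := PiLp.norm_apply_le (v y) 1
      unfold comp
      gcongr
    change ‖∫ y, (comp u 0 y * conj (comp v 0 y) + comp u 1 y * conj (comp v 1 y)) ∂cellMeasure
      + ((ε₀ - 1 : ℝ) : ℂ) * ∫ y in R, comp u 1 y * conj (comp v 1 y) ∂cellMeasure‖ ≤ _
    refine (norm_add_le_of_le h1 (norm_mul_le_of_le (le_of_eq (Complex.norm_real _)) h2)).trans ?_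
    rw [Real.norm_of_nonneg (by linarith)]
    linarith

theorem cForm_coercive {ε₀ : ℝ} (hε₀ : 1 < ε₀) (R : Set Plane) (u : L2) :
    1 * ‖u‖ ^ 2 ≤ (cForm ε₀ R u u).re := by
  have hz : ∀ z : ℂ, z * conj z = ((‖z‖ ^ 2 : ℝ) : ℂ) := fun z => by
    rw [Complex.mul_conj, Complex.normSq_eq_norm_sq]
  change _ ≤ (∫ y, (comp u 0 y * conj (comp u 0 y) + comp u 1 y * conj (comp u 1 y)) ∂cellMeasure
    + ((ε₀ - 1 : ℝ) : ℂ) * ∫ y in R, comp u 1 y * conj (comp u 1 y) ∂cellMeasure).re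
  simp only [hz, ← Complex.ofReal_add]
  rw [integral_complex_ofReal, integral_complex_ofReal, ← Complex.ofReal_mul,
    ← Complex.ofReal_add, Complex.ofReal_re, norm_sq_L2]
  simp only [norm_sq_C2, comp, one_mul]
  have : 0 ≤ ∫ y in R, ‖u y 1‖ ^ 2 ∂cellMeasure := integral_nonneg fun y => by positivity
  nlinarith

/-- The form `c`, regarded as a form on `H¹`. -/
def cFormH1 (ε₀ : ℝ) (R : Set Plane) : H1 →ₗ[ℂ] (H1 → ℂ) :=
  (LinearMap.funLeft ℂ ℂ toL2).comp ((cForm ε₀ R).comp toL2)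

theorem cFormH1_apply (ε₀ : ℝ) (R : Set Plane) (u φ : H1) :
    cFormH1 ε₀ R u φ = cForm ε₀ R (toL2 u) (toL2 φ) := rfl

/-- The form `b_ε + c` on `H¹`. -/
def bcEpsForm (ε₀ : ℝ) (R : Set Plane) (ε : ℝ) : H1 →ₗ[ℂ] (H1 → ℂ) :=
  bEpsForm ε₀ R ε + cFormH1 ε₀ R

/-- The form `b + c` on `H¹`. -/
def bcForm (ε₀ : ℝ) (R : Set Plane) : H1 →ₗ[ℂ] (H1 → ℂ) := bForm ε₀ R + cFormH1 ε₀ R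

theorem isHermitianForm_cFormH1 {ε₀ : ℝ} (hε₀ : 1 < ε₀) (R : Set Plane) :
    IsHermitianForm (E := H1) (cFormH1 ε₀ R) ε₀ where
  symm u v := (isHermitianForm_cForm hε₀ R).symm _ _
  bound u v := ((isHermitianForm_cForm hε₀ R).bound _ _).trans (by
    have := norm_toL2_le u
    have := norm_toL2_le v
    gcongr)

/-- The pointwise identity `|div u|² + |curl u|² = |∇u|² + X(u, u)`. -/
theorem divCurl_re_eq (u : H1) (y : Plane) :
    (divg u y * conj (divg u y) + curl u y * conj (curl u y)).re
      = gradSq u y + (cross u u y).re := by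
  rw [cross_eq, gradSq_eq]
  simp only [divg, curl, ← Complex.normSq_eq_norm_sq, Complex.normSq_apply, Complex.add_re,
    Complex.mul_re, Complex.conj_re, Complex.conj_im, Complex.add_im, Complex.sub_re,
    Complex.sub_im, Complex.neg_re]
  ring

theorem divCurl_re_nonneg (u : H1) (y : Plane) :
    0 ≤ (divg u y * conj (divg u y) + curl u y * conj (curl u y)).re := by
  rw [Complex.mul_conj, Complex.mul_conj, ← Complex.ofReal_add, Complex.ofReal_re]
  exact add_nonneg (Complex.normSq_nonneg _) (Complex.normSq_nonneg _)

/-- Outside `R`, the density of `ε⁻¹ a + b_ε` is `ε⁻¹ (|∇u|² + √(1-ε) X(u, u))`, in which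
`X(u, u) ≥ -|∇u|²`. -/
theorem density_compl_ge {ε : ℝ} (h0 : 0 < ε) (h1 : ε < 1) (u : H1) (y : Plane) :
    1 / 2 * gradSq u y
      ≤ ε⁻¹ * (divg u y * conj (divg u y) + curl u y * conj (curl u y)).re
        + (Real.sqrt (1 - ε) - 1) / ε * (cross u u y).re := by
  have hA := divCurl_re_nonneg u y
  rw [divCurl_re_eq] at hA ⊢
  set s := Real.sqrt (1 - ε)
  have hs0 : 0 ≤ s := Real.sqrt_nonneg _
  have hs2 : s ^ 2 = 1 - ε := Real.sq_sqrt (by linarith)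
  have hs1 : s ≤ 1 := by nlinarith
  have hG := gradSq_nonneg u y
  have e : ε⁻¹ * (gradSq u y + (cross u u y).re) + (s - 1) / ε * (cross u u y).re
      = (gradSq u y + s * (cross u u y).re) / ε := by field_simp; ring
  rw [e, le_div_iff₀ h0]
  nlinarith [mul_nonneg hs0 hA, mul_nonneg hG (sq_nonneg (1 - s))]

/-- Completing the square in `X(u, u)`, with a weight `r`. -/
theorem cross_re_ge (u : H1) (y : Plane) {r : ℝ} (hr : 0 < r) :
    -((dot (grad u 0 y) (grad u 0 y)).re / r + r * (dot (grad u 1 y) (grad u 1 y)).re)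
      ≤ (cross u u y).re := by
  have e : (cross u u y).re + ((dot (grad u 0 y) (grad u 0 y)).re / r
      + r * (dot (grad u 1 y) (grad u 1 y)).re)
      = (((pd u 0 y 0).re + r * (pd u 1 y 1).re) ^ 2 + ((pd u 0 y 0).im + r * (pd u 1 y 1).im) ^ 2
        + ((pd u 1 y 0).re - r * (pd u 0 y 1).re) ^ 2
        + ((pd u 1 y 0).im - r * (pd u 0 y 1).im) ^ 2) / r := by
    rw [cross_eq, dot_grad_eq, dot_grad_eq]
    simp only [Complex.add_re, Complex.mul_re, Complex.conj_re, Complex.conj_im, Complex.neg_re]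
    field_simp
    ring
  rw [neg_le_iff_add_nonneg, e]
  positivity

theorem gradSq_eq_dot (u : H1) (y : Plane) : gradSq u y
    = (dot (grad u 0 y) (grad u 0 y)).re + (dot (grad u 1 y) (grad u 1 y)).re := by
  rw [gradSq_eq, dot_grad_eq, dot_grad_eq]
  simp only [← Complex.normSq_eq_norm_sq, Complex.normSq_apply, Complex.add_re,
    Complex.mul_re, Complex.conj_re, Complex.conj_im]
  ring

theorem dot_grad_re_nonneg (u : H1) (i : Fin 2) (y : Plane) :
    0 ≤ (dot (grad u i y) (grad u i y)).re := by
  rw [dot_grad_eq, Complex.mul_conj, Complex.mul_conj, ← Complex.ofReal_add, Complex.ofReal_re]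
  exact add_nonneg (Complex.normSq_nonneg _) (Complex.normSq_nonneg _)

/-- The coercivity constant of the forms `ε⁻¹ a + b_ε + c`. -/
def coerConst (ε₀ : ℝ) : ℝ := min (1 / 2) ((1 - 1 / Real.sqrt ε₀) / ε₀)

theorem coerConst_pos {ε₀ : ℝ} (hε₀ : 1 < ε₀) : 0 < coerConst ε₀ := by
  have h1 : 1 < Real.sqrt ε₀ := by
    rw [Real.lt_sqrt zero_le_one]; linarith
  refine lt_min (by norm_num) (div_pos ?_ (by linarith))
  rw [sub_pos, div_lt_one (by linarith)]
  exact h1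

/-- Inside `R`, the weights `t = 1/√ε₀` in `|X(u, u)| ≤ t |∇u₁|² + t⁻¹ |∇u₂|²` leave a positive
multiple of both gradients. -/
theorem density_ge {ε₀ ε : ℝ} (hε₀ : 1 < ε₀) (h0 : 0 < ε) (h1 : ε < 1) (u : H1) (y : Plane) :
    (1 - 1 / Real.sqrt ε₀) / ε₀ * gradSq u y
      ≤ (ε₀ - 1 + ε)⁻¹ * ((dot (grad u 0 y) (grad u 0 y)).re
        + ε₀ * (dot (grad u 1 y) (grad u 1 y)).re + Real.sqrt (1 - ε) * (cross u u y).re) := by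
  rw [gradSq_eq_dot]
  set s := Real.sqrt (1 - ε)
  set r := Real.sqrt ε₀
  have hr1 : 1 < r := by
    rw [Real.lt_sqrt zero_le_one]; linarith
  have hr0 : 0 < r := by linarith
  have hr2 : r ^ 2 = ε₀ := Real.sq_sqrt (by linarith)
  have hs0 : 0 ≤ s := Real.sqrt_nonneg _
  have hs2 : s ^ 2 = 1 - ε := Real.sq_sqrt (by linarith)
  have hs1 : s ≤ 1 := by nlinarith
  have hx := cross_re_ge u y hr0
  have hp := dot_grad_re_nonneg u 0 y
  have hq := dot_grad_re_nonneg u 1 y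
  set p := (dot (grad u 0 y) (grad u 0 y)).re
  set q := (dot (grad u 1 y) (grad u 1 y)).re
  set x := (cross u u y).re
  have hB : 0 ≤ p / r + r * q := by positivity
  have hsx : -(p / r + r * q) ≤ s * x := by nlinarith
  have hrr : 1 - 1 / r ≤ ε₀ - r := by
    rw [← hr2]
    have : 1 - 1 / r = (r - 1) / r := by field_simp
    rw [this, div_le_iff₀ hr0]
    nlinarith [mul_pos (sub_pos.2 hr1) hr0, mul_pos (mul_pos (sub_pos.2 hr1) hr0) hr0]
  have hmain : (1 - 1 / r) * (p + q) ≤ p + ε₀ * q + s * x := by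
    have : (1 - 1 / r) * q ≤ (ε₀ - r) * q := by gcongr
    have e : p / r = 1 / r * p := by ring
    rw [e] at hsx
    linarith
  have hpos : 0 ≤ (1 - 1 / r) * (p + q) := by
    refine mul_nonneg ?_ (by positivity)
    rw [sub_nonneg, div_le_one hr0]; exact hr1.le
  calc (1 - 1 / r) / ε₀ * (p + q) = ε₀⁻¹ * ((1 - 1 / r) * (p + q)) := by ring
    _ ≤ (ε₀ - 1 + ε)⁻¹ * ((1 - 1 / r) * (p + q)) := by
        gcongr; linarith
    _ ≤ _ := by
        have : 0 ≤ (ε₀ - 1 + ε)⁻¹ := inv_nonneg.2 (by linarith)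
        gcongr

theorem epsForm_re (ε₀ ε : ℝ) (R : Set Plane) (u : H1) :
    ((((ε⁻¹ : ℝ) : ℂ) • aForm R + bcEpsForm ε₀ R ε) u u).re
      = (ε⁻¹ * (aForm R u u).re + (Real.sqrt (1 - ε) - 1) / ε * (crossForm Rᶜ u u).re)
        + (ε₀ - 1 + ε)⁻¹ * ((gradForm R 0 u u).re + ε₀ * (gradForm R 1 u u).re
          + Real.sqrt (1 - ε) * (crossForm R u u).re)
        + (cForm ε₀ R (toL2 u) (toL2 u)).re := by
  rw [← cFormH1_apply]
  simp only [bcEpsForm, bEpsForm, LinearMap.add_apply, LinearMap.smul_apply, Pi.add_apply,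
    Pi.smul_apply, smul_eq_mul, Complex.add_re, Complex.re_ofReal_mul]
  ring

theorem re_setIntegral {f : Plane → ℂ} (S : Set Plane) (hf : Integrable f cellMeasure) :
    (∫ y in S, f y ∂cellMeasure).re = ∫ y in S, (f y).re ∂cellMeasure :=
  (integral_re (𝕜 := ℂ) hf.restrict).symm

theorem integral_gradSq_compl_le {ε : ℝ} (h0 : 0 < ε) (h1 : ε < 1) (R : Set Plane) (u : H1)
    {k : ℝ} (hk : k ≤ 1 / 2) :
    ∫ y in Rᶜ, k * gradSq u y ∂cellMeasure ≤ ε⁻¹ * (aForm R u u).re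
      + (Real.sqrt (1 - ε) - 1) / ε * (crossForm Rᶜ u u).re := by
  have iA : Integrable (fun y => (divg u y * conj (divg u y) + curl u y * conj (curl u y)).re)
    (cellMeasure.restrict Rᶜ) := (integrable_divCurl u u).re.restrict
  have iX : Integrable (fun y => (cross u u y).re) (cellMeasure.restrict Rᶜ) :=
    (integrable_cross u u).re.restrict
  have eA : (aForm R u u).re = _ := re_setIntegral Rᶜ (integrable_divCurl u u)
  have eX : (crossForm Rᶜ u u).re = _ := re_setIntegral Rᶜ (integrable_cross u u)
  rw [eA, eX, ← integral_const_mul, ← integral_const_mul,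
    ← integral_add (iA.const_mul _) (iX.const_mul _)]
  refine integral_mono ((integrable_gradSq u).const_mul k).restrict
    ((iA.const_mul _).add (iX.const_mul _)) fun y => ?_
  exact (mul_le_mul_of_nonneg_right hk (gradSq_nonneg u y)).trans (density_compl_ge h0 h1 u y)

theorem integral_gradSq_le_form {ε₀ ε : ℝ} (hε₀ : 1 < ε₀) (h0 : 0 < ε) (h1 : ε < 1)
    (R : Set Plane) (u : H1) {k : ℝ} (hk : k ≤ (1 - 1 / Real.sqrt ε₀) / ε₀) :
    ∫ y in R, k * gradSq u y ∂cellMeasure ≤ (ε₀ - 1 + ε)⁻¹ * ((gradForm R 0 u u).re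
      + ε₀ * (gradForm R 1 u u).re + Real.sqrt (1 - ε) * (crossForm R u u).re) := by
  have iX : Integrable (fun y => (cross u u y).re) (cellMeasure.restrict R) :=
    (integrable_cross u u).re.restrict
  have iG : ∀ i, Integrable (fun y => (dot (grad u i y) (grad u i y)).re)
    (cellMeasure.restrict R) := fun i => (integrable_grad u u i).re.restrict
  have eX : (crossForm R u u).re = _ := re_setIntegral R (integrable_cross u u)
  have eG : ∀ i, (gradForm R i u u).re = _ := fun i => re_setIntegral R (integrable_grad u u i)
  have i01 : Integrable (fun y => (dot (grad u 0 y) (grad u 0 y)).re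
      + ε₀ * (dot (grad u 1 y) (grad u 1 y)).re) (cellMeasure.restrict R) :=
    (iG 0).add ((iG 1).const_mul _)
  rw [eX, eG, eG, ← integral_const_mul, ← integral_const_mul,
    ← integral_add (iG 0) ((iG 1).const_mul _),
    ← integral_add i01 (iX.const_mul _), ← integral_const_mul]
  refine integral_mono ((integrable_gradSq u).const_mul k).restrict
    ((i01.add (iX.const_mul _)).const_mul _) fun y => ?_
  exact (mul_le_mul_of_nonneg_right hk (gradSq_nonneg u y)).trans (density_ge hε₀ h0 h1 u y)

/-- The forms `ε⁻¹ a + b_ε + c` are coercive on `H¹`, uniformly in `ε`. -/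
theorem epsForm_coercive {ε₀ ε : ℝ} (hε₀ : 1 < ε₀) (h0 : 0 < ε) (h1 : ε < 1) {R : Set Plane}
    (hR : MeasurableSet R) (u : H1) :
    coerConst ε₀ * ‖u‖ ^ 2 ≤ ((((ε⁻¹ : ℝ) : ℂ) • aForm R
      + bcEpsForm ε₀ R ε) u u).re := by
  have hk1 : coerConst ε₀ ≤ 1 / 2 := min_le_left _ _
  have hk2 : coerConst ε₀ ≤ (1 - 1 / Real.sqrt ε₀) / ε₀ := min_le_right _ _
  have hc := cForm_coercive hε₀ R (toL2 u)
  have hRc := integral_gradSq_compl_le h0 h1 R u hk1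
  have hRi := integral_gradSq_le_form hε₀ h0 h1 R u hk2
  have hsplit := integral_add_compl hR ((integrable_gradSq u).const_mul (coerConst ε₀))
  rw [integral_const_mul (coerConst ε₀) (gradSq u) (μ := cellMeasure)] at hsplit
  rw [epsForm_re, norm_sq_H1]
  have : coerConst ε₀ * ‖toL2 u‖ ^ 2 ≤ 1 * ‖toL2 u‖ ^ 2 := by gcongr; linarith
  linarith

/-- A common bound for `b_ε + c` and for `ε⁻¹ (b_ε - b)`. -/
def boundConst (ε₀ : ℝ) : ℝ :=
  3 + ε₀ + (ε₀ - 1)⁻¹ * (4 + 2 * ε₀) + (ε₀ - 1)⁻¹ ^ 2 * (2 + 4 * ε₀)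

theorem boundConst_nonneg {ε₀ : ℝ} (hε₀ : 1 < ε₀) : 0 ≤ boundConst ε₀ := by
  have : 0 < (ε₀ - 1)⁻¹ := inv_pos.2 (by linarith)
  unfold boundConst; positivity

theorem sqrt_quotient_eq {ε : ℝ} (h0 : 0 < ε) (h1 : ε < 1) :
    (Real.sqrt (1 - ε) - 1) / ε = -(1 / (1 + Real.sqrt (1 - ε))) := by
  have hs2 : Real.sqrt (1 - ε) ^ 2 = 1 - ε := Real.sq_sqrt (by linarith)
  have hs0 : 0 ≤ Real.sqrt (1 - ε) := Real.sqrt_nonneg _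
  field_simp
  nlinarith

theorem sqrt_mem {ε : ℝ} (h0 : 0 < ε) (h1 : ε < 1) :
    0 ≤ Real.sqrt (1 - ε) ∧ Real.sqrt (1 - ε) ≤ 1 ∧ 1 - ε ≤ Real.sqrt (1 - ε) := by
  have hs2 : Real.sqrt (1 - ε) ^ 2 = 1 - ε := Real.sq_sqrt (by linarith)
  have hs0 : 0 ≤ Real.sqrt (1 - ε) := Real.sqrt_nonneg _
  exact ⟨hs0, by nlinarith, by nlinarith⟩

theorem isHermitianForm_bEps {ε₀ ε : ℝ} (hε₀ : 1 < ε₀) (h0 : 0 < ε) (h1 : ε < 1)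
    (R : Set Plane) : IsHermitianForm (E := H1) (bcEpsForm ε₀ R ε) (boundConst ε₀) := by
  have hX := isHermitianForm_crossForm
  have hG := isHermitianForm_gradForm
  refine ((((hX Rᶜ).smul _).add (((((hG R 0).add ((hG R 1).smul ε₀)).add
    ((hX R).smul _))).smul _)).add (isHermitianForm_cFormH1 hε₀ R)).mono ?_
  obtain ⟨hs0, hs1, hs2⟩ := sqrt_mem h0 h1
  have hγ : 0 < ε₀ - 1 := by linarith
  rw [sqrt_quotient_eq h0 h1, abs_neg, abs_of_nonneg (by positivity), abs_of_nonneg hs0,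
    abs_of_nonneg (by linarith : 0 ≤ ε₀), abs_of_nonneg (by positivity : 0 ≤ (ε₀ - 1 + ε)⁻¹)]
  have e1 : 1 / (1 + Real.sqrt (1 - ε)) ≤ 1 := by rw [div_le_one (by linarith)]; linarith
  have e2 : (ε₀ - 1 + ε)⁻¹ ≤ (ε₀ - 1)⁻¹ := by gcongr; linarith
  have e3 : (ε₀ - 1 + ε)⁻¹ * (2 + ε₀ * 2 + Real.sqrt (1 - ε) * 2)
      ≤ (ε₀ - 1)⁻¹ * (2 + ε₀ * 2 + 1 * 2) := by gcongr
  have e4 : 0 ≤ (ε₀ - 1)⁻¹ ^ 2 * (2 + 4 * ε₀) := by positivity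
  unfold boundConst
  linarith

/-- The coefficients of `b_ε` converge to those of `b` at the rate `ε`. -/
theorem abs_coeff_le {g ε : ℝ} (hg : 0 < g) (h0 : 0 < ε) (h1 : ε < 1) :
    |(Real.sqrt (1 - ε) - 1) / ε + 1 / 2| ≤ ε ∧ |(g + ε)⁻¹ - g⁻¹| ≤ ε * g⁻¹ ^ 2 ∧
      |(g + ε)⁻¹ * Real.sqrt (1 - ε) - g⁻¹| ≤ ε * (g⁻¹ ^ 2 * (g + 1)) := by
  obtain ⟨hs0, hs1, hs2⟩ := sqrt_mem h0 h1
  rw [sqrt_quotient_eq h0 h1]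
  set s := Real.sqrt (1 - ε)
  have hgε : (g + ε)⁻¹ ≤ g⁻¹ := by gcongr; linarith
  have hi : 0 < g⁻¹ := inv_pos.2 hg
  have hi' : 0 < (g + ε)⁻¹ := inv_pos.2 (by linarith)
  have hd : g⁻¹ - (g + ε)⁻¹ = ε * (g⁻¹ * (g + ε)⁻¹) := by field_simp; ring
  have hd' : g⁻¹ - (g + ε)⁻¹ ≤ ε * g⁻¹ ^ 2 := by rw [hd, sq]; gcongr
  refine ⟨?_, ?_, ?_⟩
  · have h3 : -(1 / (1 + s)) + 1 / 2 = -((1 - s) / (2 * (1 + s))) := by field_simp; ring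
    rw [h3, abs_neg, abs_of_nonneg (div_nonneg (by linarith) (by linarith)),
      div_le_iff₀ (by linarith)]
    nlinarith
  · rw [abs_sub_comm, abs_of_nonneg (by linarith)]; exact hd'
  · have h4 : g⁻¹ - (g + ε)⁻¹ * s = (g⁻¹ - (g + ε)⁻¹) + (g + ε)⁻¹ * (1 - s) := by ring
    have h5 : (g + ε)⁻¹ * (1 - s) ≤ g⁻¹ * ε := by gcongr; linarith
    have h6 : 0 ≤ (g + ε)⁻¹ * (1 - s) := mul_nonneg hi'.le (by linarith)
    rw [abs_sub_comm, abs_of_nonneg (by linarith), h4]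
    have h7 : ε * (g⁻¹ ^ 2 * (g + 1)) = ε * g⁻¹ ^ 2 + g⁻¹ * ε := by field_simp; ring
    linarith

theorem bEps_sub_b (ε₀ ε : ℝ) (R : Set Plane) (u v : H1) :
    bcEpsForm ε₀ R ε u v - bcForm ε₀ R u v
      = ((((Real.sqrt (1 - ε) - 1) / ε + 1 / 2 : ℝ) : ℂ) • crossForm Rᶜ
        + ((((ε₀ - 1 + ε)⁻¹ - (ε₀ - 1)⁻¹ : ℝ) : ℂ) • (gradForm R 0 + (ε₀ : ℂ) • gradForm R 1)
        + (((ε₀ - 1 + ε)⁻¹ * Real.sqrt (1 - ε) - (ε₀ - 1)⁻¹ : ℝ) : ℂ) • crossForm R)) u v := by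
  simp only [bcEpsForm, bEpsForm, bcForm, bForm, LinearMap.add_apply, LinearMap.smul_apply,
    Pi.add_apply, Pi.smul_apply, smul_eq_mul]
  push_cast
  ring

/-- The forms `b_ε` converge to `b` at the rate `ε`. -/
theorem norm_bEps_sub_b_le {ε₀ ε : ℝ} (hε₀ : 1 < ε₀) (h0 : 0 < ε) (h1 : ε < 1)
    (R : Set Plane) (u v : H1) :
    ‖bcEpsForm ε₀ R ε u v - bcForm ε₀ R u v‖
      ≤ boundConst ε₀ * ε * ‖u‖ * ‖v‖ := by
  have hX := isHermitianForm_crossForm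
  have hG := isHermitianForm_gradForm
  have hγ : 0 < ε₀ - 1 := by linarith
  obtain ⟨a1, a2, a3⟩ := abs_coeff_le hγ h0 h1
  rw [sub_add_cancel] at a3
  have hF := ((hX Rᶜ).smul ((Real.sqrt (1 - ε) - 1) / ε + 1 / 2)).add
    ((((hG R 0).add ((hG R 1).smul ε₀)).smul ((ε₀ - 1 + ε)⁻¹ - (ε₀ - 1)⁻¹)).add
      ((hX R).smul ((ε₀ - 1 + ε)⁻¹ * Real.sqrt (1 - ε) - (ε₀ - 1)⁻¹)))
  rw [bEps_sub_b]
  refine (hF.mono ?_).bound u v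
  rw [abs_of_nonneg (by linarith : 0 ≤ ε₀)]
  have h2 : 0 ≤ (ε₀ - 1)⁻¹ * (4 + 2 * ε₀) := by positivity
  refine (add_le_add (mul_le_mul_of_nonneg_right a1 zero_le_two)
    (add_le_add (mul_le_mul_of_nonneg_right a2 (by linarith))
      (mul_le_mul_of_nonneg_right a3 zero_le_two))).trans ?_
  have h3 : ε * 2 + (ε * (ε₀ - 1)⁻¹ ^ 2 * (2 + ε₀ * 2) + ε * ((ε₀ - 1)⁻¹ ^ 2 * ε₀) * 2)
    = (2 + (ε₀ - 1)⁻¹ ^ 2 * (2 + 4 * ε₀)) * ε := by ring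
  rw [h3]
  refine mul_le_mul_of_nonneg_right ?_ h0.le
  unfold boundConst
  linarith

theorem isHermitianForm_b {ε₀ : ℝ} (hε₀ : 1 < ε₀) (R : Set Plane) :
    ∃ M, IsHermitianForm (E := H1) (bcForm ε₀ R) M := by
  have hX := isHermitianForm_crossForm
  have hG := isHermitianForm_gradForm
  have h := (((hX Rᶜ).smul (-(1 / 2))).add ((((hG R 0).add ((hG R 1).smul ε₀)).add
    (hX R)).smul (ε₀ - 1)⁻¹)).add (isHermitianForm_cFormH1 hε₀ R)
  have e : bForm ε₀ R = ((-(1 / 2) : ℝ) : ℂ) • crossForm Rᶜ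
      + (((ε₀ - 1)⁻¹ : ℝ) : ℂ) • (gradForm R 0 + (ε₀ : ℂ) • gradForm R 1 + crossForm R) := by
    unfold bForm; push_cast; rfl
  rw [bcForm, e]
  exact ⟨_, h⟩

theorem aForm_eq_zero {R : Set Plane} {θ : Plane} {v : H1} (hv : v ∈ V R θ) (φ : H1) :
    aForm R v φ = 0 := by
  change ∫ y in Rᶜ, (divg v y * conj (divg φ y) + curl v y * conj (curl φ y)) ∂cellMeasure = 0
  refine integral_eq_zero_of_ae ?_
  filter_upwards [hv.2] with y hy
  simp [hy.1, hy.2]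

/-! ### Integration over the cell -/

/-- The cell in coordinates is a product of intervals. -/
theorem measurePreserving_toLp_cell : MeasurePreserving (WithLp.toLp 2 : (Fin 2 → ℝ) → Plane)
    (volume.restrict (Set.Icc (fun _ => -Real.pi) (fun _ => Real.pi))) cellMeasure := by
  have h := (PiLp.volume_preserving_toLp (Fin 2)).restrict_preimage measurableSet_cell
  have e : (WithLp.toLp 2 : (Fin 2 → ℝ) → Plane) ⁻¹' cell
      = Set.pi Set.univ fun _ => Set.Ico (-Real.pi) Real.pi := by
    ext x; simp [cell]
  rwa [e, volume_pi, Measure.restrict_congr_set Measure.univ_pi_Ico_ae_eq_Icc] at h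

theorem integral_cell (f : Plane → ℂ) : ∫ y, f y ∂cellMeasure
    = ∫ x in Set.Icc (fun _ => -Real.pi) (fun _ => Real.pi), f (WithLp.toLp 2 x) :=
  (measurePreserving_toLp_cell.integral_comp
    (MeasurableEquiv.toLp 2 (Fin 2 → ℝ)).measurableEmbedding f).symm

/-- The integral of a partial derivative over the cell vanishes if the values on the two opposite
sides agree. -/
theorem integral_partial_eq_zero {ψ : Plane → ℂ} (hψ : ContDiff ℝ 1 ψ) (j : Fin 2)
    (hper : ∀ y : Plane, y j = -Real.pi →
      ψ (y + EuclideanSpace.single j (2 * Real.pi)) = ψ y) :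
    ∫ y, fderiv ℝ ψ y (EuclideanSpace.single j 1) ∂cellMeasure = 0 := by
  rw [integral_cell]
  let L : (Fin 2 → ℝ) →L[ℝ] Plane := (PiLp.continuousLinearEquiv 2 ℝ (fun _ : Fin 2 => ℝ)).symm
  have hL : ∀ x, L x = WithLp.toLp 2 x := fun x => rfl
  have hLs : ∀ i, L (Pi.single i 1) = EuclideanSpace.single i 1 := fun i => rfl
  let f : Fin 2 → (Fin 2 → ℝ) → ℂ := fun i x => if i = j then ψ (L x) else 0
  let f' : Fin 2 → (Fin 2 → ℝ) → (Fin 2 → ℝ) →L[ℝ] ℂ := fun i x =>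
    if i = j then (fderiv ℝ ψ (L x)).comp L else 0
  have hc : Continuous fun x => ∑ i, f' i x (Pi.single i 1) := by
    refine continuous_finsetSum _ fun i _ => ?_
    by_cases hi : i = j
    · simp only [f', hi, if_true]
      exact (((hψ.continuous_fderiv one_ne_zero).comp L.continuous).clm_apply
        continuous_const : _)
    · simp only [f', hi, if_false]
      exact continuous_const
  have hdiv := integral_divergence_of_hasFDerivAt_off_countable' (fun _ => -Real.pi)
    (fun _ => Real.pi) (fun _ => by linarith [Real.pi_pos]) f f' ∅ Set.countable_empty
    (fun i => by
      by_cases hi : i = j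
      · simp only [f, hi, if_true]
        exact (hψ.continuous.comp L.continuous).continuousOn
      · simp only [f, hi, if_false]
        exact continuousOn_const)
    (fun x _ i => by
      by_cases hi : i = j
      · simp only [f, f', hi, if_true]
        exact ((hψ.differentiable one_ne_zero) (L x)).hasFDerivAt.comp x L.hasFDerivAt
      · simp only [f, f', hi, if_false]
        exact hasFDerivAt_const _ _)
    (hc.continuousOn.integrableOn_compact isCompact_Icc)
  have e : ∀ x, ∑ i, f' i x (Pi.single i 1)
      = fderiv ℝ ψ (WithLp.toLp 2 x) (EuclideanSpace.single j 1) := fun x => by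
    rw [Finset.sum_eq_single j]
    · simp only [f', if_true, ContinuousLinearMap.comp_apply, hLs, hL]
    · intro i _ hi; simp [f', hi]
    · simp
  simp only [e] at hdiv
  rw [hdiv]
  refine Finset.sum_eq_zero fun i _ => ?_
  rw [sub_eq_zero]
  refine integral_congr_ae (Filter.Eventually.of_forall fun x => ?_)
  by_cases hi : i = j
  · subst hi
    simp only [f, if_true, hL]
    rw [← hper (WithLp.toLp 2 (i.insertNth (-Real.pi) x)) (by simp)]
    congr 1
    ext l
    refine Fin.succAboveCases i ?_ (fun l => ?_) l
    · simp; ring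
    · simp [Fin.succAbove_ne]
  · simp only [f, hi, if_false]

/-! ### Completeness of the exponentials on the cell -/

section Completeness

-- The Fourier basis of the torus refers to the normalised Haar measure.
local instance : MeasureSpace UnitAddCircle := ⟨AddCircle.haarAddCircle⟩

/-- An `L²` function on the unit box that is orthogonal to all exponentials vanishes. -/
theorem ae_eq_zero_of_mFourier {a : Fin 2 → ℝ} {F : (Fin 2 → ℝ) → ℂ}
    (hF : MemLp F 2 (volume.restrict {x | ∀ i, x i ∈ Set.Ioc (a i) (a i + 1)}))
    (h : ∀ k : Fin 2 → ℤ, ∫ x in {x | ∀ i, x i ∈ Set.Ioc (a i) (a i + 1)},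
      UnitAddTorus.mFourier (-k) (fun i => (x i : UnitAddCircle)) * F x = 0) :
    F =ᵐ[volume.restrict {x | ∀ i, x i ∈ Set.Ioc (a i) (a i + 1)}] 0 := by
  set box := {x : Fin 2 → ℝ | ∀ i, x i ∈ Set.Ioc (a i) (a i + 1)}
  have hbox : MeasurableSet box := MeasurableSet.univ_pi' fun i => measurableSet_Ioc
  have hσ : MeasurePreserving
      (fun t : UnitAddTorus (Fin 2) => (UnitAddTorus.measurableEquivPiIoc a t).1) volume
      (volume.restrict box) := by
    refine MeasurePreserving.comp (g := Subtype.val) ⟨measurable_subtype_coe, ?_⟩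
      (UnitAddTorus.measurePreserving_equivPiIoc a)
    exact map_comap_subtype_coe hbox volume
  have hg := hF.comp_measurePreserving hσ
  have hσq : ∀ x ∈ box,
      (UnitAddTorus.measurableEquivPiIoc a fun i => (x i : UnitAddCircle)).1 = x := fun x hx =>
    congrArg Subtype.val ((UnitAddTorus.measurableEquivPiIoc a).apply_symm_apply ⟨x, hx⟩)
  have h0 : hg.toLp _ = 0 := by
    rw [← UnitAddTorus.mFourierBasis.repr.map_eq_zero_iff]
    ext k
    rw [UnitAddTorus.mFourierBasis_repr, lp.coeFn_zero, Pi.zero_apply]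
    have : UnitAddTorus.mFourierCoeff (hg.toLp _) k = UnitAddTorus.mFourierCoeff
        (F ∘ fun t => (UnitAddTorus.measurableEquivPiIoc a t).1) k := by
      refine integral_congr_ae ?_
      filter_upwards [hg.coeFn_toLp] with t ht
      rw [ht]
    rw [this, UnitAddTorus.mFourierCoeff_eq_integral _ k a, ← h k]
    refine setIntegral_congr_fun hbox fun x hx => ?_
    simp only [Function.comp_apply, hσq x hx, smul_eq_mul]
  have h1 : eLpNorm F 2 (volume.restrict box) = 0 := by
    rw [← eLpNorm_comp_measurePreserving hF.1 hσ, eLpNorm_eq_zero_iff hg.1 (by norm_num)]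
    exact hg.coeFn_toLp.symm.trans (h0 ▸ Lp.coeFn_zero _ _ _)
  exact (eLpNorm_eq_zero_iff hF.1 (by norm_num)).1 h1

/-- The lattice vector with integer coordinates `k`. -/
def kvec (k : Fin 2 → ℤ) : Plane := WithLp.toLp 2 fun i => (k i : ℝ)

/-- An `L²` function on the cell that is orthogonal to all exponentials `e^{i k·y}` vanishes. -/
theorem ae_eq_zero_of_bloch {f : Plane → ℂ} (hf : MemLp f 2 cellMeasure)
    (h : ∀ k : Fin 2 → ℤ, ∫ y, bloch (-kvec k) y * f y ∂cellMeasure = 0) :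
    f =ᵐ[cellMeasure] 0 := by
  set box := {x : Fin 2 → ℝ | ∀ i, x i ∈ Set.Ioc (-(1 / 2) : ℝ) (-(1 / 2) + 1)}
  have hpi : (2 * Real.pi) ≠ 0 := by positivity
  set d : (Fin 2 → ℝ) → (Fin 2 → ℝ) := fun x => (2 * Real.pi) • x
  have hde : MeasurableEmbedding d := (Homeomorph.smulOfNeZero _ hpi).measurableEmbedding
  obtain ⟨c, hc0, hct, hc⟩ : ∃ c : ENNReal, c ≠ 0 ∧ c ≠ ⊤ ∧
      Measure.map d (volume.restrict box)
        = c • volume.restrict (Set.Icc (fun _ : Fin 2 => -Real.pi) (fun _ => Real.pi)) := by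
    refine ⟨ENNReal.ofReal |((2 * Real.pi) ^ Module.finrank ℝ (Fin 2 → ℝ))⁻¹|, ?_,
      ENNReal.ofReal_ne_top, ?_⟩
    · rw [Ne, ENNReal.ofReal_eq_zero, not_le]; positivity
    have e : box = d ⁻¹' (Set.pi Set.univ fun _ => Set.Ioc (-Real.pi) Real.pi) := by
      ext x
      have hp := Real.pi_pos
      simp only [box, d, Set.mem_ofPred_eq, Set.mem_preimage, Set.mem_univ_pi, Set.mem_Ioc,
        Pi.smul_apply, smul_eq_mul]
      refine forall_congr' fun i => and_congr ⟨fun h => by nlinarith, fun h => by nlinarith⟩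
        ⟨fun h => by nlinarith, fun h => by nlinarith⟩
    rw [e, ← hde.restrict_map, Measure.map_addHaar_smul _ hpi, Measure.restrict_smul,
      volume_pi, Measure.restrict_congr_set Measure.univ_pi_Ioc_ae_eq_Icc]
  set F : (Fin 2 → ℝ) → ℂ := fun x => f (WithLp.toLp 2 (d x))
  have hf1 := hf.comp_measurePreserving measurePreserving_toLp_cell
  have hf2 : MemLp (f ∘ WithLp.toLp 2) 2 (Measure.map d (volume.restrict box)) := by
    rw [hc]; exact hf1.smul_measure hct
  have hF : MemLp F 2 (volume.restrict box) := (hde.memLp_map_measure_iff).1 hf2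
  have key : F =ᵐ[volume.restrict box] 0 := by
    refine ae_eq_zero_of_mFourier (a := fun _ => -(1 / 2)) hF fun k => ?_
    have e1 : ∀ x : Fin 2 → ℝ, UnitAddTorus.mFourier (-k) (fun i => (x i : UnitAddCircle)) * F x
        = (fun z => bloch (-kvec k) (WithLp.toLp 2 z) * f (WithLp.toLp 2 z)) (d x) := fun x => by
      congr 1
      simp only [UnitAddTorus.mFourier, ContinuousMap.coe_mk, fourier_coe_apply, bloch, kvec,
        Fin.prod_univ_two, Fin.sum_univ_two, ← Complex.exp_add, d, Pi.smul_apply, smul_eq_mul]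
      congr 1
      simp
      ring
    simp only [e1]
    rw [← hde.integral_map (μ := volume.restrict box)
      (fun z => bloch (-kvec k) (WithLp.toLp 2 z) * f (WithLp.toLp 2 z)), hc,
      integral_smul_measure, ← integral_cell (fun y => bloch (-kvec k) y * f y), h k, smul_zero]
  have h1 : eLpNorm (f ∘ WithLp.toLp 2) 2
      (c • volume.restrict (Set.Icc (fun _ : Fin 2 => -Real.pi) (fun _ => Real.pi))) = 0 := by
    rw [← hc, hde.eLpNorm_map_measure]
    exact (eLpNorm_eq_zero_iff hF.1 (by norm_num)).2 key
  rw [eLpNorm_smul_measure_of_ne_top (by norm_num), smul_eq_mul, mul_eq_zero] at h1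
  have h2 := h1.resolve_left (by
    simp [ENNReal.rpow_eq_zero_iff, hc0, hct])
  rw [eLpNorm_comp_measurePreserving hf.1 measurePreserving_toLp_cell] at h2
  exact (eLpNorm_eq_zero_iff hf.1 (by norm_num)).1 h2

end Completeness

/-! ### Bloch factors -/

theorem bloch_add (a b y : Plane) : bloch (a + b) y = bloch a y * bloch b y := by
  rw [bloch, bloch, bloch, ← Complex.exp_add]
  congr 1
  simp only [Fin.sum_univ_two, PiLp.add_apply]
  push_cast
  ring

theorem bloch_neg (a y : Plane) : bloch (-a) y = conj (bloch a y) := by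
  rw [bloch, bloch, ← Complex.exp_conj]
  congr 1
  simp only [Fin.sum_univ_two, PiLp.neg_apply, map_mul, Complex.conj_I, Complex.conj_ofReal]
  push_cast
  ring

theorem bloch_zero (y : Plane) : bloch 0 y = 1 := by simp [bloch]

theorem norm_bloch (a y : Plane) : ‖bloch a y‖ = 1 := by
  rw [bloch, mul_comm, Complex.norm_exp_ofReal_mul_I]

theorem bloch_neg_mul (a y : Plane) : bloch (-a) y * bloch a y = 1 := by
  rw [← bloch_add, neg_add_cancel, bloch_zero]

theorem hasFDerivAt_bloch (κ y : Plane) : ∃ L : Plane →L[ℝ] ℂ, HasFDerivAt (bloch κ) L y ∧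
    ∀ j, L (EuclideanSpace.single j 1) = Complex.I * κ j * bloch κ y := by
  let l : Plane →L[ℝ] ℝ := ∑ i, κ i • EuclideanSpace.proj (𝕜 := ℝ) i
  have hl : ∀ y, l y = ∑ i, κ i * y i := fun y => by simp [l]
  have h1 : HasFDerivAt (fun y => Complex.I * ((l y : ℝ) : ℂ))
      (Complex.I • (Complex.ofRealCLM.comp l)) y :=
    ((Complex.ofRealCLM.comp l).hasFDerivAt).const_mul Complex.I
  have h2 := h1.cexp
  have e : bloch κ = fun y => Complex.exp (Complex.I * ((l y : ℝ) : ℂ)) := by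
    funext y; rw [hl]; rfl
  refine ⟨_, e ▸ h2, fun j => ?_⟩
  have h3 : l (EuclideanSpace.single j 1) = κ j := by
    rw [hl, Finset.sum_eq_single j]
    · simp
    · intro i _ hi; simp [hi]
    · simp
  rw [e]
  simp [h3]
  ring

theorem fderiv_bloch (κ y : Plane) (j : Fin 2) :
    fderiv ℝ (bloch κ) y (EuclideanSpace.single j 1) = Complex.I * κ j * bloch κ y := by
  obtain ⟨L, hL, h⟩ := hasFDerivAt_bloch κ y
  rw [hL.fderiv, h]

theorem contDiff_bloch (κ : Plane) : ContDiff ℝ ∞ (bloch κ) := by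
  have h1 : ContDiff ℝ ∞ fun y : Plane => ∑ i, κ i * y i := by fun_prop
  exact (contDiff_const.mul (Complex.ofRealCLM.contDiff.comp h1)).cexp

theorem continuous_bloch (κ : Plane) : Continuous (bloch κ) := (contDiff_bloch κ).continuous

theorem bloch_kvec_periodic (k : Fin 2 → ℤ) (y : Plane) (j : Fin 2) :
    bloch (kvec k) (y + EuclideanSpace.single j (2 * Real.pi)) = bloch (kvec k) y := by
  have h : Complex.I * ((∑ i, kvec k i
      * (y + EuclideanSpace.single j (2 * Real.pi) : Plane) i : ℝ) : ℂ)
      = Complex.I * ((∑ i, kvec k i * y i : ℝ) : ℂ) + (k j : ℂ) * (2 * Real.pi * Complex.I) := by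
    have : ∑ i, kvec k i * (y + EuclideanSpace.single j (2 * Real.pi) : Plane) i
        = ∑ i, kvec k i * y i + k j * (2 * Real.pi) := by
      simp only [PiLp.add_apply, mul_add, Finset.sum_add_distrib]
      congr 1
      rw [Finset.sum_eq_single j]
      · simp [kvec]
      · intro i _ hi; simp [hi]
      · simp
    rw [this]; push_cast; ring
  rw [bloch, h, Complex.exp_add, Complex.exp_int_mul_two_pi_mul_I, mul_one, bloch]

theorem integral_bloch_eq_zero {k : Fin 2 → ℤ} (hk : k ≠ 0) :
    ∫ y, bloch (kvec k) y ∂cellMeasure = 0 := by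
  obtain ⟨j, hj⟩ := Function.ne_iff.1 hk
  have h := integral_partial_eq_zero ((contDiff_bloch (kvec k)).of_le (by simp)) j
    (fun y _ => bloch_kvec_periodic k y j)
  simp only [fderiv_bloch] at h
  rw [integral_const_mul, mul_eq_zero] at h
  refine h.resolve_left (mul_ne_zero Complex.I_ne_zero ?_)
  simpa [kvec] using hj

/-! ### Pairings with test fields -/

theorem memLp_of_continuous {g : Plane → C2} (hg : Continuous g) : MemLp g 2 cellMeasure := by
  obtain ⟨C, hC⟩ := (isCompact_closedBall (0 : Plane) (2 * Real.pi)).exists_bound_of_continuousOn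
    hg.continuousOn
  refine MemLp.of_bound hg.aestronglyMeasurable C ?_
  rw [cellMeasure, ae_restrict_iff' measurableSet_cell]
  exact Filter.Eventually.of_forall fun y hy => hC y (cell_subset_closedBall hy)

theorem integrable_of_continuous {g : Plane → ℂ} (hg : Continuous g) :
    Integrable g cellMeasure := by
  obtain ⟨C, hC⟩ := (isCompact_closedBall (0 : Plane) (2 * Real.pi)).exists_bound_of_continuousOn
    hg.continuousOn
  refine Integrable.of_bound hg.aestronglyMeasurable C ?_
  rw [cellMeasure, ae_restrict_iff' measurableSet_cell]
  exact Filter.Eventually.of_forall fun y hy => hC y (cell_subset_closedBall hy)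

/-- A continuous field, as an element of `L²`. -/
def ofContinuous {g : Plane → C2} (hg : Continuous g) : L2 := (memLp_of_continuous hg).toLp g

/-- The pairing `∫_□ f · conj g` of a field `f` with a test field `g`. -/
def pair (g : Plane → C2) (f : L2) : ℂ := ∫ y, inner ℂ (g y) (f y) ∂cellMeasure

theorem coeFn_ofContinuous {g : Plane → C2} (hg : Continuous g) :
    ofContinuous hg =ᵐ[cellMeasure] g := MemLp.coeFn_toLp _

theorem inner_ofContinuous {g : Plane → C2} (hg : Continuous g) (f : L2) :
    inner ℂ (ofContinuous hg) f = pair g f := by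
  rw [L2.inner_def]
  refine integral_congr_ae ?_
  filter_upwards [coeFn_ofContinuous hg] with y hy
  rw [hy]

theorem integrable_pair {g : Plane → C2} (hg : Continuous g) (f : L2) :
    Integrable (fun y => inner ℂ (g y) (f y)) cellMeasure := by
  refine (L2.integrable_inner (𝕜 := ℂ) (ofContinuous hg) f).congr ?_
  filter_upwards [coeFn_ofContinuous hg] with y hy
  rw [hy]

theorem pair_add_right {g : Plane → C2} (hg : Continuous g) (f f' : L2) :
    pair g (f + f') = pair g f + pair g f' := by
  simp only [← inner_ofContinuous hg, inner_add_right]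

theorem pair_smul_right {g : Plane → C2} (hg : Continuous g) (a : ℂ) (f : L2) :
    pair g (a • f) = a * pair g f := by
  simp only [← inner_ofContinuous hg, inner_smul_right]

theorem pair_add_left {g g' : Plane → C2} (hg : Continuous g) (hg' : Continuous g') (f : L2) :
    pair (fun y => g y + g' y) f = pair g f + pair g' f := by
  rw [pair, pair, pair, ← integral_add (integrable_pair hg f) (integrable_pair hg' f)]
  simp only [inner_add_left]

theorem pair_smul_left (g : Plane → C2) (a : ℂ) (f : L2) :
    pair (fun y => a • g y) f = conj a * pair g f := by
  rw [pair, pair, ← integral_const_mul]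
  simp only [inner_smul_left]

theorem pair_real_smul {φ : Plane → ℝ} (hφ : Continuous φ) (x : C2) (f : L2) :
    pair (fun y => φ y • x) f = inner ℂ x (∫ y, φ y • f y ∂cellMeasure) := by
  rw [← integral_inner (integrable_smul_L2 hφ f)]
  refine integral_congr_ae (Filter.Eventually.of_forall fun y => ?_)
  simp only [RCLike.real_smul_eq_coe_smul (K := ℂ), inner_smul_left, inner_smul_right,
    RCLike.conj_ofReal]

theorem intByParts_iff {j : Fin 2} {φ : Plane → ℝ} (hφ : ContDiff ℝ ∞ φ) (w : Jet) :
    IntByParts j φ w ↔ ∀ x : C2,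
      pair (fun y => fderiv ℝ φ y (EuclideanSpace.single j 1) • x) w.fst
        = -pair (fun y => φ y • x) (w.snd j) := by
  simp only [pair_real_smul (continuous_partial hφ j), pair_real_smul hφ.continuous]
  constructor
  · intro h x
    rw [h, inner_neg_right]
  · intro h
    refine ext_inner_left ℂ fun x => ?_
    rw [h, inner_neg_right]

theorem continuous_partial_complex {Φ : Plane → ℂ} (hΦ : ContDiff ℝ ∞ Φ) (j : Fin 2) :
    Continuous fun y => fderiv ℝ Φ y (EuclideanSpace.single j 1) :=
  (hΦ.continuous_fderiv (by simp)).clm_apply continuous_const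

/-- Integration by parts against the real and the imaginary part of a complex test function. -/
theorem pair_partial_of_intByParts {j : Fin 2} {Φ : Plane → ℂ} (hΦ : ContDiff ℝ ∞ Φ) {w : Jet}
    (hre : IntByParts j (fun y => (Φ y).re) w) (him : IntByParts j (fun y => (Φ y).im) w)
    (x : C2) : pair (fun y => fderiv ℝ Φ y (EuclideanSpace.single j 1) • x) w.fst
      = -pair (fun y => Φ y • x) (w.snd j) := by
  have hR : ContDiff ℝ ∞ fun y => (Φ y).re := Complex.reCLM.contDiff.comp hΦ
  have hI : ContDiff ℝ ∞ fun y => (Φ y).im := Complex.imCLM.contDiff.comp hΦ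
  have hd : ∀ y, HasFDerivAt Φ (fderiv ℝ Φ y) y := fun y =>
    ((hΦ.differentiable (by simp)) y).hasFDerivAt
  have hdR : ∀ y v, fderiv ℝ (fun y => (Φ y).re) y v = (fderiv ℝ Φ y v).re := fun y v => by
    have : HasFDerivAt (fun y => (Φ y).re) (Complex.reCLM.comp (fderiv ℝ Φ y)) y :=
      Complex.reCLM.hasFDerivAt.comp y (hd y)
    rw [this.fderiv]; rfl
  have hdI : ∀ y v, fderiv ℝ (fun y => (Φ y).im) y v = (fderiv ℝ Φ y v).im := fun y v => by
    have : HasFDerivAt (fun y => (Φ y).im) (Complex.imCLM.comp (fderiv ℝ Φ y)) y :=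
      Complex.imCLM.hasFDerivAt.comp y (hd y)
    rw [this.fderiv]; rfl
  have hsplit : ∀ z : ℂ, z • x = z.re • x + z.im • (Complex.I • x) := fun z => by
    rw [RCLike.real_smul_eq_coe_smul (K := ℂ), RCLike.real_smul_eq_coe_smul (K := ℂ), smul_smul,
      ← add_smul]
    exact congrArg (· • x) (Complex.re_add_im z).symm
  have h1 := (intByParts_iff hR w).1 hre x
  have h2 := (intByParts_iff hI w).1 him (Complex.I • x)
  have c1 := continuous_partial hR j
  have c2 := continuous_partial hI j
  simp only [hdR] at h1 c1
  simp only [hdI] at h2 c2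
  have d1 : Continuous fun y => (fderiv ℝ Φ y (EuclideanSpace.single j 1)).re • x :=
    c1.smul continuous_const
  have d2 : Continuous fun y => (fderiv ℝ Φ y (EuclideanSpace.single j 1)).im • Complex.I • x :=
    c2.smul continuous_const
  have d3 : Continuous fun y => (Φ y).re • x := hR.continuous.smul continuous_const
  have d4 : Continuous fun y => (Φ y).im • Complex.I • x := hI.continuous.smul continuous_const
  rw [show (fun y => fderiv ℝ Φ y (EuclideanSpace.single j 1) • x) = _ from
      funext fun y => hsplit _, show (fun y => Φ y • x) = _ from funext fun y => hsplit _,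
    pair_add_left d1 d2, pair_add_left d3 d4, h1, h2]
  ring

/-! ### Multiplication by a Bloch factor -/

theorem memLp_blochMul (θ : Plane) (f : L2) : MemLp (fun y => bloch θ y • f y) 2 cellMeasure :=
  (Lp.memLp f).of_le ((continuous_bloch θ).aestronglyMeasurable.smul (Lp.memLp f).1)
    (Filter.Eventually.of_forall fun y => by rw [norm_smul, norm_bloch, one_mul])

/-- The field `e^{iθ·y} f`. -/
def blochMul (θ : Plane) (f : L2) : L2 := (memLp_blochMul θ f).toLp _

theorem coeFn_blochMul (θ : Plane) (f : L2) :
    blochMul θ f =ᵐ[cellMeasure] fun y => bloch θ y • f y := MemLp.coeFn_toLp _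

theorem pair_blochMul (g : Plane → C2) (θ : Plane) (f : L2) :
    pair g (blochMul θ f) = pair (fun y => bloch (-θ) y • g y) f := by
  refine integral_congr_ae ?_
  filter_upwards [coeFn_blochMul θ f] with y hy
  rw [hy, inner_smul_left, inner_smul_right, bloch_neg, Complex.conj_conj]

/-! ### The Fourier basis -/

/-- The eigenvalue `± i` of the rotation `(x₁, x₂) ↦ (x₂, -x₁)`. -/
def sgnI (s : Bool) : ℂ := cond s Complex.I (-Complex.I)

/-- The eigenvector `(1, ± i)` of the rotation `(x₁, x₂) ↦ (x₂, -x₁)`. -/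
def polVec (s : Bool) : C2 := !₂[1, sgnI s]

theorem inner_polVec_apply (s : Bool) (x : C2) :
    inner ℂ (polVec s) x = x 0 + conj (sgnI s) * x 1 := by
  simp [polVec, PiLp.inner_apply, Fin.sum_univ_two, mul_comm]

theorem inner_polVec (s t : Bool) : inner ℂ (polVec s) (polVec t) = if s = t then 2 else 0 := by
  rw [inner_polVec_apply]
  cases s <;> cases t <;> simp [polVec, sgnI] <;> norm_num

theorem eq_zero_of_inner_polVec {x : C2} (h : ∀ s, inner ℂ (polVec s) x = 0) : x = 0 := by
  have h1 := h true
  have h2 := h false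
  simp only [inner_polVec_apply, sgnI, cond_true, cond_false, map_neg, Complex.conj_I] at h1 h2
  have e0 : x 0 = 0 := by linear_combination (h1 + h2) / 2
  have e1 : x 1 = 0 := by
    linear_combination Complex.I * (h1 - h2) / 2 + x 1 * Complex.I_mul_I
  ext i
  fin_cases i
  · exact e0
  · exact e1

theorem continuous_modeFun (κ : Plane) (s : Bool) :
    Continuous fun y => bloch κ y • polVec s := (continuous_bloch κ).smul continuous_const

/-- The field `e^{iκ·y} (1, ± i)`. -/
def mode (κ : Plane) (s : Bool) : L2 := ofContinuous (continuous_modeFun κ s)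

theorem inner_mode (κ : Plane) (s : Bool) (f : L2) :
    inner ℂ (mode κ s) f = pair (fun y => bloch κ y • polVec s) f := inner_ofContinuous _ f

theorem inner_mode_eq (κ : Plane) (s : Bool) (f : L2) :
    inner ℂ (mode κ s) f = ∫ y, bloch (-κ) y * inner ℂ (polVec s) (f y) ∂cellMeasure := by
  rw [inner_mode, pair]
  simp only [inner_smul_left, bloch_neg]

theorem inner_mode_mode (κ κ' : Plane) (s t : Bool) : inner ℂ (mode κ s) (mode κ' t)
    = (∫ y, bloch (κ' - κ) y ∂cellMeasure) * inner ℂ (polVec s) (polVec t) := by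
  rw [inner_mode_eq, ← integral_mul_const]
  refine integral_congr_ae ?_
  filter_upwards [coeFn_ofContinuous (continuous_modeFun κ' t)] with y hy
  rw [mode, hy, inner_smul_right, sub_eq_neg_add, bloch_add, mul_assoc]

theorem inner_mode_blochMul (κ θ : Plane) (s : Bool) (f : L2) :
    inner ℂ (mode κ s) (blochMul θ f) = inner ℂ (mode (κ - θ) s) f := by
  rw [inner_mode, inner_mode, pair_blochMul]
  simp only [smul_smul, ← bloch_add, sub_eq_neg_add]

theorem interior_cell_subset {y : Plane} (hy : y ∈ interior cell) (j : Fin 2) :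
    y j ∈ Set.Ioo (-Real.pi) Real.pi := by
  have ho : IsOpenMap (EuclideanSpace.proj (𝕜 := ℝ) j : Plane → ℝ) :=
    (EuclideanSpace.proj (𝕜 := ℝ) j : Plane →L[ℝ] ℝ).isOpenMap fun t =>
      ⟨EuclideanSpace.single j t, by simp⟩
  have h1 : cell ⊆ (EuclideanSpace.proj (𝕜 := ℝ) j : Plane → ℝ) ⁻¹' Set.Ico (-Real.pi) Real.pi :=
    fun y hy => hy j
  have h2 := interior_mono h1 hy
  rw [← ho.preimage_interior_eq_interior_preimage
    (EuclideanSpace.proj (𝕜 := ℝ) j : Plane →L[ℝ] ℝ).continuous, interior_Ico] at h2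
  exact h2

theorem interior_cell : interior cell = {y | ∀ i, y i ∈ Set.Ioo (-Real.pi) Real.pi} := by
  refine Set.Subset.antisymm (fun y hy j => interior_cell_subset hy j) ?_
  refine interior_maximal (fun y hy i => Set.Ioo_subset_Ico_self (hy i)) ?_
  have : {y : Plane | ∀ i, y i ∈ Set.Ioo (-Real.pi) Real.pi}
      = ⋂ i, (fun y : Plane => y i) ⁻¹' Set.Ioo (-Real.pi) Real.pi := by
    ext y; simp
  rw [this]
  exact isOpen_iInter_of_finite fun i => isOpen_Ioo.preimage (by fun_prop)

/-- The area of the cell. -/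
def cellVol : ℝ := cellMeasure.real Set.univ

theorem cellVol_pos : 0 < cellVol := by
  have h : 0 < cellMeasure Set.univ := by
    rw [cellMeasure, Measure.restrict_apply_univ]
    have ho : (0 : Plane) ∈ interior cell := by
      rw [interior_cell]; intro i; simp [Real.pi_pos]
    exact lt_of_lt_of_le (isOpen_interior.measure_pos _ ⟨0, ho⟩) (measure_mono interior_subset)
  exact ENNReal.toReal_pos h.ne' (measure_ne_top _ _)

/-- The normalising factor of the Fourier basis. -/
def modeScale : ℝ := (Real.sqrt (2 * cellVol))⁻¹

theorem modeScale_pos : 0 < modeScale :=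
  inv_pos.2 (Real.sqrt_pos.2 (mul_pos two_pos cellVol_pos))

theorem modeScale_sq : modeScale ^ 2 * (2 * cellVol) = 1 := by
  have h := cellVol_pos
  rw [modeScale, inv_pow, Real.sq_sqrt (by positivity)]
  field_simp

/-- The normalised modes `e^{i(k+θ)·y} (1, ± i)`. -/
def nmode (θ : Plane) (i : (Fin 2 → ℤ) × Bool) : L2 :=
  (modeScale : ℂ) • mode (kvec i.1 + θ) i.2

theorem inner_nmode (θ : Plane) (i : (Fin 2 → ℤ) × Bool) (f : L2) :
    inner ℂ (nmode θ i) f = modeScale * inner ℂ (mode (kvec i.1 + θ) i.2) f := by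
  rw [nmode, inner_smul_left, Complex.conj_ofReal]

theorem orthonormal_nmode (θ : Plane) : Orthonormal ℂ (nmode θ) := by
  rw [orthonormal_iff_ite]
  rintro ⟨k, s⟩ ⟨l, t⟩
  rw [inner_nmode, nmode, inner_smul_right, inner_mode_mode, inner_polVec]
  have e : kvec l + θ - (kvec k + θ) = kvec (l - k) := by
    ext i; simp [kvec]
  simp only [e]
  by_cases hk : k = l
  · subst hk
    have h0 : kvec 0 = 0 := by ext i; simp [kvec]
    have hI : ∫ y, bloch 0 y ∂cellMeasure = (cellVol : ℂ) := by
      simp only [bloch_zero, integral_const, cellVol, Complex.real_smul, mul_one]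
    rw [sub_self, h0, hI]
    by_cases hs : s = t
    · rw [if_pos hs, if_pos (by rw [hs])]
      have := modeScale_sq
      have h2 : (modeScale : ℂ) ^ 2 * (2 * cellVol) = 1 := by exact_mod_cast this
      linear_combination h2
    · rw [if_neg hs, if_neg (fun h => hs (congrArg Prod.snd h))]
      ring
  · rw [integral_bloch_eq_zero (sub_ne_zero.2 (Ne.symm hk)),
      if_neg (fun h => hk (congrArg Prod.fst h))]
    ring

theorem eq_zero_of_inner_mode {θ : Plane} {f : L2}
    (h : ∀ k s, inner ℂ (mode (kvec k + θ) s) f = 0) : f = 0 := by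
  have hs : ∀ s, ∀ᵐ y ∂cellMeasure, inner ℂ (polVec s) (f y) = 0 := by
    intro s
    have hm : MemLp (fun y => bloch (-θ) y * inner ℂ (polVec s) (f y)) 2 cellMeasure := by
      refine ((Lp.memLp f).norm.const_mul ‖polVec s‖).of_le
        ((continuous_bloch (-θ)).aestronglyMeasurable.mul
        ((innerSL ℂ (polVec s)).continuous.comp_aestronglyMeasurable (Lp.memLp f).1))
        (Filter.Eventually.of_forall fun y => ?_)
      rw [norm_mul, norm_bloch, one_mul]
      exact (norm_inner_le_norm _ _).trans (le_abs_self _)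
    have h0 := ae_eq_zero_of_bloch hm fun k => by
      rw [← h k s, inner_mode_eq]
      refine integral_congr_ae (Filter.Eventually.of_forall fun y => ?_)
      simp only [neg_add, bloch_add]
      ring
    filter_upwards [h0] with y hy
    refine (mul_eq_zero.1 hy).resolve_left fun h => ?_
    have := norm_bloch (-θ) y
    rw [h, norm_zero] at this
    exact zero_ne_one this
  refine Lp.ext ?_
  filter_upwards [hs true, hs false, Lp.coeFn_zero C2 2 cellMeasure] with y h1 h2 h3
  rw [h3, Pi.zero_apply]
  exact eq_zero_of_inner_polVec fun s => by cases s <;> assumption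

/-- The Hilbert basis of `L²(□; ℂ²)` made of the normalised modes with quasi-momentum `θ`. -/
def fourierBasis (θ : Plane) : HilbertBasis ((Fin 2 → ℤ) × Bool) ℂ L2 :=
  HilbertBasis.mkOfOrthogonalEqBot (orthonormal_nmode θ) (by
    rw [Submodule.eq_bot_iff]
    intro f hf
    refine eq_zero_of_inner_mode (θ := θ) fun k s => ?_
    have h := (Submodule.mem_orthogonal _ _).1 hf _ (Submodule.subset_span ⟨(k, s), rfl⟩)
    rw [inner_nmode, mul_eq_zero] at h
    exact h.resolve_left (Complex.ofReal_ne_zero.2 modeScale_pos.ne'))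

theorem fourierBasis_apply (θ : Plane) (i : (Fin 2 → ℤ) × Bool) :
    fourierBasis θ i = nmode θ i := by
  rw [fourierBasis, HilbertBasis.coe_mkOfOrthogonalEqBot]

/-! ### Fourier characterisation of the Sobolev spaces -/

/-- The Fourier coefficients, for the quasi-momentum `θ`, of the entry of `w` in the place of the
`j`-th derivative are `i (k + θ)_j` times those of the field itself. -/
def IsFourierPartial (θ : Plane) (j : Fin 2) (w : Jet) : Prop :=
  ∀ k s, inner ℂ (mode (kvec k + θ) s) (w.snd j)
    = Complex.I * (kvec k + θ) j * inner ℂ (mode (kvec k + θ) s) w.fst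

/-- Parseval's identity transfers integration by parts from the modes to every jet with the right
Fourier coefficients. The hypothesis `hb` says that the boundary term vanishes for each mode. -/
theorem IsFourierPartial.intByParts {θ : Plane} {j : Fin 2} {w : Jet}
    (hw : IsFourierPartial θ j w) {φ : Plane → ℝ} (hφ : ContDiff ℝ ∞ φ)
    (hb : ∀ k, ∀ y : Plane, y j = -Real.pi →
      (φ (y + EuclideanSpace.single j (2 * Real.pi)) : ℂ)
          * bloch (kvec k + θ) (y + EuclideanSpace.single j (2 * Real.pi))
        = φ y * bloch (kvec k + θ) y) : IntByParts j φ w := by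
  rw [intByParts_iff hφ]
  intro x
  have c1 : Continuous fun y => fderiv ℝ φ y (EuclideanSpace.single j 1) • x :=
    (continuous_partial hφ j).smul continuous_const
  have c2 : Continuous fun y => φ y • x := hφ.continuous.smul continuous_const
  have key : ∀ i, inner ℂ (ofContinuous c1) (fourierBasis θ i)
      = -(Complex.I * (kvec i.1 + θ) j) * inner ℂ (ofContinuous c2) (fourierBasis θ i) := by
    rintro ⟨k, s⟩
    set κ := kvec k + θ
    have e : ∀ {ψ : Plane → ℝ} (c : Continuous fun y => ψ y • x),
        inner ℂ (ofContinuous c) (fourierBasis θ (k, s))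
          = modeScale * (inner ℂ x (polVec s) * ∫ y, (ψ y : ℂ) * bloch κ y ∂cellMeasure) := by
      intro ψ c
      rw [fourierBasis_apply, nmode, inner_smul_right, inner_ofContinuous, pair,
        ← integral_const_mul (inner ℂ x (polVec s))]
      congr 1
      refine integral_congr_ae ?_
      filter_upwards [coeFn_ofContinuous (continuous_modeFun κ s)] with y hy
      rw [mode, hy, RCLike.real_smul_eq_coe_smul (K := ℂ), inner_smul_left, inner_smul_right,
        RCLike.conj_ofReal]
      simp only [Complex.coe_algebraMap]
      ring
    have hψ : ContDiff ℝ ∞ fun y => (φ y : ℂ) * bloch κ y :=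
      (Complex.ofRealCLM.contDiff.comp hφ).mul (contDiff_bloch κ)
    have h0 := integral_partial_eq_zero (hψ.of_le (by simp)) j (hb k)
    have hd : ∀ y, fderiv ℝ (fun y => (φ y : ℂ) * bloch κ y) y (EuclideanSpace.single j 1)
        = (fderiv ℝ φ y (EuclideanSpace.single j 1) : ℂ) * bloch κ y
          + Complex.I * κ j * (φ y * bloch κ y) := by
      intro y
      have h1 : HasFDerivAt (fun y => (φ y : ℂ)) (Complex.ofRealCLM.comp (fderiv ℝ φ y)) y :=
        Complex.ofRealCLM.hasFDerivAt.comp y ((hφ.differentiable (by simp)) y).hasFDerivAt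
      obtain ⟨L, hL, hLj⟩ := hasFDerivAt_bloch κ y
      have h2 : HasFDerivAt (fun y => (φ y : ℂ) * bloch κ y) _ y := h1.mul hL
      rw [h2.fderiv]
      simp [hLj]
      ring
    have i1 : Integrable (fun y => (fderiv ℝ φ y (EuclideanSpace.single j 1) : ℂ) * bloch κ y)
        cellMeasure := integrable_of_continuous
      ((Complex.continuous_ofReal.comp (continuous_partial hφ j)).mul (continuous_bloch κ))
    have i2 : Integrable (fun y => (φ y : ℂ) * bloch κ y) cellMeasure :=
      integrable_of_continuous hψ.continuous
    simp only [hd] at h0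
    rw [integral_add i1 (i2.const_mul _), integral_const_mul] at h0
    rw [e c1, e c2]
    linear_combination (modeScale * inner ℂ x (polVec s)) * h0
  have h1 := (fourierBasis θ).hasSum_inner_mul_inner (ofContinuous c1) w.fst
  have h2 := (fourierBasis θ).hasSum_inner_mul_inner (ofContinuous c2) (w.snd j)
  rw [inner_ofContinuous] at h1 h2
  refine h1.unique ?_
  convert! h2.neg using 1
  funext i
  rw [key, fourierBasis_apply, inner_nmode, inner_nmode, hw]
  ring

theorem mem_H1_of_isFourierPartial {θ : Plane} {w : Jet} (hw : ∀ j, IsFourierPartial θ j w) :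
    w ∈ H1 := by
  intro j φ hφ _ hsupp
  refine (hw j).intByParts hφ fun k y hy => ?_
  have hz : ∀ z : Plane, z j ∉ Set.Ioo (-Real.pi) Real.pi → φ z = 0 := fun z hz =>
    image_eq_zero_of_notMem_tsupport fun h => hz (interior_cell_subset (hsupp h) j)
  rw [hz y (by simp [hy]), hz (y + _) (by simp [hy]; intro; linarith)]
  simp

theorem IsFourierPartial.intByParts_periodic {j : Fin 2} {w : Jet} (hw : IsFourierPartial 0 j w)
    {φ : Plane → ℝ} (hφ : ContDiff ℝ ∞ φ) (hp : IsCellPeriodic φ) : IntByParts j φ w :=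
  hw.intByParts hφ fun k y _ => by rw [hp, add_zero, bloch_kvec_periodic]

theorem ae_mem_interior_cell : ∀ᵐ y ∂cellMeasure, y ∈ interior cell := by
  have hconv : Convex ℝ cell := by
    intro x hx y hy a b ha hb hab i
    have := convex_Ico (𝕜 := ℝ) (-Real.pi) Real.pi (hx i) (hy i) ha hb hab
    simpa using this
  have h0 := hconv.addHaar_frontier (volume : Measure Plane)
  rw [cellMeasure, ae_restrict_iff' measurableSet_cell]
  filter_upwards [measure_eq_zero_iff_ae_notMem.1 h0] with y hy hyc
  by_contra hni
  exact hy ⟨subset_closure hyc, hni⟩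

/-- A field is determined by its pairings with test functions supported inside the cell. -/
theorem eq_of_pair_eq {f g : L2} (h : ∀ φ : Plane → ℝ, ContDiff ℝ ∞ φ → HasCompactSupport φ →
    tsupport φ ⊆ interior cell → ∀ x, pair (fun y => φ y • x) f = pair (fun y => φ y • x) g) :
    f = g := by
  rw [← sub_eq_zero]
  have h0 := isOpen_interior.ae_eq_zero_of_integral_contDiff_smul_eq_zero
    (U := interior cell) (μ := cellMeasure) (f := (f - g : L2))
    ((integrable_L2 (f - g)).locallyIntegrable.locallyIntegrableOn _) (fun φ h1 h2 h3 => by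
      refine ext_inner_left ℂ fun x => ?_
      have hc : Continuous fun y => φ y • x := h1.continuous.smul continuous_const
      rw [← pair_real_smul h1.continuous, inner_zero_right, sub_eq_add_neg, ← neg_one_smul ℂ g,
        pair_add_right hc, pair_smul_right hc, h φ h1 h2 h3 x]
      ring)
  refine Lp.ext ?_
  filter_upwards [h0, ae_mem_interior_cell, Lp.coeFn_zero C2 2 cellMeasure] with y h1 h2 h3
  rw [h1 h2, h3, Pi.zero_apply]

/-- The weak derivatives are determined by the field. -/
theorem toL2_injective : Function.Injective toL2 := by
  intro v w h
  have hp : ∀ j, pd v j = pd w j := fun j => by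
    refine eq_of_pair_eq fun φ h1 h2 h3 x => ?_
    have hv := (intByParts_iff h1 v.1).1 (v.2 j φ h1 h2 h3) x
    have hw := (intByParts_iff h1 w.1).1 (w.2 j φ h1 h2 h3) x
    rw [show v.1.fst = w.1.fst from h, hw] at hv
    exact (neg_injective hv).symm
  refine Subtype.ext (WithLp.ofLp_injective 2 (Prod.ext h ?_))
  ext j : 1
  exact hp j

/-- The jet of `e^{iθ·y} v`, for a jet `v`. -/
def blochJet (θ : Plane) (v : Jet) : Jet :=
  WithLp.toLp 2 (blochMul θ v.fst, WithLp.toLp 2 fun j =>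
    blochMul θ (v.snd j + (Complex.I * θ j) • v.fst))

/-- The product rule for the product with a Bloch factor. -/
theorem blochJet_mem_H1 (θ : Plane) {v : Jet} (hv : v ∈ H1) : blochJet θ v ∈ H1 := by
  intro j φ hφ hc hs
  rw [intByParts_iff hφ]
  intro x
  set Φ : Plane → ℂ := fun y => (φ y : ℂ) * bloch (-θ) y
  have hΦ : ContDiff ℝ ∞ Φ := (Complex.ofRealCLM.contDiff.comp hφ).mul (contDiff_bloch _)
  have hd : ∀ y, fderiv ℝ Φ y (EuclideanSpace.single j 1)
      = (fderiv ℝ φ y (EuclideanSpace.single j 1) : ℂ) * bloch (-θ) y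
        - Complex.I * θ j * Φ y := by
    intro y
    have h1 : HasFDerivAt (fun y => (φ y : ℂ)) (Complex.ofRealCLM.comp (fderiv ℝ φ y)) y :=
      Complex.ofRealCLM.hasFDerivAt.comp y ((hφ.differentiable (by simp)) y).hasFDerivAt
    obtain ⟨L, hL, hLj⟩ := hasFDerivAt_bloch (-θ) y
    have h2 : HasFDerivAt Φ _ y := h1.mul hL
    rw [h2.fderiv]
    simp [hLj, Φ]
    ring
  have htest : ∀ g : ℂ →L[ℝ] ℝ, IntByParts j (fun y => g (Φ y)) v := fun g => by
    have hsub : tsupport (fun y => g (Φ y)) ⊆ tsupport φ := by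
      refine closure_mono fun y hy hy0 => hy ?_
      simp [Φ, hy0]
    exact hv j _ (g.contDiff.comp hΦ)
      (hc.mono' (subset_closure.trans hsub)) (hsub.trans hs)
  have h := pair_partial_of_intByParts hΦ (htest Complex.reCLM) (htest Complex.imCLM) x
  have cΦ : Continuous fun y => Φ y • x := hΦ.continuous.smul continuous_const
  have cdΦ : Continuous fun y => fderiv ℝ Φ y (EuclideanSpace.single j 1) • x :=
    (continuous_partial_complex hΦ j).smul continuous_const
  have cΦ' : Continuous fun y => (Complex.I * θ j) • (Φ y • x) :=
    (continuous_const_smul (Complex.I * (θ j : ℂ))).comp cΦ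
  have e1 : (fun y => bloch (-θ) y • fderiv ℝ φ y (EuclideanSpace.single j 1) • x)
      = fun y => fderiv ℝ Φ y (EuclideanSpace.single j 1) • x
        + (Complex.I * θ j) • (Φ y • x) := by
    funext y
    rw [RCLike.real_smul_eq_coe_smul (K := ℂ), smul_smul, smul_smul, ← add_smul, hd]
    congr 1
    simp only [Complex.coe_algebraMap]
    ring
  have e2 : (fun y => bloch (-θ) y • φ y • x) = fun y => Φ y • x := by
    funext y
    rw [RCLike.real_smul_eq_coe_smul (K := ℂ), smul_smul]
    congr 1
    simp only [Complex.coe_algebraMap, Φ]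
    ring
  change pair _ (blochMul θ v.fst) = -pair _ (blochMul θ (v.snd j + (Complex.I * θ j) • v.fst))
  rw [pair_blochMul, pair_blochMul, e1, e2, pair_add_left cdΦ cΦ', pair_smul_left,
    pair_add_right cΦ, pair_smul_right cΦ, h]
  simp only [map_mul, Complex.conj_I, Complex.conj_ofReal]
  ring

theorem isFourierPartial_blochJet {θ θ' : Plane} {j : Fin 2} {v : Jet}
    (hv : IsFourierPartial θ' j v) : IsFourierPartial (θ' + θ) j (blochJet θ v) := by
  intro k s
  change inner ℂ _ (blochMul θ (v.snd j + (Complex.I * θ j) • v.fst))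
    = _ * inner ℂ _ (blochMul θ v.fst)
  rw [inner_mode_blochMul, inner_mode_blochMul,
    show kvec k + (θ' + θ) - θ = kvec k + θ' by abel, inner_add_right, inner_smul_right, hv k s]
  simp only [PiLp.add_apply]
  push_cast
  ring

/-- Membership in `H¹_θ` is a relation between Fourier coefficients. -/
theorem mem_H1theta_iff (θ : Plane) (w : H1) :
    w ∈ H1theta θ ↔ ∀ j, IsFourierPartial θ j w.1 := by
  constructor
  · rintro ⟨v, hv, hwv⟩ j
    have hv0 : IsFourierPartial 0 j v.1 := by
      intro k s
      rw [add_zero]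
      set κ := kvec k
      have hper : ∀ g : ℂ →L[ℝ] ℝ, IntByParts j (fun y => g (bloch κ y)) v.1 := fun g =>
        hv j _ (g.contDiff.comp (contDiff_bloch κ)) fun i y => by rw [bloch_kvec_periodic]
      have h := pair_partial_of_intByParts (contDiff_bloch κ) (hper Complex.reCLM)
        (hper Complex.imCLM) (polVec s)
      simp only [fderiv_bloch] at h
      rw [inner_mode, inner_mode]
      have e : (fun y => (Complex.I * κ j * bloch κ y) • polVec s)
          = fun y => (Complex.I * κ j) • (bloch κ y • polVec s) := by
        funext y; rw [smul_smul]
      rw [e, pair_smul_left] at h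
      simp only [map_mul, Complex.conj_I, Complex.conj_ofReal] at h
      linear_combination h
    have h2 : w = ⟨blochJet θ v.1, blochJet_mem_H1 θ v.2⟩ := by
      refine toL2_injective (Lp.ext ?_)
      filter_upwards [hwv, coeFn_blochMul θ v.1.fst] with y h3 h4
      rw [h3]
      exact h4.symm
    rw [h2]
    have := isFourierPartial_blochJet (θ := θ) hv0
    rwa [zero_add] at this
  · intro hw
    have h0 : ∀ j, IsFourierPartial 0 j (blochJet (-θ) w.1) := fun j => by
      have := isFourierPartial_blochJet (θ := -θ) (hw j)
      rwa [add_neg_cancel] at this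
    refine ⟨⟨blochJet (-θ) w.1, mem_H1_of_isFourierPartial h0⟩,
      fun j φ hφ hp => (h0 j).intByParts_periodic hφ hp, ?_⟩
    filter_upwards [coeFn_blochMul (-θ) w.1.fst] with y hy
    change _ = bloch θ y • blochMul (-θ) w.1.fst y
    rw [hy, smul_smul, mul_comm, bloch_neg_mul, one_smul]
    rfl

/-! ### Completeness of the Sobolev spaces -/

theorem continuous_fst_jet : Continuous fun w : Jet => w.fst :=
  (WithLp.prod_continuous_ofLp 2 _ _).fst

theorem continuous_snd_jet (j : Fin 2) : Continuous fun w : Jet => w.snd j :=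
  (PiLp.continuous_apply 2 _ j).comp (WithLp.prod_continuous_ofLp 2 _ _).snd

theorem continuous_pair {g : Plane → C2} (hg : Continuous g) : Continuous (pair g) := by
  have : pair g = fun f => inner ℂ (ofContinuous hg) f := funext fun f =>
    (inner_ofContinuous hg f).symm
  rw [this]
  fun_prop

theorem isClosed_H1 : IsClosed (H1 : Set Jet) := by
  have e : (H1 : Set Jet) = ⋂ (j : Fin 2) (φ : Plane → ℝ) (_ : ContDiff ℝ ∞ φ)
      (_ : HasCompactSupport φ) (_ : tsupport φ ⊆ interior cell) (x : C2),
      {w : Jet | pair (fun y => fderiv ℝ φ y (EuclideanSpace.single j 1) • x) w.fst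
        = -pair (fun y => φ y • x) (w.snd j)} := by
    ext w
    simp only [Set.mem_iInter]
    exact forall_congr' fun j => forall_congr' fun φ => forall_congr' fun h1 =>
      forall_congr' fun _ => forall_congr' fun _ => intByParts_iff h1 w
  rw [e]
  refine isClosed_iInter fun j => isClosed_iInter fun φ => isClosed_iInter fun h1 =>
    isClosed_iInter fun _ => isClosed_iInter fun _ => isClosed_iInter fun x => isClosed_eq ?_ ?_
  · exact (continuous_pair ((continuous_partial h1 j).smul continuous_const)).comp
      continuous_fst_jet
  · exact ((continuous_pair (h1.continuous.smul continuous_const)).comp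
      (continuous_snd_jet j)).neg

instance : CompleteSpace H1 := isClosed_H1.completeSpace_coe

theorem isClosed_H1theta (θ : Plane) : IsClosed (H1theta θ : Set H1) := by
  have e : (H1theta θ : Set H1) = ⋂ (j : Fin 2) (k : Fin 2 → ℤ) (s : Bool),
      {w : H1 | inner ℂ (mode (kvec k + θ) s) (w.1.snd j)
        = Complex.I * (kvec k + θ) j * inner ℂ (mode (kvec k + θ) s) w.1.fst} := by
    ext w
    simp only [Set.mem_iInter]
    exact mem_H1theta_iff θ w
  rw [e]
  refine isClosed_iInter fun j => isClosed_iInter fun k => isClosed_iInter fun s =>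
    isClosed_eq ?_ ?_
  · exact continuous_const.inner ((continuous_snd_jet j).comp continuous_subtype_val)
  · exact continuous_const.mul
      (continuous_const.inner (continuous_fst_jet.comp continuous_subtype_val))

instance (θ : Plane) : CompleteSpace (H1theta θ) := (isClosed_H1theta θ).completeSpace_coe

/-! ### The div–curl operator -/

/-- The rotation `(x₁, x₂) ↦ (x₂, -x₁)`. -/
def rot : C2 →L[ℂ] C2 := LinearMap.toContinuousLinearMap
  { toFun := fun x => !₂[x 1, -x 0]
    map_add' := fun x y => by
      ext i; fin_cases i
      · simp
      · simp; ring
    map_smul' := fun a x => by ext i; fin_cases i <;> simp }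

theorem rot_apply (x : C2) : rot x = !₂[x 1, -x 0] := rfl

theorem inner_polVec_rot (s : Bool) (x : C2) :
    inner ℂ (polVec s) (rot x) = sgnI s * inner ℂ (polVec s) x := by
  rw [inner_polVec_apply, inner_polVec_apply, rot_apply]
  cases s
  · simp [sgnI]; linear_combination (x 1) * Complex.I_mul_I
  · simp [sgnI]; linear_combination (x 1) * Complex.I_mul_I

/-- The field `(div w, curl w)`, written as `w_{,1} + J w_{,2}` with the rotation `J = rot`. -/
def divCurl (w : Jet) : L2 := w.snd 0 + rot.compLpL 2 cellMeasure (w.snd 1)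

theorem divCurl_sub (v w : Jet) : divCurl (v - w) = divCurl v - divCurl w := by
  change v.snd 0 - w.snd 0 + rot.compLpL 2 cellMeasure (v.snd 1 - w.snd 1) = _
  rw [map_sub, divCurl, divCurl]
  abel

theorem ae_divCurl (w : H1) :
    ∀ᵐ y ∂cellMeasure, divCurl w.1 y 0 = divg w y ∧ divCurl w.1 y 1 = curl w y := by
  filter_upwards [Lp.coeFn_add (w.1.snd 0) (rot.compLpL 2 cellMeasure (w.1.snd 1)),
    rot.coeFn_compLpL (p := 2) (μ := cellMeasure) (w.1.snd 1)] with y h1 h2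
  rw [divCurl, h1, Pi.add_apply, h2, rot_apply]
  simp [divg, curl, pd, sub_eq_add_neg]

theorem inner_mode_rot (κ : Plane) (s : Bool) (f : L2) :
    inner ℂ (mode κ s) (rot.compLpL 2 cellMeasure f) = sgnI s * inner ℂ (mode κ s) f := by
  rw [inner_mode_eq, inner_mode_eq, ← integral_const_mul]
  refine integral_congr_ae ?_
  filter_upwards [rot.coeFn_compLpL (p := 2) (μ := cellMeasure) f] with y hy
  rw [hy, inner_polVec_rot]
  ring

/-- The symbol of the div–curl operator on the eigenvector `(1, ± i)`. -/
def symb (κ : Plane) (s : Bool) : ℂ := Complex.I * (κ 0 + sgnI s * κ 1)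

theorem inner_mode_divCurl {θ : Plane} {w : Jet} (hw : ∀ j, IsFourierPartial θ j w)
    (k : Fin 2 → ℤ) (s : Bool) : inner ℂ (mode (kvec k + θ) s) (divCurl w)
      = symb (kvec k + θ) s * inner ℂ (mode (kvec k + θ) s) w.fst := by
  rw [divCurl, inner_add_right, inner_mode_rot, hw 0 k s, hw 1 k s, symb]
  ring

theorem normSq_symb (κ : Plane) (s : Bool) : Complex.normSq (symb κ s) = κ 0 ^ 2 + κ 1 ^ 2 := by
  cases s <;> simp [symb, sgnI, Complex.normSq_apply] <;> ring

theorem abs_le_norm_symb (κ : Plane) (s : Bool) (j : Fin 2) : |κ j| ≤ ‖symb κ s‖ := by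
  refine abs_le_of_sq_le_sq ?_ (norm_nonneg _)
  rw [← Complex.normSq_eq_norm_sq, normSq_symb]
  fin_cases j
  · exact le_add_of_nonneg_right (sq_nonneg _)
  · exact le_add_of_nonneg_left (sq_nonneg _)

theorem half_le_norm_symb {θ : Plane} (hθ : θ ∈ dualCell) {k : Fin 2 → ℤ} (hk : k ≠ 0) (s : Bool) :
    1 / 2 ≤ ‖symb (kvec k + θ) s‖ := by
  obtain ⟨j, hj⟩ := Function.ne_iff.1 hk
  refine le_trans ?_ (abs_le_norm_symb _ s j)
  have h1 : (1 : ℝ) ≤ |(k j : ℝ)| := by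
    exact_mod_cast Int.one_le_abs hj
  have h2 := hθ j
  have h3 : |θ j| ≤ 1 / 2 := abs_le.2 ⟨h2.1, h2.2.le⟩
  have h4 : (kvec k + θ) j = k j + θ j := rfl
  rw [h4]
  have := abs_sub_abs_le_abs_sub (k j : ℝ) (-θ j)
  rw [abs_neg, sub_neg_eq_add] at this
  linarith

/-- A bounded Fourier multiplier acts on the whole Hilbert space. -/
theorem exists_multiplier {ι H : Type*} [NormedAddCommGroup H] [InnerProductSpace ℂ H]
    (b : HilbertBasis ι ℂ H) (m : ι → ℂ) {C : ℝ} (hC : 0 ≤ C) (hm : ∀ i, ‖m i‖ ≤ C) (h : H) :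
    ∃ z : H, (∀ i, inner ℂ (b i) z = m i * inner ℂ (b i) h) ∧ ‖z‖ ≤ C * ‖h‖ := by
  have h2 : 0 < (2 : ENNReal).toReal := by norm_num
  have hb : ∀ i, ‖m i * b.repr h i‖ ^ (2 : ENNReal).toReal
      ≤ C ^ (2 : ENNReal).toReal * ‖b.repr h i‖ ^ (2 : ENNReal).toReal := fun i => by
    rw [← Real.mul_rpow hC (norm_nonneg _), norm_mul]
    gcongr
    exact hm i
  have hs := (((lp.memℓp (b.repr h)).summable h2).mul_left (C ^ (2 : ENNReal).toReal))
  have hmem : Memℓp (fun i => m i * b.repr h i) 2 := by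
    refine memℓp_gen (Summable.of_nonneg_of_le (fun i => by positivity) hb hs)
  let y : lp (fun _ : ι => ℂ) 2 := ⟨_, hmem⟩
  refine ⟨b.repr.symm y, fun i => ?_, ?_⟩
  · rw [← b.repr_apply_apply, LinearIsometryEquiv.apply_symm_apply, ← b.repr_apply_apply]
  · rw [LinearIsometryEquiv.norm_map]
    refine lp.norm_le_of_tsum_le h2 (by positivity) ?_
    rw [← b.repr.norm_map h, Real.mul_rpow hC (norm_nonneg _), lp.norm_rpow_eq_tsum h2,
      ← tsum_mul_left]
    exact Summable.tsum_le_tsum hb (hmem.summable h2) hs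

/-- The div–curl system with quasi-momentum `θ` is solvable, uniformly in `θ`, when the right-hand
side is orthogonal to the modes with `k = 0`; for the other modes the symbol is at least `1/2`. -/
theorem exists_divCurl_eq {θ : Plane} (hθ : θ ∈ dualCell) {h : L2}
    (h0 : ∀ s, inner ℂ (mode θ s) h = 0) :
    ∃ w ∈ H1theta θ, divCurl w.1 = h ∧ ‖w‖ ^ 2 ≤ 6 * ‖h‖ ^ 2 := by
  have hcancel : ∀ {m : (Fin 2 → ℤ) × Bool → ℂ} {z : L2},
      (∀ i, inner ℂ (fourierBasis θ i) z = m i * inner ℂ (fourierBasis θ i) h) →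
      ∀ k s, inner ℂ (mode (kvec k + θ) s) z = m (k, s) * inner ℂ (mode (kvec k + θ) s) h := by
    intro m z hz k s
    have := hz (k, s)
    rw [fourierBasis_apply, inner_nmode, inner_nmode, mul_left_comm] at this
    exact mul_left_cancel₀ (Complex.ofReal_ne_zero.2 modeScale_pos.ne') this
  -- the field and its derivatives have the multipliers `1 / symb` and `i κ_j / symb`; the modes
  -- with `k = 0` are dropped
  obtain ⟨z, hz, hzn⟩ := exists_multiplier (fourierBasis θ)
    (fun i => if i.1 = 0 then 0 else (symb (kvec i.1 + θ) i.2)⁻¹) zero_le_two (fun i => by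
      split_ifs with hi
      · simp
      · rw [norm_inv]
        have := half_le_norm_symb hθ hi i.2
        rw [inv_le_comm₀ (by linarith) two_pos]
        linarith) h
  have hg := fun j : Fin 2 => exists_multiplier (fourierBasis θ)
    (fun i => if i.1 = 0 then 0
      else Complex.I * (kvec i.1 + θ) j * (symb (kvec i.1 + θ) i.2)⁻¹) zero_le_one (fun i => by
      split_ifs with hi
      · simp
      · have h1 := half_le_norm_symb hθ hi i.2
        have h2 := abs_le_norm_symb (kvec i.1 + θ) i.2 j
        rw [norm_mul, norm_mul, Complex.norm_I, one_mul, norm_inv, Complex.norm_real,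
          Real.norm_eq_abs, ← div_eq_mul_inv, div_le_one (by linarith)]
        exact h2) h
  choose g hg hgn using hg
  set w : Jet := WithLp.toLp 2 (z, WithLp.toLp 2 g) with hw
  have hF : ∀ j, IsFourierPartial θ j w := by
    intro j k s
    change inner ℂ _ (g j) = _ * inner ℂ _ z
    rw [hcancel (hg j), hcancel hz]
    split_ifs
    · ring
    · ring
  refine ⟨⟨w, mem_H1_of_isFourierPartial hF⟩, (mem_H1theta_iff θ _).2 hF, ?_, ?_⟩
  · rw [← sub_eq_zero]
    refine eq_zero_of_inner_mode (θ := θ) fun k s => ?_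
    rw [inner_sub_right, inner_mode_divCurl hF]
    change _ * inner ℂ _ z - _ = 0
    rw [hcancel hz]
    by_cases hk : k = 0
    · have hk0 : kvec 0 + θ = θ := by ext i; simp [kvec]
      rw [hk, hk0, h0 s]
      ring
    · have hs : symb (kvec k + θ) s ≠ 0 := by
        have := half_le_norm_symb hθ hk s
        exact norm_pos_iff.1 (by linarith)
      simp only [hk, if_false]
      rw [mul_inv_cancel_left₀ hs, sub_self]
  · change ‖w‖ ^ 2 ≤ _
    have e : ‖w‖ ^ 2 = ‖z‖ ^ 2 + (‖g 0‖ ^ 2 + ‖g 1‖ ^ 2) := norm_sq_jet w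
    have e0 := pow_le_pow_left₀ (norm_nonneg _) hzn 2
    have e1 := pow_le_pow_left₀ (norm_nonneg _) (hgn 0) 2
    have e2 := pow_le_pow_left₀ (norm_nonneg _) (hgn 1) 2
    rw [e]
    nlinarith

/-! ### The spectral gap -/

/-- The restriction of a field to a set, extended by zero. -/
def cut {S : Set Plane} (hS : MeasurableSet S) (f : L2) : L2 := ((Lp.memLp f).indicator hS).toLp _

theorem coeFn_cut {S : Set Plane} (hS : MeasurableSet S) (f : L2) :
    cut hS f =ᵐ[cellMeasure] S.indicator f := MemLp.coeFn_toLp _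

theorem norm_cut_le {S : Set Plane} (hS : MeasurableSet S) (f : L2) : ‖cut hS f‖ ≤ ‖f‖ := by
  refine Lp.norm_le_norm_of_ae_le ?_
  filter_upwards [coeFn_cut hS f] with y hy
  rw [hy]
  exact norm_indicator_le_norm_self _ _

theorem norm_sq_cut_divCurl {R : Set Plane} (hR : MeasurableSet R) (u : H1) :
    ‖cut hR.compl (divCurl u.1)‖ ^ 2 = (aForm R u u).re := by
  have e : (aForm R u u).re = _ := re_setIntegral Rᶜ (integrable_divCurl u u)
  rw [norm_sq_L2, e, ← integral_indicator hR.compl]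
  refine integral_congr_ae ?_
  filter_upwards [coeFn_cut hR.compl (divCurl u.1), ae_divCurl u] with y h1 h2
  rw [h1]
  by_cases hy : y ∈ Rᶜ
  · rw [Set.indicator_of_mem hy, Set.indicator_of_mem hy, norm_sq_C2, h2.1, h2.2,
      Complex.mul_conj, Complex.mul_conj, ← Complex.ofReal_add, Complex.ofReal_re,
      Complex.normSq_eq_norm_sq, Complex.normSq_eq_norm_sq]
  · rw [Set.indicator_of_notMem hy, Set.indicator_of_notMem hy]
    simp

theorem inner_mode_cut_mode {R : Set Plane} (hR : MeasurableSet R) (θ : Plane) (s t : Bool) :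
    inner ℂ (mode θ s) (cut hR (mode θ t))
      = if s = t then ((2 * cellMeasure.real R : ℝ) : ℂ) else 0 := by
  have e : inner ℂ (mode θ s) (cut hR (mode θ t))
      = ∫ y, R.indicator (fun _ => inner ℂ (polVec s) (polVec t)) y ∂cellMeasure := by
    rw [inner_mode_eq]
    refine integral_congr_ae ?_
    filter_upwards [coeFn_cut hR (mode θ t), coeFn_ofContinuous (continuous_modeFun θ t)]
      with y h1 h2
    rw [h1]
    by_cases hy : y ∈ R
    · rw [Set.indicator_of_mem hy, Set.indicator_of_mem hy, mode, h2, inner_smul_right,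
        ← mul_assoc, bloch_neg_mul, one_mul]
    · rw [Set.indicator_of_notMem hy, Set.indicator_of_notMem hy, inner_zero_right, mul_zero]
  rw [e, integral_indicator_const _ hR, inner_polVec]
  split_ifs
  · rw [Complex.real_smul]; push_cast; ring
  · simp

theorem norm_sq_mode (θ : Plane) (s : Bool) : ‖mode θ s‖ ^ 2 = 2 * cellVol := by
  rw [← inner_self_eq_norm_sq (𝕜 := ℂ), inner_mode_mode, inner_polVec, if_pos rfl, sub_self]
  simp [bloch_zero, cellVol, mul_comm]

/-- The constant of the gap inequality. -/
def gapConst (R : Set Plane) : ℝ := 6 * (1 + 2 * cellVol / cellMeasure.real R) ^ 2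

theorem gapConst_nonneg (R : Set Plane) : 0 ≤ gapConst R := by unfold gapConst; positivity

/-- The gap inequality: the distance of `u` to the kernel `V(θ)` of the form `a` is controlled by
`a(u, u)`, uniformly in `θ`. The values of `(div u, curl u)` inside `R` are free, and they are
chosen such that the modes with `k = 0`, for which the symbol of the div–curl operator degenerates
as `θ → 0`, are absent. -/
theorem exists_mem_V_norm_sub_le {R : Set Plane} (hR : MeasurableSet R)
    (hpos : 0 < cellMeasure.real R) {θ : Plane} (hθ : θ ∈ dualCell) {u : H1} (hu : u ∈ H1theta θ) :
    ∃ w ∈ V R θ, ‖u - w‖ ^ 2 ≤ gapConst R * (aForm R u u).re := by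
  set h₀ := cut hR.compl (divCurl u.1) with hh0
  set ρ := cellMeasure.real R
  -- the coefficients for which the correction inside `R` cancels the modes with `k = 0` of `h₀`
  let α : Bool → ℂ := fun s => inner ℂ (mode θ s) h₀ / ((2 * ρ : ℝ) : ℂ)
  set h : L2 := h₀ - ∑ s, α s • cut hR (mode θ s) with hh
  have hρ : ((2 * ρ : ℝ) : ℂ) ≠ 0 := Complex.ofReal_ne_zero.2 (by positivity)
  have h0 : ∀ s, inner ℂ (mode θ s) h = 0 := by
    intro s
    rw [hh, inner_sub_right, inner_sum, Finset.sum_eq_single s]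
    · rw [inner_smul_right, inner_mode_cut_mode, if_pos rfl, div_mul_cancel₀ _ hρ, sub_self]
    · intro t _ ht
      rw [inner_smul_right, inner_mode_cut_mode, if_neg (Ne.symm ht), mul_zero]
    · simp
  have hterm : ∀ s, ‖α s • cut hR (mode θ s)‖ ≤ cellVol / ρ * ‖h₀‖ := by
    intro s
    have h1 : ‖α s‖ ≤ ‖mode θ s‖ * ‖h₀‖ / (2 * ρ) := by
      rw [norm_div, Complex.norm_real, Real.norm_of_nonneg (by positivity)]
      gcongr
      exact norm_inner_le_norm _ _
    rw [norm_smul]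
    calc ‖α s‖ * ‖cut hR (mode θ s)‖ ≤ ‖mode θ s‖ * ‖h₀‖ / (2 * ρ) * ‖mode θ s‖ := by
          gcongr; exact norm_cut_le hR _
      _ = ‖mode θ s‖ ^ 2 / (2 * ρ) * ‖h₀‖ := by ring
      _ = cellVol / ρ * ‖h₀‖ := by rw [norm_sq_mode]; field_simp
  have hn : ‖h‖ ≤ (1 + 2 * cellVol / ρ) * ‖h₀‖ := by
    calc ‖h‖ ≤ ‖h₀‖ + ‖∑ s, α s • cut hR (mode θ s)‖ := norm_sub_le _ _
      _ ≤ ‖h₀‖ + ∑ _s : Bool, cellVol / ρ * ‖h₀‖ := by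
          gcongr; exact norm_sum_le_of_le _ fun s _ => hterm s
      _ = (1 + 2 * cellVol / ρ) * ‖h₀‖ := by
          simp only [Finset.sum_const, Finset.card_univ, Fintype.card_bool, nsmul_eq_mul]
          push_cast; ring
  obtain ⟨z, hz, hzh, hzn⟩ := exists_divCurl_eq hθ h0
  refine ⟨u - z, ⟨(H1theta θ).sub_mem hu hz, ?_⟩, ?_⟩
  · rw [ae_restrict_iff' hR.compl]
    have e1 : divCurl (u - z).1 = divCurl u.1 - h := by rw [← hzh]; exact divCurl_sub _ _
    have e2 : h = h₀ - (α true • cut hR (mode θ true) + α false • cut hR (mode θ false)) := by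
      rw [hh, Fintype.sum_bool]
    filter_upwards [ae_divCurl (u - z), Lp.coeFn_sub (divCurl u.1) h,
      Lp.coeFn_sub h₀ (α true • cut hR (mode θ true) + α false • cut hR (mode θ false)),
      Lp.coeFn_add (α true • cut hR (mode θ true)) (α false • cut hR (mode θ false)),
      Lp.coeFn_smul (α true) (cut hR (mode θ true)),
      Lp.coeFn_smul (α false) (cut hR (mode θ false)),
      coeFn_cut hR (mode θ true), coeFn_cut hR (mode θ false),
      coeFn_cut hR.compl (divCurl u.1)] with y a1 a2 a3 a4 a5 a6 a7 a8 a9 hy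
    have hy' : y ∉ R := hy
    have hzero : divCurl (u - z).1 y = 0 := by
      rw [e1, a2, Pi.sub_apply, e2, a3, Pi.sub_apply, a4, Pi.add_apply, a5, a6, Pi.smul_apply,
        Pi.smul_apply, a7, a8, a9, Set.indicator_of_notMem hy', Set.indicator_of_notMem hy',
        Set.indicator_of_mem hy]
      simp
    rw [← a1.1, ← a1.2, hzero]
    exact ⟨rfl, rfl⟩
  · rw [sub_sub_cancel, ← norm_sq_cut_divCurl hR]
    calc ‖z‖ ^ 2 ≤ 6 * ‖h‖ ^ 2 := hzn
      _ ≤ 6 * ((1 + 2 * cellVol / ρ) * ‖h₀‖) ^ 2 := by gcongr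
      _ = gapConst R * ‖h₀‖ ^ 2 := by unfold gapConst; ring

/-- `V(θ)` is closed, being the kernel of `a` on `H¹_θ`. -/
theorem isClosed_V {R : Set Plane} (hR : MeasurableSet R)
    (hpos : 0 < cellMeasure.real R) {θ : Plane} (hθ : θ ∈ dualCell) :
    IsClosed (V R θ : Set H1) := by
  refine isClosed_of_closure_subset fun u hu => ?_
  have huθ : u ∈ H1theta θ :=
    closure_minimal (fun v hv => hv.1 : (V R θ : Set H1) ⊆ H1theta θ) (isClosed_H1theta θ) hu
  -- `a(u, u) = a(u - v, u)` for all `v` in `V(θ)`, so that `a(u, u)` vanishes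
  have ha : (aForm R u u).re ≤ 0 := by
    refine le_of_forall_pos_le_add fun δ hδ => ?_
    obtain ⟨v, hv, hd⟩ := Metric.mem_closure_iff.1 hu (δ / (2 * ‖u‖ + 1)) (by positivity)
    rw [dist_eq_norm] at hd
    have e : aForm R u u = aForm R (u - v) u := by
      rw [map_sub, Pi.sub_apply, aForm_eq_zero hv, sub_zero]
    calc (aForm R u u).re ≤ ‖aForm R (u - v) u‖ := by rw [e]; exact Complex.re_le_norm _
      _ ≤ 2 * ‖u - v‖ * ‖u‖ := (isHermitianForm_aForm R).bound _ _
      _ ≤ 2 * (δ / (2 * ‖u‖ + 1)) * ‖u‖ := by gcongr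
      _ = δ * (2 * ‖u‖ / (2 * ‖u‖ + 1)) := by ring
      _ ≤ δ * 1 := by
          gcongr
          rw [div_le_one (by positivity)]; linarith
      _ = 0 + δ := by ring
  obtain ⟨w, hw, hle⟩ := exists_mem_V_norm_sub_le hR hpos hθ huθ
  have h1 : ‖u - w‖ ^ 2 ≤ 0 := hle.trans (mul_nonpos_of_nonneg_of_nonpos (gapConst_nonneg R) ha)
  have h2 : ‖u - w‖ = 0 := by nlinarith [norm_nonneg (u - w)]
  rw [sub_eq_zero.1 (norm_eq_zero.1 h2)]
  exact hw

/-! ### Solution operators -/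

/-- The functionals `φ ↦ q(f, t φ)` attached to a bounded Hermitian form `q`. -/
def IsHermitianForm.dual {E E' : Type*} [NormedAddCommGroup E] [InnerProductSpace ℂ E]
    [NormedAddCommGroup E'] [InnerProductSpace ℂ E'] {q : E' →ₗ[ℂ] (E' → ℂ)} {M : ℝ}
    (hq : IsHermitianForm q M) (t : E →L[ℂ] E') : E' →L[ℂ] (E →L⋆[ℂ] ℂ) :=
  LinearMap.mkContinuous₂ (LinearMap.mk₂'ₛₗ (RingHom.id ℂ) (starRingEnd ℂ)
    (fun f φ => q f (t φ)) (fun f f' φ => by simp) (fun a f φ => by simp)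
    (fun f φ φ' => by rw [map_add, hq.map_add_right])
    (fun a f φ => by rw [map_smul, hq.map_smul_right, smul_eq_mul])) (|M| * ‖t‖) fun f φ => by
      calc ‖q f (t φ)‖ ≤ M * ‖f‖ * ‖t φ‖ := hq.bound _ _
        _ ≤ |M| * ‖f‖ * (‖t‖ * ‖φ‖) := by
            gcongr
            · exact le_abs_self M
            · exact t.le_opNorm φ
        _ = |M| * ‖t‖ * ‖f‖ * ‖φ‖ := by ring

/-- The solutions of a coercive problem depend linearly and continuously on the data. -/
theorem exists_solutionOperator {E X : Type*} [NormedAddCommGroup E] [InnerProductSpace ℂ E]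
    [NormedAddCommGroup X] [NormedSpace ℂ X] {q : E →ₗ[ℂ] (E → ℂ)} {M ν : ℝ}
    (hq : IsHermitianForm q M) {D : Submodule ℂ E} [CompleteSpace D] (hν : 0 < ν)
    (hco : ∀ u ∈ D, ν * ‖u‖ ^ 2 ≤ (q u u).re) (Φ : X →L[ℂ] (E →L⋆[ℂ] ℂ)) :
    ∃ S : X →L[ℂ] E, ∀ f, S f ∈ D ∧ ∀ φ ∈ D, q (S f) φ = Φ f φ := by
  have hex := fun f => hq.exists_solution hν hco (Φ f)
  choose s hsD hs using hex
  refine ⟨LinearMap.mkContinuous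
    { toFun := s
      map_add' := fun f g => solution_unique hν hco (hsD _) (D.add_mem (hsD f) (hsD g)) (hs _)
        fun φ hφ => by simp [hs f φ hφ, hs g φ hφ]
      map_smul' := fun a f => solution_unique hν hco (hsD _) (D.smul_mem a (hsD f)) (hs _)
        fun φ hφ => by simp [hs f φ hφ] } (‖Φ‖ / ν) fun f => ?_, fun f => ⟨hsD f, hs f⟩⟩
  calc ‖s f‖ ≤ ‖Φ f‖ / ν := norm_le_of_solution hν hco (hsD f) (hs f)
    _ ≤ ‖Φ‖ * ‖f‖ / ν := by gcongr; exact Φ.le_opNorm f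
    _ = ‖Φ‖ / ν * ‖f‖ := by ring

/-! ### Resolvents of operators generated by forms -/

/-- The resolvent at `-1` of the operator generated by the form `q` consists of the solutions of
`q(w, ψ) + c(w, ψ) = c(f, ψ)`. -/
theorem isResolvent_formGraph {K : Type*} [NormedAddCommGroup K] [NormedSpace ℂ K]
    {ι : K →ₗ[ℂ] L2} (hι : Function.Injective ι) {D : Submodule ℂ H1} {q : H1 →ₗ[ℂ] (H1 → ℂ)}
    {c : L2 →ₗ[ℂ] (L2 → ℂ)}
    (hdense : ∀ f : K, (∀ ψ ∈ D, c (ι f) (toL2 ψ) = 0) → f = 0)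
    (huniq : ∀ w ∈ D, (∀ ψ ∈ D, q w ψ + c (toL2 w) (toL2 ψ) = 0) → w = 0)
    {S : K →L[ℂ] K} (hS : ∀ f, ∃ w ∈ D, toL2 w = ι (S f) ∧
      ∀ ψ ∈ D, q w ψ + c (toL2 w) (toL2 ψ) = c (ι f) (toL2 ψ)) :
    IsResolvent (formGraph ι D q c).toLinearPMap S := by
  have hg : ∀ x ∈ formGraph ι D q c, x.1 = 0 → x.2 = 0 := by
    rintro x ⟨w, hw, h1, h2⟩ hx
    rw [hx, map_zero] at h1
    have hw0 : w = 0 := toL2_injective (h1.trans (map_zero toL2).symm)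
    refine hdense _ fun ψ hψ => ?_
    rw [← h2 ψ hψ, hw0, map_zero, Pi.zero_apply]
  have hgraph : ∀ f, (S f, f - S f) ∈ formGraph ι D q c := fun f => by
    obtain ⟨w, hw, h1, h2⟩ := hS f
    refine ⟨w, hw, h1, fun ψ hψ => ?_⟩
    rw [map_sub, map_sub, Pi.sub_apply, ← h1, ← h2 ψ hψ, add_sub_cancel_right]
  refine ⟨fun f => ?_, fun u => ?_⟩
  · have hdom : S f ∈ (formGraph ι D q c).toLinearPMap.domain := by
      rw [Submodule.toLinearPMap_domain]
      exact ⟨_, hgraph f, rfl⟩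
    refine ⟨hdom, ?_⟩
    have h1 := Submodule.mem_graph_toLinearPMap hg ⟨S f, hdom⟩
    have h2 := hg _ (Submodule.sub_mem _ h1 (hgraph f)) (sub_self _)
    have h3 := sub_eq_zero.1 h2
    change (formGraph ι D q c).toLinearPMap ⟨S f, hdom⟩ = f - S f at h3
    rw [h3, sub_add_cancel]
  · obtain ⟨w, hw, h1, h2⟩ := Submodule.mem_graph_toLinearPMap hg u
    obtain ⟨w', hw', h1', h2'⟩ := hS ((formGraph ι D q c).toLinearPMap u + u)
    have e : w' - w = 0 := huniq _ (D.sub_mem hw' hw) fun ψ hψ => by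
      have h3 := h2 ψ hψ
      have h4 := h2' ψ hψ
      simp only [map_sub, Pi.sub_apply, map_add, Pi.add_apply] at h4 ⊢
      rw [h1]
      simp only at h3
      linear_combination h4 - h3
    apply hι
    rw [← h1', sub_eq_zero.1 e]
    exact h1

/-- The inclusion of `H¹` into `L²`, as a bounded operator. -/
def toL2L : H1 →L[ℂ] L2 := toL2.mkContinuous 1 fun w => by rw [one_mul]; exact norm_toL2_le w

/-- The functionals `φ ↦ c(f, φ)` on `H¹`. -/
def cDual {ε₀ : ℝ} (hε₀ : 1 < ε₀) (R : Set Plane) : L2 →L[ℂ] Hneg1 :=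
  IsHermitianForm.dual (E := H1) (E' := L2) (isHermitianForm_cForm hε₀ R) toL2L

theorem norm_cDual_le {ε₀ : ℝ} (hε₀ : 1 < ε₀) (R : Set Plane) (f : L2) :
    ‖cDual hε₀ R f‖ ≤ ε₀ * ‖f‖ := by
  have h0 : 0 ≤ ε₀ := by linarith
  refine ContinuousLinearMap.opNorm_le_bound _ (by positivity) fun φ => ?_
  calc ‖cForm ε₀ R f (toL2 φ)‖ ≤ ε₀ * ‖f‖ * ‖toL2 φ‖ := (isHermitianForm_cForm hε₀ R).bound _ _
    _ ≤ ε₀ * ‖f‖ * ‖φ‖ := by gcongr; exact norm_toL2_le φ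

/-- An element of the closure of the form domain is determined by its `c`-products with the form
domain. -/
theorem eq_zero_of_cForm_eq_zero {ε₀ : ℝ} (hε₀ : 1 < ε₀) (R : Set Plane) {D : Submodule ℂ L2}
    {f : L2} (hf : f ∈ D.topologicalClosure) (h : ∀ ψ ∈ D, cForm ε₀ R f ψ = 0) : f = 0 := by
  have hc := isHermitianForm_cForm hε₀ R
  set l := hc.dual (ContinuousLinearMap.id ℂ L2) f
  have hcl : IsClosed {ψ : L2 | l ψ = 0} := isClosed_eq l.continuous continuous_const
  have h1 : l f = 0 := closure_minimal (fun ψ hψ => h ψ hψ) hcl hf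
  have h2 := cForm_coercive hε₀ R f
  have h3 : cForm ε₀ R f f = 0 := h1
  rw [h3, Complex.zero_re] at h2
  have h4 : ‖f‖ = 0 := by nlinarith [norm_nonneg f]
  exact norm_eq_zero.1 h4

theorem isFourierPartial_mode (θ : Plane) (k : Fin 2 → ℤ) (s : Bool) (j : Fin 2) :
    IsFourierPartial θ j (WithLp.toLp 2 (nmode θ (k, s), WithLp.toLp 2 fun j =>
      (Complex.I * (kvec k + θ) j) • nmode θ (k, s))) := by
  intro l t
  change inner ℂ _ ((Complex.I * (kvec k + θ) j) • nmode θ (k, s)) = _ * inner ℂ _ (nmode θ (k, s))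
  rw [inner_smul_right]
  by_cases hkl : k = l
  · rw [hkl]
  · have h := (orthonormal_nmode θ).2 (i := (l, t)) (j := (k, s))
      (fun h => hkl (congrArg Prod.fst h).symm)
    have h := (inner_nmode θ (l, t) _).symm.trans h
    rw [mul_eq_zero] at h
    rw [h.resolve_left (Complex.ofReal_ne_zero.2 modeScale_pos.ne')]
    ring

/-- `H¹_θ` is dense in `L²`, as it contains the Fourier modes. -/
theorem H1theta_dense (θ : Plane) : ((H1theta θ).map toL2).topologicalClosure = ⊤ := by
  rw [eq_top_iff, ← (fourierBasis θ).dense_span]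
  refine Submodule.topologicalClosure_mono (Submodule.span_le.2 ?_)
  rintro _ ⟨⟨k, s⟩, rfl⟩
  rw [fourierBasis_apply]
  have h := isFourierPartial_mode θ k s
  exact ⟨⟨_, mem_H1_of_isFourierPartial h⟩, (mem_H1theta_iff θ _).2 h, rfl⟩

theorem measureReal_pos {R : Set Plane} (hR : IsOpen R) (hne : R.Nonempty)
    (hRcell : closure R ⊆ cell) : 0 < cellMeasure.real R := by
  refine ENNReal.toReal_pos ?_ (measure_ne_top _ _)
  rw [cellMeasure, Measure.restrict_apply hR.measurableSet,
    Set.inter_eq_left.2 (subset_closure.trans hRcell)]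
  exact (hR.measure_pos _ hne).ne'

theorem V_le_H1theta (R : Set Plane) (θ : Plane) : V R θ ≤ H1theta θ := fun _ hv => hv.1

/-- The limit form is coercive on the constrained space. -/
theorem b_coercive {ε₀ : ℝ} (hε₀ : 1 < ε₀) {R : Set Plane} (hR : MeasurableSet R) (θ : Plane) :
    ∀ u ∈ V R θ, coerConst ε₀ * ‖u‖ ^ 2 ≤ (bcForm ε₀ R u u).re := by
  refine @coercive_limit H1 _ _ (H1theta θ) (V R θ) (V_le_H1theta R θ) (aForm R) (bcForm ε₀ R)
    (fun ε => bcEpsForm ε₀ R ε) (boundConst ε₀) (coerConst ε₀)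
    (fun _ hv φ => aForm_eq_zero hv φ) ?_ ?_
  · intro ε h0 h1 u v
    exact norm_bEps_sub_b_le hε₀ h0 h1 R u v
  · intro ε h0 h1 u _
    exact epsForm_coercive hε₀ h0 h1 hR u

theorem epsForm_add_cForm (ε₀ : ℝ) (R : Set Plane) (ε : ℝ) (u φ : H1) :
    epsForm ε₀ R ε u φ + cForm ε₀ R (toL2 u) (toL2 φ)
      = (((ε⁻¹ : ℝ) : ℂ) • aForm R + bcEpsForm ε₀ R ε) u φ := by
  rw [bcEpsForm, ← add_assoc]; rfl

theorem isHermitianForm_eps {ε₀ ε : ℝ} (hε₀ : 1 < ε₀) (h0 : 0 < ε) (h1 : ε < 1)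
    (R : Set Plane) : IsHermitianForm (E := H1)
      (((ε⁻¹ : ℝ) : ℂ) • aForm R + bcEpsForm ε₀ R ε)
      (|ε⁻¹| * 2 + boundConst ε₀) :=
  ((isHermitianForm_aForm R).smul ε⁻¹).add (isHermitianForm_bEps hε₀ h0 h1 R)

/-- The error estimate in `H¹`, with an explicit constant. -/
theorem norm_solution_sub_le {ε₀ ε : ℝ} (hε₀ : 1 < ε₀) (h0 : 0 < ε) (h1 : ε < 1)
    {R : Set Plane} (hR : MeasurableSet R) (hpos : 0 < cellMeasure.real R) {θ : Plane}
    (hθ : θ ∈ dualCell) {F : Hneg1} {U W : H1} (hU : SolvesEps ε₀ R ε θ F U)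
    (hW : SolvesLimit ε₀ R θ F W) :
    ‖U - W‖ ≤ errorConst (gapConst R) (boundConst ε₀) (coerConst ε₀) * ε * ‖F‖ := by
  have h := @norm_sub_le_of_gap H1 _ _ (H1theta θ) (V R θ) (V_le_H1theta R θ) (aForm R)
    (bcForm ε₀ R) (bcEpsForm ε₀ R ε) (gapConst R) (boundConst ε₀) 2 (coerConst ε₀) ε
    (gapConst_nonneg R) (boundConst_nonneg hε₀) (coerConst_pos hε₀) h0 h1
    (by exact isHermitianForm_aForm R) (by intro v hv φ; exact aForm_eq_zero hv φ)
    (by intro u hu; exact exists_mem_V_norm_sub_le hR hpos hθ hu)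
    (by exact isHermitianForm_bEps hε₀ h0 h1 R)
    (by intro u v; exact norm_bEps_sub_b_le hε₀ h0 h1 R u v)
    (by intro u _; exact epsForm_coercive hε₀ h0 h1 hR u)
    (by exact b_coercive hε₀ hR θ) F U W hU.1
    (by intro φ hφ; exact (epsForm_add_cForm ε₀ R ε U φ).symm.trans (hU.2 φ hφ)) hW.1
    (by intro φ hφ; exact hW.2 φ hφ)
  exact h

theorem existsUnique_solvesEps {ε₀ ε : ℝ} (hε₀ : 1 < ε₀) (h0 : 0 < ε) (h1 : ε < 1)
    {R : Set Plane} (hR : MeasurableSet R) (θ : Plane) (F : Hneg1) :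
    ∃! U : H1, SolvesEps ε₀ R ε θ F U := by
  have hco := fun u (_ : u ∈ H1theta θ) => epsForm_coercive hε₀ h0 h1 hR u
  obtain ⟨U, hU, hs⟩ := (isHermitianForm_eps hε₀ h0 h1 R).exists_solution
    (D := H1theta θ) (coerConst_pos hε₀) hco F
  refine ⟨U, ⟨hU, fun φ hφ => (epsForm_add_cForm ε₀ R ε U φ).trans (hs φ hφ)⟩, fun U' hU' => ?_⟩
  exact solution_unique (E := H1) (coerConst_pos hε₀) hco hU'.1 hU
    (fun φ hφ => (epsForm_add_cForm ε₀ R ε U' φ).symm.trans (hU'.2 φ hφ)) hs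

theorem existsUnique_solvesLimit {ε₀ : ℝ} (hε₀ : 1 < ε₀) {R : Set Plane} (hR : MeasurableSet R)
    (hpos : 0 < cellMeasure.real R) {θ : Plane} (hθ : θ ∈ dualCell) (F : Hneg1) :
    ∃! W : H1, SolvesLimit ε₀ R θ F W := by
  have : CompleteSpace (V R θ) := (isClosed_V hR hpos hθ).completeSpace_coe
  have hco := b_coercive hε₀ hR θ
  obtain ⟨M, hM⟩ := isHermitianForm_b hε₀ R
  obtain ⟨W, hW, hs⟩ := hM.exists_solution (D := V R θ) (coerConst_pos hε₀) hco F
  exact ⟨W, ⟨hW, hs⟩, fun W' hW' => solution_unique (E := H1) (coerConst_pos hε₀) hco hW'.1 hW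
    hW'.2 hs⟩

/-- The resolvent of `ℬ_ε(θ)` is given by the solutions of the perturbed problem. -/
theorem exists_resolvent_Beps {ε₀ ε : ℝ} (hε₀ : 1 < ε₀) (h0 : 0 < ε) (h1 : ε < 1)
    {R : Set Plane} (hR : MeasurableSet R) (θ : Plane) :
    ∃ T : L2 →L[ℂ] H1, IsResolvent (Beps ε₀ R ε θ) (toL2L ∘L T) ∧
      ∀ f, SolvesEps ε₀ R ε θ (cDual hε₀ R f) (T f) := by
  have hco := fun u (_ : u ∈ H1theta θ) => epsForm_coercive hε₀ h0 h1 hR u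
  obtain ⟨T, hT⟩ := exists_solutionOperator (isHermitianForm_eps hε₀ h0 h1 R) (D := H1theta θ)
    (coerConst_pos hε₀) hco (cDual hε₀ R)
  have hsol : ∀ f, SolvesEps ε₀ R ε θ (cDual hε₀ R f) (T f) :=
    fun f => ⟨(hT f).1, fun φ hφ => (epsForm_add_cForm ε₀ R ε _ φ).trans ((hT f).2 φ hφ)⟩
  refine ⟨T, isResolvent_formGraph (fun _ _ h => h) (fun f hf => ?_) (fun w hw hs => ?_)
    fun f => ⟨T f, (hsol f).1, rfl, (hsol f).2⟩, hsol⟩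
  · refine eq_zero_of_cForm_eq_zero hε₀ R (D := (H1theta θ).map toL2)
      (H1theta_dense θ ▸ Submodule.mem_top) ?_
    rintro _ ⟨ψ, hψ, rfl⟩
    exact hf ψ hψ
  · exact solution_unique (E := H1) (F := 0) (coerConst_pos hε₀) hco hw (H1theta θ).zero_mem
      (fun φ hφ => (epsForm_add_cForm ε₀ R ε w φ).symm.trans (hs φ hφ)) (fun φ _ => by simp)

/-- The resolvent of `ℬ(θ)` is given by the solutions of the limit problem. -/
theorem exists_resolvent_B {ε₀ : ℝ} (hε₀ : 1 < ε₀) {R : Set Plane} (hR : MeasurableSet R)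
    (hpos : 0 < cellMeasure.real R) {θ : Plane} (hθ : θ ∈ dualCell) :
    ∃ (T : L2 →L[ℂ] H1) (S : Hspace R θ →L[ℂ] Hspace R θ), IsResolvent (B ε₀ R θ) S ∧
      (∀ f, (S f : L2) = toL2 (T f)) ∧
      ∀ f, SolvesLimit ε₀ R θ (cDual hε₀ R f) (T f) := by
  have : CompleteSpace (V R θ) := (isClosed_V hR hpos hθ).completeSpace_coe
  have hco := b_coercive hε₀ hR θ
  obtain ⟨M, hM⟩ := isHermitianForm_b hε₀ R
  obtain ⟨T, hT⟩ := exists_solutionOperator hM (D := V R θ)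
    (coerConst_pos hε₀) hco (cDual hε₀ R)
  have hmem : ∀ f, toL2L (T f) ∈ Hspace R θ := fun f =>
    Submodule.le_topologicalClosure _ ⟨T f, (hT f).1, rfl⟩
  refine ⟨T, (toL2L ∘L T ∘L (Hspace R θ).subtypeL).codRestrict (Hspace R θ) fun f => hmem f,
    isResolvent_formGraph (Hspace R θ).subtype_injective (fun f hf => ?_) (fun w hw hs => ?_)
    fun f => ⟨T f, (hT f).1, rfl, (hT f).2⟩, fun f => rfl, hT⟩
  · refine Subtype.ext (eq_zero_of_cForm_eq_zero hε₀ R (D := (V R θ).map toL2) f.2 ?_)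
    rintro _ ⟨ψ, hψ, rfl⟩
    exact hf ψ hψ
  · exact solution_unique (E := H1) (F := 0) (coerConst_pos hε₀) hco hw (V R θ).zero_mem
      hs (fun φ _ => by simp)

theorem exists_orthogonalProjection {ε₀ : ℝ} (hε₀ : 1 < ε₀) (R : Set Plane) (θ : Plane) :
    ∃ P : L2 →L[ℂ] Hspace R θ, IsOrthogonalProjection (cForm ε₀ R) (Hspace R θ) P := by
  have hc := isHermitianForm_cForm hε₀ R
  have : CompleteSpace (Hspace R θ) :=
    (Submodule.isClosed_topologicalClosure _).completeSpace_coe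
  obtain ⟨P, hP⟩ := exists_solutionOperator hc (D := Hspace R θ) one_pos
    (fun u _ => cForm_coercive hε₀ R u) (hc.dual (ContinuousLinearMap.id ℂ L2))
  refine ⟨P.codRestrict _ fun f => (hP f).1, fun f h hh => ?_⟩
  rw [map_sub, Pi.sub_apply, sub_eq_zero]
  exact ((hP f).2 h hh).symm

end LightLine

end

theorem mainTheorem2 (ε₀ : ℝ) (hε₀ : 1 < ε₀) (R : Set LightLine.Plane) (hR : IsOpen R)
    (hne : R.Nonempty) (hRcell : closure R ⊆ LightLine.cell) :
    (∃ C : ℝ, 0 < C ∧ ∀ ε : ℝ, 0 < ε → ε < 1 → ∀ θ ∈ LightLine.dualCell, ∀ F : LightLine.Hneg1,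
      (∃! U : LightLine.H1, LightLine.SolvesEps ε₀ R ε θ F U) ∧
      (∃! W : LightLine.H1, LightLine.SolvesLimit ε₀ R θ F W) ∧
      ∀ U W : LightLine.H1, LightLine.SolvesEps ε₀ R ε θ F U →
        LightLine.SolvesLimit ε₀ R θ F W → ‖U - W‖ ≤ C * ε * ‖F‖) ∧
    (∃ C : ℝ, 0 < C ∧ ∀ θ ∈ LightLine.dualCell,
      ∃ (S : LightLine.Hspace R θ →L[ℂ] LightLine.Hspace R θ)
        (P : LightLine.L2 →L[ℂ] LightLine.Hspace R θ),
        LightLine.IsResolvent (LightLine.B ε₀ R θ) S ∧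
        LightLine.IsOrthogonalProjection (LightLine.cForm ε₀ R) (LightLine.Hspace R θ) P ∧
        ∀ ε : ℝ, 0 < ε → ε < 1 → ∃ Sε : LightLine.L2 →L[ℂ] LightLine.L2,
          LightLine.IsResolvent (LightLine.Beps ε₀ R ε θ) Sε ∧
          ‖Sε - (LightLine.Hspace R θ).subtypeL ∘L S ∘L P‖ ≤ C * ε) := by
  have hRm := hR.measurableSet
  have hpos := LightLine.measureReal_pos hR hne hRcell
  set C := LightLine.errorConst (LightLine.gapConst R) (LightLine.boundConst ε₀)
    (LightLine.coerConst ε₀)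
  have hC : 0 < C := LightLine.errorConst_pos (LightLine.gapConst_nonneg R)
    (LightLine.boundConst_nonneg hε₀) (LightLine.coerConst_pos hε₀)
  refine ⟨⟨C, hC, fun ε h0 h1 θ hθ F => ⟨LightLine.existsUnique_solvesEps hε₀ h0 h1 hRm θ F,
    LightLine.existsUnique_solvesLimit hε₀ hRm hpos hθ F, fun U W hU hW =>
      LightLine.norm_solution_sub_le hε₀ h0 h1 hRm hpos hθ hU hW⟩⟩, ?_⟩
  refine ⟨C * ε₀, by positivity, fun θ hθ => ?_⟩
  obtain ⟨T, S, hS, hST, hT⟩ := LightLine.exists_resolvent_B hε₀ hRm hpos hθ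
  obtain ⟨P, hP⟩ := LightLine.exists_orthogonalProjection hε₀ R θ
  refine ⟨S, P, hS, hP, fun ε h0 h1 => ?_⟩
  obtain ⟨Tε, hTε, hsol⟩ := LightLine.exists_resolvent_Beps hε₀ h0 h1 hRm θ
  refine ⟨_, hTε, ContinuousLinearMap.opNorm_le_bound _ (by positivity) fun f => ?_⟩
  -- `P f` and `f` define the same functional on `V(θ)`
  have hlim : LightLine.SolvesLimit ε₀ R θ (LightLine.cDual hε₀ R f) (T (P f)) := by
    refine ⟨(hT _).1, fun ψ hψ => ((hT _).2 ψ hψ).trans ?_⟩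
    have h := hP f (LightLine.toL2 ψ) (Submodule.le_topologicalClosure _ ⟨ψ, hψ, rfl⟩)
    rw [map_sub, Pi.sub_apply, sub_eq_zero] at h
    exact h.symm
  have e : (LightLine.toL2L ∘L Tε - (LightLine.Hspace R θ).subtypeL ∘L S ∘L P) f
      = LightLine.toL2 (Tε f - T (P f)) := by
    rw [map_sub, ← hST]; rfl
  rw [e]
  calc ‖LightLine.toL2 (Tε f - T (P f))‖ ≤ ‖Tε f - T (P f)‖ := LightLine.norm_toL2_le _
    _ ≤ C * ε * ‖LightLine.cDual hε₀ R f‖ :=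
        LightLine.norm_solution_sub_le hε₀ h0 h1 hRm hpos hθ (hsol f) hlim
    _ ≤ C * ε * (ε₀ * ‖f‖) := by gcongr; exact LightLine.norm_cDual_le hε₀ R f
    _ = C * ε₀ * ε * ‖f‖ := by ring
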